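/- **Conventions.** A knot projection is (the image of) a generic immersed closed curve $P$ on the sphere $S^2$ with at least one double point, considered up to homeomorphism of $S^2$; equivalently, a connected 4-valent map on $S^2$ all of whose edges form one closed curve going straight through the vertices. A double point $v$ is nugatory if some circle on $S^2$ meets $P$ only in $v$, where it passes from one corner to the opposite corner; $P$ is reducible if it has a nugatory double point, and reduced otherwise. A non-Seifert splice at $v$ removes $v$ by joining the two outgoing branches to each other and the two incoming branches to each other (for any orientation of $P$); the result is again a one-component curve. The reductivity $r(P)$ is the least number of non-Seifert splices, applied one after the other, that turn $P$ into a reducible knot projection. An oriented simple closed curve $\gamma\subset S^2$ *passes straight* through a double point $x$ if it goes from a corner at $x$ to the opposite corner. Then $\gamma$ has two branches of $P$ at $x$ on each of its two sides; on one side (chosen freely) call the front one (in the direction of $\gamma$) $F_x$ and the back one $B_x$, and on the other side call them $f_x$ and $b_x$. If $\gamma$ meets $P$ only in double points, the double points on $\gamma$ cut $P$ into arcs that join these branches in pairs; write $F_xB_y$ if an arc joins $F_x$ to $B_y$, and so on. *Two-point circle.* A $\gamma$ that meets $P$ in exactly two double points $x,y$, passing straight through both, with arcs $F_xF_y,\ B_xB_y$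 and $f_xb_y,\ b_xf_y$. *Three-point circle.* A $\gamma$ that meets $P$ in exactly three double points in one of the following five configurations. Triangular configurations: $\gamma$ passes straight through $x,y,z$, in this order, with arcs 1. $F_xF_y,\ B_xF_z,\ B_yB_z$ and $f_xf_y,\ b_xb_z,\ b_yf_z$; or 2. $F_xF_y,\ B_xF_z,\ B_yB_z$ and $f_xb_y,\ f_yb_z,\ f_zb_x$; or 3. $F_xF_y,\ B_xB_z,\ B_yF_z$ and $f_xb_z,\ f_yb_x,\ f_zb_y$. Loop configurations: $\gamma$ passes straight through $x,y$ and, between them, touches $P$ in a double point $c$ (it visits one corner at $c$ and returns to the same face, so that all four branches at $c$ are on one side of $\gamma$). On one side an arc of $P$ joins $F_x$ to $B_x$ through $c$ and another arc joins $F_y$ to $B_y$ through $c$, so that these two loops cross at $c$; on the other side there are the arcs 4. $f_xb_y,\ b_xf_y$; or 5. $f_xf_y,\ b_xb_y$. **Theorem.** Let $P$ be a reduced knot projection. Then $P$ has a two-point circle if and only if $r(P)=1$. Moreover, $r(P)=2$ if and only if $P$ has no two-point circle and $P$ has a three-point circle. The last equivalence also holds when, in the two loop configurations, $\gamma$ is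 only required to meet $P$ in the double points $x,y$, and the crossing $c\ne x,y$ of the two loops may lie anywhere on that side of $\gamma$. -/

import Mathlib

universe u

/-- A 4-valent map on a closed oriented surface, given by its rotation system.  `V` is the set of
vertices; the four branches at a vertex `v` are `(v, 0), (v, 1), (v, 2), (v, 3)`, in
counterclockwise order, and `edge` sends each branch to the branch at the other end of the same
edge.  The corner at `v` between the branches `(v, i)` and `(v, i + 1)` is also denoted `(v, i)`. -/
structure FourValentMap where
  V : Type u
  [fintypeV : Fintype V]
  edge : Equiv.Perm (V × ZMod 4)
  edge_edge : ∀ d, edge (edge d) = d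
  edge_ne : ∀ d, edge d ≠ d

namespace FourValentMap

/-- A branch at a double point (equivalently, an edge leaving it). -/
abbrev Dart (P : FourValentMap.{u}) : Type u := P.V × ZMod 4

/-- Rotation of the branches at each vertex by `k` counterclockwise quarter turns. -/
def turn (P : FourValentMap.{u}) (k : ZMod 4) : Equiv.Perm P.Dart :=
  (Equiv.refl P.V).prodCongr (Equiv.addRight k)

/-- The opposite branch (or the opposite corner) at the same double point. -/
def opp (P : FourValentMap.{u}) : Equiv.Perm P.Dart := P.turn 2

/-- Follow the curve along the edge that leaves by `d`, pass straight through the double point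
that is met, and return the branch by which that double point is left. -/
def straight (P : FourValentMap.{u}) : Equiv.Perm P.Dart := P.edge.trans P.opp

/-- One step along the boundary of a face, with the face on the left-hand side: from a corner to
the next corner of the same face. -/
def faceStep (P : FourValentMap.{u}) : Equiv.Perm P.Dart := P.edge.trans (P.turn (-1))

/-- The two corners belong to the same face. -/
def SameFace (P : FourValentMap.{u}) (x y : P.Dart) : Prop := P.faceStep.SameCycle x y

/-- The set of faces: the orbits of corners under `faceStep`. -/
def Face (P : FourValentMap.{u}) : Type u := Quotient (Equiv.Perm.SameCycle.setoid P.faceStep)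

end FourValentMap

/-- A knot projection (with at least one double point) up to homeomorphism of the sphere: a
4-valent map all of whose edges lie on one closed curve going straight through the double points,
and which lies on the sphere.  There are `2 * card V` edges, so Euler's formula
`card V - 2 * card V + #faces = 2` reads `#faces = card V + 2`. -/
structure KnotProjection extends FourValentMap.{u} where
  nonempty : Nonempty V
  one_component : ∀ d e, toFourValentMap.straight.SameCycle d e ∨
    toFourValentMap.straight.SameCycle d (edge e)
  spherical : Nat.card toFourValentMap.Face = Nat.card V + 2

namespace KnotProjection

/-! ### Reducible projections -/

/-- The double point `v` is nugatory: there is a circle on the sphere that meets the projection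
only in `v`, where it passes from one corner to the opposite corner; that is, two opposite corners
at `v` belong to the same face. -/
def IsNugatory (P : KnotProjection.{u}) (v : P.V) : Prop :=
  ∃ i : ZMod 4, P.SameFace (v, i) (P.opp (v, i))

def IsReducible (P : KnotProjection.{u}) : Prop := ∃ v, P.IsNugatory v

def IsReduced (P : KnotProjection.{u}) : Prop := ¬ P.IsReducible

/-! ### Non-Seifert splices and reductivity -/

/-- An orientation of the curve: `o d = true` if the curve leaves the double point by the branch
`d`, and `o d = false` if it arrives by `d`. -/
def IsOrientation (P : KnotProjection.{u}) (o : P.Dart → Bool) : Prop :=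
  (∀ d, o (P.edge d) = !o d) ∧ ∀ d, o (P.opp d) = !o d

/-- The two ways to splice a double point: its four branches are joined in two pairs of
neighbouring branches. -/
def IsSmoothing (m : ZMod 4 → ZMod 4) : Prop :=
  (∀ i, m (m i) = i) ∧ ∀ i, m i = i + 1 ∨ m i = i - 1

/-- After the double point `v` has been removed and its branch `i` has been joined to its branch
`m i`, the edge that leaves by `d` ends at `e`. -/
inductive SpliceEdge (P : KnotProjection.{u}) (v : P.V) (m : ZMod 4 → ZMod 4) :
    P.Dart → P.Dart → Prop
  | direct (d : P.Dart) (h : (P.edge d).1 ≠ v) : SpliceEdge P v m d (P.edge d)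
  | through (d e : P.Dart) (h : (P.edge d).1 = v) (t : SpliceEdge P v m (v, m (P.edge d).2) e) :
      SpliceEdge P v m d e

/-- `Q` is obtained from `P` by a non-Seifert splice at one double point `v`: at `v` the two
outgoing branches are joined to each other, and the two incoming branches are joined to each
other. -/
def IsNonSeifertSplice (P Q : KnotProjection.{u}) : Prop :=
  ∃ (v : P.V) (m : ZMod 4 → ZMod 4) (o : P.Dart → Bool),
    IsSmoothing m ∧ P.IsOrientation o ∧ (∀ i, o (v, m i) = o (v, i)) ∧
    ∃ f : Q.V ≃ {w : P.V // w ≠ v}, ∀ d : Q.Dart,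
      P.SpliceEdge v m ((f d.1 : P.V), d.2) ((f (Q.edge d).1 : P.V), (Q.edge d).2)

/-- `Q` is obtained from `P` by `n` non-Seifert splices, applied one after the other. -/
inductive Splices : ℕ → KnotProjection.{u} → KnotProjection.{u} → Prop
  | zero (P : KnotProjection.{u}) : Splices 0 P P
  | succ {n : ℕ} {P Q R : KnotProjection.{u}} (h : IsNonSeifertSplice P Q) (t : Splices n Q R) :
      Splices (n + 1) P R

/-- Shimizu's reductivity (`⊤` if no reducible projection can be reached). -/
noncomputable def reductivity (P : KnotProjection.{u}) : ℕ∞ :=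
  sInf {x : ℕ∞ | ∃ (n : ℕ) (Q : KnotProjection.{u}), x = n ∧ Splices n P Q ∧ Q.IsReducible}

/-! ### Circles that meet the projection in double points only

An oriented circle passing straight through the double point `v` arrives in a corner `(v, i + 2)`
and leaves by the opposite corner `x = (v, i)`; it is recorded by `x`.  On its left-hand side it has
the branches `i + 1` (the front one, next to the corner of departure) and `i + 2` (the back one); on
its right-hand side it has the branches `i` (front) and `i + 3` (back).  Between two consecutive
double points the circle runs inside a face.  The faces that it runs through are required to be
distinct, so the curve is simple.  This loses nothing for reduced projections: if two of the (at
most three) faces were equal, opposite corners at some double point would lie in one face. -/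

/-- The front branch on the left-hand (`s = true`) or right-hand (`s = false`) side. -/
def front (P : KnotProjection.{u}) (s : Bool) (x : P.Dart) : P.Dart :=
  P.turn (if s then 1 else 0) x

/-- The back branch on the left-hand (`s = true`) or right-hand (`s = false`) side. -/
def back (P : KnotProjection.{u}) (s : Bool) (x : P.Dart) : P.Dart :=
  P.turn (if s then 2 else 3) x

/-- A circle that passes straight through the double points of the corners `x`, `y` and meets the
projection nowhere else. -/
def TwoCircle (P : KnotProjection.{u}) (x y : P.Dart) : Prop :=
  x.1 ≠ y.1 ∧ P.SameFace x (P.opp y) ∧ P.SameFace y (P.opp x) ∧ ¬ P.SameFace x y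

/-- A circle that passes straight through the double points of the corners `x`, `y`, `z`, in this
order, and meets the projection nowhere else. -/
def ThreeCircle (P : KnotProjection.{u}) (x y z : P.Dart) : Prop :=
  (x.1 ≠ y.1 ∧ y.1 ≠ z.1 ∧ z.1 ≠ x.1) ∧
  (P.SameFace x (P.opp y) ∧ P.SameFace y (P.opp z) ∧ P.SameFace z (P.opp x)) ∧
  ¬ P.SameFace x y ∧ ¬ P.SameFace y z ∧ ¬ P.SameFace z x

/-- A circle that passes straight through the double points of the corners `x`, `y`, touches the
projection in the double point `c` (between `x` and `y`, it visits a corner at `c` and returns to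
the same face, leaving all four branches of `c` on one side), and meets it nowhere else. -/
def TouchingCircle (P : KnotProjection.{u}) (x y : P.Dart) (c : P.V) : Prop :=
  P.TwoCircle x y ∧ c ≠ x.1 ∧ c ≠ y.1 ∧ ∃ j : ZMod 4, P.SameFace x (c, j)

/-- The arc of the curve that leaves by the branch `d`, going straight through all double points
outside `S`, reaches `S` for the first time by the branch `e`. -/
inductive Arc (P : KnotProjection.{u}) (S : Set P.V) : P.Dart → P.Dart → Prop
  | arrive (d : P.Dart) (h : (P.edge d).1 ∈ S) : Arc P S d (P.edge d)
  | pass (d e : P.Dart) (h : (P.edge d).1 ∉ S) (t : Arc P S (P.opp (P.edge d)) e) : Arc P S d e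

/-- On the side `s` of the circle, the front branches at `x` and `y` are joined by an arc, and so
are the back branches. -/
def CrossedPair (P : KnotProjection.{u}) (S : Set P.V) (s : Bool) (x y : P.Dart) : Prop :=
  P.Arc S (P.front s x) (P.front s y) ∧ P.Arc S (P.back s x) (P.back s y)

/-- On the side `s` of the circle, the front branch at each of `x`, `y` is joined by an arc to the
back branch at the other one. -/
def ParallelPair (P : KnotProjection.{u}) (S : Set P.V) (s : Bool) (x y : P.Dart) : Prop :=
  P.Arc S (P.front s x) (P.back s y) ∧ P.Arc S (P.back s x) (P.front s y)

/-- The circle with two double points: crossed arcs on one side, parallel arcs on the other. -/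
def HasTwoPointCircle (P : KnotProjection.{u}) : Prop :=
  ∃ (x y : P.Dart) (s : Bool), P.TwoCircle x y ∧
    P.CrossedPair {x.1, y.1} s x y ∧ P.ParallelPair {x.1, y.1} (!s) x y

/-- On the side `s`, an arc joins the two branches at `x` and another arc joins the two branches at
`y`; these arcs cross at `c`. -/
def LoopsCrossingAt (P : KnotProjection.{u}) (c : P.V) (s : Bool) (x y : P.Dart) : Prop :=
  ∃ p q : ZMod 4,
    P.Arc {x.1, y.1, c} (P.front s x) (c, p) ∧ P.Arc {x.1, y.1, c} (P.back s x) (c, p + 2) ∧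
    P.Arc {x.1, y.1, c} (P.front s y) (c, q) ∧ P.Arc {x.1, y.1, c} (P.back s y) (c, q + 2)

/-- First loop configuration: loops crossing at `c` on one side, parallel arcs on the other. -/
def LoopsParallel (P : KnotProjection.{u}) (x y : P.Dart) (c : P.V) : Prop :=
  ∃ s : Bool, P.LoopsCrossingAt c s x y ∧ P.ParallelPair {x.1, y.1, c} (!s) x y

/-- Second loop configuration: loops crossing at `c` on one side, crossed arcs on the other. -/
def LoopsCrossed (P : KnotProjection.{u}) (x y : P.Dart) (c : P.V) : Prop :=
  ∃ s : Bool, P.LoopsCrossingAt c s x y ∧ P.CrossedPair {x.1, y.1, c} (!s) x y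

/-- First triangular configuration. -/
def TriangleOne (P : KnotProjection.{u}) (x y z : P.Dart) : Prop :=
  ∃ s : Bool,
    (P.Arc {x.1, y.1, z.1} (P.front s x) (P.front s y) ∧
      P.Arc {x.1, y.1, z.1} (P.back s x) (P.front s z) ∧
      P.Arc {x.1, y.1, z.1} (P.back s y) (P.back s z)) ∧
    P.Arc {x.1, y.1, z.1} (P.front (!s) x) (P.front (!s) y) ∧
      P.Arc {x.1, y.1, z.1} (P.back (!s) x) (P.back (!s) z) ∧
      P.Arc {x.1, y.1, z.1} (P.back (!s) y) (P.front (!s) z)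

/-- Second triangular configuration. -/
def TriangleTwo (P : KnotProjection.{u}) (x y z : P.Dart) : Prop :=
  ∃ s : Bool,
    (P.Arc {x.1, y.1, z.1} (P.front s x) (P.front s y) ∧
      P.Arc {x.1, y.1, z.1} (P.back s x) (P.front s z) ∧
      P.Arc {x.1, y.1, z.1} (P.back s y) (P.back s z)) ∧
    P.Arc {x.1, y.1, z.1} (P.front (!s) x) (P.back (!s) y) ∧
      P.Arc {x.1, y.1, z.1} (P.front (!s) y) (P.back (!s) z) ∧
      P.Arc {x.1, y.1, z.1} (P.front (!s) z) (P.back (!s) x)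

/-- Third triangular configuration. -/
def TriangleThree (P : KnotProjection.{u}) (x y z : P.Dart) : Prop :=
  ∃ s : Bool,
    (P.Arc {x.1, y.1, z.1} (P.front s x) (P.front s y) ∧
      P.Arc {x.1, y.1, z.1} (P.back s x) (P.back s z) ∧
      P.Arc {x.1, y.1, z.1} (P.back s y) (P.front s z)) ∧
    P.Arc {x.1, y.1, z.1} (P.front (!s) x) (P.back (!s) z) ∧
      P.Arc {x.1, y.1, z.1} (P.front (!s) y) (P.back (!s) x) ∧
      P.Arc {x.1, y.1, z.1} (P.front (!s) z) (P.back (!s) y)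

/-- A circle that passes straight through three double points, in a triangular configuration. -/
def HasTriangleCircle (P : KnotProjection.{u}) : Prop :=
  ∃ x y z : P.Dart, P.ThreeCircle x y z ∧
    (P.TriangleOne x y z ∨ P.TriangleTwo x y z ∨ P.TriangleThree x y z)

/-- A circle that meets the projection in exactly three double points, in one of the five
configurations.  In the loop configurations the circle touches the projection in the double point
where the two loops cross. -/
def HasThreePointCircle (P : KnotProjection.{u}) : Prop :=
  P.HasTriangleCircle ∨
  ∃ (x y : P.Dart) (c : P.V), P.TouchingCircle x y c ∧ (P.LoopsParallel x y c ∨ P.LoopsCrossed x y c)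

/-- The variant of `HasThreePointCircle` in which, in the two loop configurations, the third double
point, where the two loops cross, may be anywhere inside the disk bounded by the circle. -/
def HasThreePointDisk (P : KnotProjection.{u}) : Prop :=
  P.HasTriangleCircle ∨
  ∃ (x y : P.Dart) (c : P.V), P.TwoCircle x y ∧ c ≠ x.1 ∧ c ≠ y.1 ∧
    (P.LoopsParallel x y c ∨ P.LoopsCrossed x y c)

end KnotProjection

-- A splice at `v` merges two opposite corners at `v`, hence the two faces containing them, and
-- changes no other face. If it creates a nugatory double point `x`, the circle of `x` must run
-- through the merged face; seen in the original projection it is a circle passing straight through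
-- `x` and `v`. In the same way, the circle of a double point that becomes nugatory after two
-- splices comes either from a circle through two double points that misses the first splice, or
-- from one through all three.
--
-- Such a circle separates the curve. On the sphere this is the vanishing of the first cohomology,
-- obtained by a dimension count from Euler's formula (`exists_coboundary`, `exists_sides`). Hence
-- the double points on the circle cut the curve into arcs that stay on one side each, and only
-- finitely many pairings of branches are possible. They are restricted by two principles. First,
-- the curve has one component, so two arcs cannot join opposite pairs of branches at two double
-- points (`Arc.not_opp`). Second, directions alternate between the ends of an arc, and a splice at
-- `v` is non-Seifert exactly if the two branches at `v` on one side of the circle have equal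
-- directions (`nonSeifert_iff`).
--
-- For one splice, these principles leave crossed arcs on one side and parallel arcs on the other
-- (`hasTwoPointCircle_iff`). For two splices, the direction function of the intermediate projection
-- is pulled back to the original branches (`SplicedOrientation`), giving a second constraint. If
-- the circle passes through all three double points, each side has three arcs, one between each two
-- of the points; the remaining pairings are checked exhaustively and are the three triangular
-- configurations (`triangleMate_cases`). If the circle misses the first splice, and there is no
-- two-point circle, then one side consists of loops, and the second direction function forces both
-- loops to pass through the first spliced point, where they cross
-- (`hasThreePointDisk_of_twoCircle`).
--
-- Conversely, each configuration determines enough directions to show that two suitable splices are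
-- non-Seifert and produce a nugatory point (`exists_two_splices`). Finally, a crossing of the loops
-- anywhere inside the disk may be replaced by one touched by the circle: a face traversed by the
-- circle has the loop at `x` at one end of its boundary walk and the loop at `y` at the other, so
-- some double point on that walk belongs to both (`exists_touchingCircle`).

attribute [instance] FourValentMap.fintypeV

/-! ### Cycles of permutations. -/

theorem Equiv.Perm.SameCycle.induct {α : Type*} [Finite α] {f : Equiv.Perm α} {x y : α}
    (h : f.SameCycle x y) (C : α → Prop) (step : ∀ z, C z → C (f z)) (hx : C x) : C y := by
  obtain ⟨i, rfl⟩ := h.exists_nat_pow_eq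
  clear h
  induction i with
  | zero => exact hx
  | succ n ih => rw [pow_succ', Equiv.Perm.mul_apply]; exact step _ ih

/-- Composing a permutation with a transposition of points of two different cycles merges these
cycles. -/
theorem Equiv.Perm.sameCycle_swap_mul {α : Type*} [Finite α] [DecidableEq α] {f : Equiv.Perm α}
    {a b : α} (hab : ¬ f.SameCycle a b) (x y : α) :
    (Equiv.swap a b * f).SameCycle x y ↔
      f.SameCycle x y ∨ (f.SameCycle x a ∧ f.SameCycle b y) ∨
        (f.SameCycle x b ∧ f.SameCycle a y) := by
  have key : (Equiv.swap a b * f).SameCycle a b := by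
    have hex : ∃ k : ℕ, (f ^ (k + 1)) a = a := ⟨orderOf f - 1, by
      rw [Nat.sub_add_cancel (orderOf_pos f), pow_orderOf_eq_one]; rfl⟩
    classical
    -- Before `f` first returns to `a`, its iterates of `a` avoid `a`, and they avoid `b` because
    -- `b` is on another cycle, so the swap has no effect. At the return, `Nat.find hex + 1` steps
    -- after the start, the swap sends `a` to `b`.
    have hmin : ∀ j, j ≤ Nat.find hex → ((Equiv.swap a b * f) ^ j) a = (f ^ j) a := by
      intro j hj
      induction j with
      | zero => rfl
      | succ j ih =>
        rw [pow_succ', Equiv.Perm.mul_apply, ih (by omega), Equiv.Perm.mul_apply,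
          ← Equiv.Perm.mul_apply f, ← pow_succ']
        refine Equiv.swap_apply_of_ne_of_ne (Nat.find_min hex hj) ?_
        intro h
        exact hab ⟨(j + 1 : ℕ), by rw [zpow_natCast]; exact h⟩
    refine ⟨(Nat.find hex + 1 : ℕ), ?_⟩
    rw [zpow_natCast, pow_succ', Equiv.Perm.mul_apply, hmin _ le_rfl, Equiv.Perm.mul_apply,
      ← Equiv.Perm.mul_apply f, ← pow_succ', Nat.find_spec hex, Equiv.swap_apply_left]
  have step : ∀ z, (Equiv.swap a b * f).SameCycle z (f z) := by
    intro z
    have h1 : (Equiv.swap a b * f).SameCycle z (Equiv.swap a b (f z)) :=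
      Equiv.Perm.SameCycle.rfl.apply_right
    by_cases ha : f z = a
    · rw [ha] at h1 ⊢; rw [Equiv.swap_apply_left] at h1; exact h1.trans key.symm
    by_cases hb : f z = b
    · rw [hb] at h1 ⊢; rw [Equiv.swap_apply_right] at h1; exact h1.trans key
    rwa [Equiv.swap_apply_of_ne_of_ne ha hb] at h1
  have up : ∀ {x y}, f.SameCycle x y → (Equiv.swap a b * f).SameCycle x y := fun {x y} h =>
    h.induct (fun y => (Equiv.swap a b * f).SameCycle x y) (fun z hz => hz.trans (step z))
      Equiv.Perm.SameCycle.rfl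
  constructor
  · intro h
    refine h.induct (fun y => f.SameCycle x y ∨ (f.SameCycle x a ∧ f.SameCycle b y) ∨
        (f.SameCycle x b ∧ f.SameCycle a y)) (fun z hz => ?_) (Or.inl Equiv.Perm.SameCycle.rfl)
    rw [Equiv.Perm.mul_apply]
    have hzz : f.SameCycle z (f z) := Equiv.Perm.SameCycle.rfl.apply_right
    by_cases ha : f z = a
    · rw [ha] at hzz ⊢; rw [Equiv.swap_apply_left]
      rcases hz with h | ⟨h1, h2⟩ | ⟨h1, h2⟩
      · exact Or.inr (Or.inl ⟨h.trans hzz, Equiv.Perm.SameCycle.rfl⟩)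
      · exact absurd (h2.trans hzz).symm hab
      · exact Or.inl h1
    by_cases hb : f z = b
    · rw [hb] at hzz ⊢; rw [Equiv.swap_apply_right]
      rcases hz with h | ⟨h1, h2⟩ | ⟨h1, h2⟩
      · exact Or.inr (Or.inr ⟨h.trans hzz, Equiv.Perm.SameCycle.rfl⟩)
      · exact Or.inl h1
      · exact absurd (h2.trans hzz) hab
    rw [Equiv.swap_apply_of_ne_of_ne ha hb]
    rcases hz with h | ⟨h1, h2⟩ | ⟨h1, h2⟩
    · exact Or.inl (h.trans hzz)
    · exact Or.inr (Or.inl ⟨h1, h2.trans hzz⟩)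
    · exact Or.inr (Or.inr ⟨h1, h2.trans hzz⟩)
  · rintro (h | ⟨h1, h2⟩ | ⟨h1, h2⟩)
    · exact up h
    · exact (up h1).trans (key.trans (up h2))
    · exact (up h1).trans (key.symm.trans (up h2))

theorem zmod_four_cases : ∀ k : ZMod 4, k = 0 ∨ k = 1 ∨ k = 2 ∨ k = 3 := by decide

/-! ### Rotations of branches and faces. -/

namespace FourValentMap
variable {P : FourValentMap.{u}}

theorem turn_apply (k : ZMod 4) (d : P.Dart) : P.turn k d = (d.1, d.2 + k) := rfl

theorem turn_fst (k : ZMod 4) (d : P.Dart) : (P.turn k d).1 = d.1 := rfl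

theorem opp_apply (d : P.Dart) : P.opp d = (d.1, d.2 + 2) := rfl

theorem opp_fst (d : P.Dart) : (P.opp d).1 = d.1 := rfl

theorem opp_opp (d : P.Dart) : P.opp (P.opp d) = d := by
  simp only [opp_apply, add_assoc, (by decide : (2 + 2 : ZMod 4) = 0), add_zero]

theorem opp_ne (d : P.Dart) : P.opp d ≠ d := fun h => by
  have h2 := congrArg Prod.snd h
  exact absurd (add_eq_left.mp h2) (by decide)

theorem turn_opp (k : ZMod 4) (d : P.Dart) : P.turn k (P.opp d) = P.turn (k + 2) d := by
  simp only [opp_apply, turn_apply]; congr 1; ring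

theorem opp_turn (k : ZMod 4) (d : P.Dart) : P.opp (P.turn k d) = P.turn (k + 2) d := by
  simp only [opp_apply, turn_apply]; congr 1; ring

theorem turn_zero (d : P.Dart) : P.turn 0 d = d := by simp [turn_apply]

theorem turn_turn (k l : ZMod 4) (d : P.Dart) : P.turn k (P.turn l d) = P.turn (l + k) d := by
  simp only [turn_apply, add_assoc]

theorem turn_inj {k l : ZMod 4} {d : P.Dart} : P.turn k d = P.turn l d ↔ k = l := by
  simp [turn_apply]

theorem eq_turn {d e : P.Dart} (h : d.1 = e.1) : d = P.turn (d.2 - e.2) e := by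
  rw [turn_apply]; ext <;> simp [h]

theorem straight_apply (d : P.Dart) : P.straight d = P.opp (P.edge d) := rfl

theorem faceStep_apply (d : P.Dart) : P.faceStep d = P.turn (-1) (P.edge d) := rfl

theorem edge_eq_iff {d e : P.Dart} : P.edge d = e ↔ d = P.edge e :=
  ⟨fun h => by rw [← h, P.edge_edge], fun h => by rw [h, P.edge_edge]⟩

theorem SameFace.refl (d : P.Dart) : P.SameFace d d := Equiv.Perm.SameCycle.rfl

theorem SameFace.symm {d e : P.Dart} (h : P.SameFace d e) : P.SameFace e d :=
  Equiv.Perm.SameCycle.symm h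

theorem SameFace.trans {d e f : P.Dart} (h : P.SameFace d e) (h' : P.SameFace e f) :
    P.SameFace d f :=
  Equiv.Perm.SameCycle.trans h h'

theorem sameFace_faceStep (d : P.Dart) : P.SameFace d (P.faceStep d) :=
  Equiv.Perm.SameCycle.rfl.apply_right

theorem sameFace_turn_edge (d : P.Dart) : P.SameFace d (P.turn (-1) (P.edge d)) :=
  sameFace_faceStep d

end FourValentMap

/-! ### Consequences of having one component: orientations, absence of loop edges. -/

namespace KnotProjection
open FourValentMap
variable {P : KnotProjection.{u}}

/-- A nonempty set of branches that is closed under passing along edges and straight through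
double points contains all branches. -/
theorem of_closed (K : P.Dart → Prop) (he : ∀ d, K d → K (P.edge d))
    (ho : ∀ d, K d → K (P.opp d)) {d : P.Dart} (hd : K d) (e : P.Dart) : K e := by
  have hs : ∀ z, K z → K (P.straight z) := fun z hz => ho _ (he _ hz)
  rcases P.one_component d e with h | h
  · exact h.induct K hs hd
  · rw [← P.edge_edge e]; exact he _ (h.induct K hs hd)

/-- Reversing the direction of travel conjugates `straight` into its inverse. -/
theorem edge_straight_pow (n : ℕ) (d : P.Dart) :
    (P.straight ^ n) (P.edge ((P.straight ^ n) d)) = P.edge d := by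
  induction n generalizing d with
  | zero => rfl
  | succ n ih =>
    have h := ih (P.straight d)
    have e : (P.straight ^ (n + 1)) d = (P.straight ^ n) (P.straight d) := by
      rw [pow_succ, Equiv.Perm.mul_apply]
    rw [e, pow_succ', Equiv.Perm.mul_apply, h, straight_apply, straight_apply, P.edge_edge, opp_opp]

/-- If the curve ran through an edge in both directions, the middle of the walk between the two
passages would be a fixed point of `edge` (even length) or of `opp` (odd length). -/
theorem not_sameCycle_edge (d : P.Dart) : ¬ P.straight.SameCycle d (P.edge d) := by
  intro h
  obtain ⟨n, hn⟩ := h.exists_nat_pow_eq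
  obtain ⟨j, rfl | rfl⟩ := n.even_or_odd'
  · apply P.edge_ne ((P.straight ^ j) d)
    apply (P.straight ^ j).injective
    rw [edge_straight_pow, ← hn, two_mul, pow_add, Equiv.Perm.mul_apply]
  · apply opp_ne (P.edge ((P.straight ^ j) d))
    apply (P.straight ^ j).injective
    rw [edge_straight_pow, ← hn, two_mul, pow_succ, pow_add, ← straight_apply]
    simp only [← Equiv.Perm.mul_apply, ← pow_succ, ← pow_succ', ← pow_add]
    congr 1

theorem exists_orientation (P : KnotProjection.{u}) : ∃ o, P.IsOrientation o := by
  classical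
  obtain ⟨v⟩ := P.nonempty
  set d0 : P.Dart := (v, 0)
  have key : ∀ d, decide (P.straight.SameCycle d0 (P.edge d)) =
      !decide (P.straight.SameCycle d0 d) := fun d => by
    rcases P.one_component d0 d with h | h
    · have h' : ¬ P.straight.SameCycle d0 (P.edge d) := fun h' =>
        not_sameCycle_edge d (h.symm.trans h')
      simp [h, h']
    · have h' : ¬ P.straight.SameCycle d0 d := fun h' =>
        not_sameCycle_edge d (h'.symm.trans h)
      simp [h, h']
  refine ⟨fun d => decide (P.straight.SameCycle d0 d), key, fun d => ?_⟩
  have h : P.straight.SameCycle (P.edge d) (P.opp d) := by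
    have := (Equiv.Perm.SameCycle.refl P.straight (P.edge d)).apply_right
    rwa [straight_apply, P.edge_edge] at this
  rw [← key]
  exact decide_eq_decide.mpr ⟨fun h' => h'.trans h.symm, fun h' => h'.trans h⟩

/-- A reduced projection has no loop edges. -/
theorem edge_fst_ne (hP : P.IsReduced) (d : P.Dart) : (P.edge d).1 ≠ d.1 := by
  -- A loop edge between neighbouring branches bounds a monogon, and the face along its outer side
  -- contains two opposite corners. A loop edge between opposite branches would be a component that
  -- misses the two other branches.
  have h1 : ∀ d, P.edge d ≠ P.turn 1 d := fun d h => by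
    refine hP ⟨d.1, d.2 + 1, ?_⟩
    have h2 := sameFace_turn_edge (P := P.toFourValentMap) (P.turn 1 d)
    rw [← h, P.edge_edge, h] at h2
    have e : P.turn (-1) d = P.opp (P.turn 1 d) := by rw [opp_turn]; rfl
    rwa [e] at h2
  intro h
  obtain ⟨k, hk⟩ : ∃ k, P.edge d = P.turn k d := ⟨_, eq_turn h⟩
  have hk4 := zmod_four_cases k
  rcases hk4 with rfl | rfl | rfl | rfl
  · exact P.edge_ne d (by rw [hk, turn_zero])
  · exact h1 d hk
  · have h2 := of_closed (fun e => e = d ∨ e = P.opp d)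
      (by rintro e (rfl | rfl)
          · exact Or.inr hk
          · exact Or.inl (edge_eq_iff.mpr hk.symm))
      (by rintro e (rfl | rfl)
          · exact Or.inr rfl
          · exact Or.inl (opp_opp _)) (Or.inl rfl) (P.turn 1 d)
    rcases h2 with h2 | h2
    · exact absurd (turn_inj.mp (h2.trans (turn_zero d).symm)) (by decide)
    · exact absurd (turn_inj.mp h2) (by decide)
  · refine h1 (P.edge d) ?_
    rw [P.edge_edge, hk, turn_turn, (by decide : (3 + 1 : ZMod 4) = 0), turn_zero]

theorem not_sameFace_opp (hP : P.IsReduced) (d : P.Dart) : ¬ P.SameFace d (P.opp d) :=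
  fun h => hP ⟨d.1, d.2, h⟩

/-! ### Vanishing of the first cohomology of the sphere. -/

/-- The first cohomology of the sphere vanishes: a function on the corners with even sums around
all double points and all faces is the coboundary of a function on the edges. -/
theorem exists_coboundary (P : KnotProjection.{u}) (g : P.Dart → ZMod 2)
    (hv : ∀ v, ∑ k, g (v, k) = 0)
    (hf : ∀ d, ∑ᶠ e ∈ {e | P.SameFace d e}, g e = 0) :
    ∃ h : P.Dart → ZMod 2, (∀ d, h (P.edge d) = h d) ∧ ∀ d, h (P.turn 1 d) = h d + g d := by
  classical
  have two (a : ZMod 2) : a + a = 0 := CharTwo.add_self_eq_zero a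
  have : Fact (Nat.Prime 2) := ⟨Nat.prime_two⟩
  have : Finite P.Face := Quotient.finite _
  have : Fintype P.Face := Fintype.ofFinite _
  let q : P.Dart → P.Face := Quotient.mk _
  have hq : ∀ d e, q d = q e ↔ P.SameFace d e := fun d e => Quotient.eq
  let n := Fintype.card P.V
  have cardD : Fintype.card P.Dart = 4 * n := by simp [n, ZMod.card, mul_comm]
  have cardF : Fintype.card P.Face = n + 2 := by
    have := P.spherical
    rwa [Nat.card_eq_fintype_card, Nat.card_eq_fintype_card] at this
  let W := P.Dart → ZMod 2
  have rankW : Module.finrank (ZMod 2) W = 4 * n := by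
    rw [Module.finrank_fintype_fun_eq_card, cardD]
  let E : W →ₗ[ZMod 2] W := LinearMap.funLeft _ _ P.edge + LinearMap.id
  let δ : W →ₗ[ZMod 2] W := LinearMap.funLeft _ _ (P.turn 1) + LinearMap.id
  have hE : ∀ h d, E h d = h (P.edge d) + h d := fun h d => rfl
  have hδ : ∀ h d, δ h d = h (P.turn 1 d) + h d := fun h d => rfl
  have eq_of_add (a b : ZMod 2) (h : a + b = 0) : a = b := by
    rw [← sub_eq_zero, CharTwo.sub_eq_add]; exact h
  have memA : ∀ h, h ∈ LinearMap.ker E ↔ ∀ d, h (P.edge d) = h d := fun h => by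
    rw [LinearMap.mem_ker]
    constructor
    · intro h0 d; exact eq_of_add _ _ (congrFun h0 d)
    · intro h0; ext d; rw [hE, h0]; exact two _
  -- In characteristic 2, `E` has square zero, so its range lies in its kernel and the kernel has at
  -- least half of the dimension `4 * n`.
  have dimA : 2 * n ≤ Module.finrank (ZMod 2) (LinearMap.ker E) := by
    have h1 := LinearMap.finrank_range_add_finrank_ker E
    have h2 : LinearMap.range E ≤ LinearMap.ker E := by
      rintro _ ⟨h, rfl⟩
      rw [memA]; intro d; rw [hE, hE, P.edge_edge, add_comm]
    have h3 := Submodule.finrank_mono h2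
    omega
  have hconst : ∀ h : W, (∀ d, h (P.edge d) = h d) → (∀ d, h (P.turn 1 d) = h d) →
      ∀ d e, h d = h e := by
    intro h h1 h2 d e
    refine (of_closed (fun e => h e = h d) (fun e he => (h1 e).trans he) (fun e he => ?_) rfl e).symm
    have : P.opp e = P.turn 1 (P.turn 1 e) := by rw [turn_turn]; rfl
    rw [this, h2, h2, he]
  obtain ⟨v0⟩ := P.nonempty
  -- By connectedness, `δ` kills only the constants among the functions on the edges.
  have dimB : 2 * n ≤ Module.finrank (ZMod 2) ((LinearMap.ker E).map δ) + 1 := by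
    have h1 := LinearMap.finrank_range_add_finrank_ker (δ.domRestrict (LinearMap.ker E))
    rw [LinearMap.range_domRestrict] at h1
    have h2 : Module.finrank (ZMod 2) (LinearMap.ker (δ.domRestrict (LinearMap.ker E))) ≤ 1 := by
      refine finrank_le_one ⟨⟨fun _ => 1, (memA _).mpr fun _ => rfl⟩, ?_⟩ ?_
      · rw [LinearMap.mem_ker]; ext d; exact two 1
      · rintro ⟨⟨h, hA⟩, hk⟩
        refine ⟨h (v0, 0), ?_⟩
        ext d
        show h (v0, 0) * (1 : ZMod 2) = h d
        rw [mul_one]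
        refine hconst h ((memA h).mp hA) (fun d => ?_) _ _
        exact eq_of_add _ _ (congrFun (LinearMap.mem_ker.mp hk) d)
    omega
  let M : Matrix (P.V ⊕ P.Face) P.Dart (ZMod 2) := fun i d =>
    Sum.elim (fun v => if d.1 = v then 1 else 0) (fun F => if q d = F then 1 else 0) i
  have hMv : ∀ (h : W) (v : P.V), M.mulVec h (Sum.inl v) = ∑ k, h (v, k) := fun h v => by
    simp only [Matrix.mulVec, dotProduct, M, Sum.elim_inl, ite_mul, one_mul, zero_mul]
    rw [Fintype.sum_prod_type, Finset.sum_comm]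
    simp
  have hMf : ∀ (h : W) (d : P.Dart), M.mulVec h (Sum.inr (q d)) =
      ∑ᶠ e ∈ {e | P.SameFace d e}, h e := fun h d => by
    simp only [Matrix.mulVec, dotProduct, M, Sum.elim_inr, ite_mul, one_mul, zero_mul]
    rw [← Finset.sum_filter, finsum_mem_eq_finite_toFinset_sum _ (Set.toFinite _)]
    refine Finset.sum_congr ?_ fun _ _ => rfl
    ext e
    simp only [Finset.mem_filter, Finset.mem_univ, true_and, Set.Finite.mem_toFinset,
      Set.mem_ofPred_eq, hq]
    exact ⟨SameFace.symm, SameFace.symm⟩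
  -- Euler's formula enters here: there are `n + (n + 2)` conditions, one for each double point and
  -- each face, with at most one linear relation among them by connectedness. So the cocycles have
  -- dimension at most `2 * n - 1`, the lower bound found for the coboundaries.
  have dimZ : Module.finrank (ZMod 2) (LinearMap.ker M.mulVecLin) + 1 ≤ 2 * n := by
    have h1 := LinearMap.finrank_range_add_finrank_ker M.mulVecLin
    have h2 := LinearMap.finrank_range_add_finrank_ker M.transpose.mulVecLin
    have h3 : M.transpose.rank = M.rank := Matrix.rank_transpose M
    simp only [Matrix.rank] at h3
    have h4 : Module.finrank (ZMod 2) (LinearMap.ker M.transpose.mulVecLin) ≤ 1 := by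
      have hT : ∀ φ d, M.transpose.mulVec φ d = φ (Sum.inl d.1) + φ (Sum.inr (q d)) := fun φ d => by
        show ∑ i, M i d * φ i = _
        rw [Fintype.sum_sum_type]
        simp [M]
      refine finrank_le_one ⟨fun _ => 1, ?_⟩ ?_
      · rw [LinearMap.mem_ker]; ext d
        rw [Matrix.mulVecLin_apply, hT]; exact two 1
      · rintro ⟨φ, hk⟩
        have hφ : ∀ d : P.Dart, φ (Sum.inl d.1) = φ (Sum.inr (q d)) := fun d => by
          have := congrFun (LinearMap.mem_ker.mp hk) d
          rw [Matrix.mulVecLin_apply, hT] at this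
          exact eq_of_add _ _ this
        have hc := hconst (fun d => φ (Sum.inl d.1)) (fun d => by
          have hs : q d = q (P.turn (-1) (P.edge d)) := (hq _ _).mpr (sameFace_turn_edge d)
          show φ (Sum.inl (P.edge d).1) = φ (Sum.inl d.1)
          rw [hφ d, hs, ← hφ]; rfl) (fun d => rfl)
        refine ⟨φ (Sum.inl v0), ?_⟩
        ext i
        simp only [SetLike.mk_smul_mk, Pi.smul_apply, smul_eq_mul, mul_one]
        rcases i with v | F
        · exact hc (v0, 0) (v, 0)
        · obtain ⟨d, rfl⟩ := Quotient.exists_rep F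
          exact (hc (v0, 0) d).trans (hφ d)
    simp only [Module.finrank_fintype_fun_eq_card, Fintype.card_sum, cardD, cardF] at h1 h2
    have hn : Fintype.card P.V = n := rfl
    omega
  have hle : (LinearMap.ker E).map δ ≤ LinearMap.ker M.mulVecLin := by
    rintro _ ⟨h, hA, rfl⟩
    have hA' := (memA h).mp hA
    rw [LinearMap.mem_ker, Matrix.mulVecLin_apply]
    ext i
    rcases i with v | F
    · rw [hMv]
      simp only [hδ, Finset.sum_add_distrib, turn_apply, Pi.zero_apply]
      have e : ∑ k, h (v, k + 1) = ∑ k, h (v, k) :=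
        Equiv.sum_comp (Equiv.addRight (1 : ZMod 4)) (fun k => h (v, k))
      rw [e]; exact two _
    · obtain ⟨d, rfl⟩ := Quotient.exists_rep F
      rw [show (Quotient.mk _ d : P.Face) = q d from rfl, hMf, Pi.zero_apply]
      simp only [hδ]
      rw [finsum_mem_add_distrib (Set.toFinite _)]
      -- Each edge on the boundary of a face borders two successive corners: `turn 1 (faceStep e) =
      -- edge e`.
      have e : ∑ᶠ e ∈ {e | P.SameFace d e}, h (P.turn 1 e) = ∑ᶠ e ∈ {e | P.SameFace d e}, h e := by
        refine (finsum_mem_eq_of_bijOn P.faceStep ⟨?_, P.faceStep.injective.injOn, ?_⟩ ?_).symm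
        · intro e he; exact SameFace.trans he (sameFace_faceStep e)
        · intro e he
          refine ⟨P.faceStep.symm e, ?_, by simp⟩
          have := sameFace_faceStep (P.faceStep.symm e)
          rw [Equiv.apply_symm_apply] at this
          exact SameFace.trans he this.symm
        · intro e _
          rw [faceStep_apply, turn_turn, neg_add_cancel, turn_zero, hA']
      rw [e]; exact two _
  have heq := Submodule.eq_of_le_of_finrank_le hle (Nat.le_of_succ_le_succ (dimZ.trans dimB))
  have hg : g ∈ (LinearMap.ker E).map δ := by
    rw [heq, LinearMap.mem_ker, Matrix.mulVecLin_apply]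
    ext i
    rcases i with v | F
    · rw [hMv]; exact hv v
    · obtain ⟨d, rfl⟩ := Quotient.exists_rep F
      rw [show (Quotient.mk _ d : P.Face) = q d from rfl, hMf]; exact hf d
  obtain ⟨h, hA, rfl⟩ := hg
  refine ⟨h, (memA h).mp hA, fun d => ?_⟩
  rw [hδ, add_comm, add_assoc, two, add_zero]

end KnotProjection

/-! ### Arcs of the curve between chosen double points. -/

namespace KnotProjection
open FourValentMap
variable {P : KnotProjection.{u}} {S T : Set P.V} {d e f : P.Dart}

theorem Arc.mem (h : P.Arc S d e) : e.1 ∈ S := by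
  induction h with
  | arrive d h => exact h
  | pass d e h t ih => exact ih

theorem Arc.unique (h : P.Arc S d e) (h' : P.Arc S d f) : e = f := by
  induction h with
  | arrive d h =>
    cases h' with
    | arrive _ _ => rfl
    | pass _ _ h2 _ => exact absurd h h2
  | pass d e h t ih =>
    cases h' with
    | arrive _ h2 => exact absurd h2 h
    | pass _ _ _ t2 => exact ih t2

/-- The walk back from `e` retraces the arc and then runs along the first edge towards `d`. The
start `d` may lie outside `S`; `Arc.symm` is the case in which it lies in `S`. -/
theorem Arc.extend (h : P.Arc S d e) : P.Arc S (P.edge d) f → P.Arc S e f := by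
  induction h with
  | arrive d h => exact id
  | pass d e h t ih =>
    intro h'
    refine ih (Arc.pass _ _ ?_ ?_)
    · rwa [P.edge_edge]
    · rw [P.edge_edge, opp_opp]; exact h'

theorem Arc.symm (h : P.Arc S d e) (hd : d.1 ∈ S) : P.Arc S e d := by
  apply h.extend
  have h2 : (P.edge (P.edge d)).1 ∈ S := by rwa [P.edge_edge]
  have h3 := Arc.arrive (P.edge d) h2
  rwa [P.edge_edge] at h3

theorem Arc.exists {s : P.V} (hs : s ∈ S) (d : P.Dart) : ∃ e, P.Arc S d e := by
  let K : P.Dart → Prop := fun d => ∃ e, P.Arc S d e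
  have hK : ∀ z, P.straight.SameCycle d z → K z → K d := fun z hz =>
    hz.induct (fun z => K z → K d) (fun z ih => by
      rintro ⟨e, he⟩
      refine ih ?_
      by_cases h : (P.edge z).1 ∈ S
      · exact ⟨_, Arc.arrive z h⟩
      · exact ⟨e, Arc.pass z e h he⟩) id
  rcases P.one_component d (s, 0) with h | h
  · have e1 : P.straight (P.edge (P.opp (s, 0))) = ((s, 0) : P.Dart) := by
      rw [straight_apply, P.edge_edge, opp_opp]
    refine hK (P.edge (P.opp (s, 0))) ?_ ⟨_, Arc.arrive _ ?_⟩
    · rw [← e1] at h; exact Equiv.Perm.sameCycle_apply_right.mp h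
    · rw [P.edge_edge]; exact hs
  · refine hK _ h ⟨_, Arc.arrive _ ?_⟩
    rw [P.edge_edge]; exact hs

theorem Arc.const {α : Type*} {c : P.Dart → α} (he : ∀ d, c (P.edge d) = c d)
    (ho : ∀ d : P.Dart, d.1 ∉ S → c (P.opp d) = c d) (h : P.Arc S d e) : c e = c d := by
  induction h with
  | arrive d h => exact he d
  | pass d e h t ih => rw [ih, ho _ h, he]

theorem Arc.flip {o : P.Dart → Bool} (he : ∀ d, o (P.edge d) = !o d)
    (ho : ∀ d : P.Dart, d.1 ∉ S → o (P.opp d) = !o d) (h : P.Arc S d e) : o e = !o d := by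
  induction h with
  | arrive d h => exact he d
  | pass d e h t ih => rw [ih, ho _ h, he, Bool.not_not]

theorem Arc.flip_orientation {o : P.Dart → Bool} (ho : P.IsOrientation o) (h : P.Arc S d e) :
    o e = !o d :=
  h.flip ho.1 fun d _ => ho.2 d

theorem Arc.irrefl : ¬ P.Arc S d d := fun h => by
  obtain ⟨o, ho⟩ := P.exists_orientation
  have := h.flip_orientation ho
  revert this; cases o d <;> decide

/-- This is `of_closed` for the coarser graph with vertices `S` and arcs as edges: a branch outside
`S` is assigned the status of the branch at which its arc ends. -/
theorem Arc.closed (K : P.Dart → Prop)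
    (hm : ∀ d e : P.Dart, d.1 ∈ S → K d → P.Arc S d e → K e)
    (ho : ∀ d : P.Dart, d.1 ∈ S → K d → K (P.opp d)) (hd : d.1 ∈ S) (hK : K d) (he : e.1 ∈ S) :
    K e := by
  have key := of_closed (P := P) (fun z => ∃ w, P.Arc S z w ∧ K w) ?_ ?_ (d := d) ?_ e
  · obtain ⟨w, hw, hKw⟩ := key
    exact hm _ _ hw.mem hKw (hw.symm he)
  · rintro z ⟨w, hw, hKw⟩
    obtain ⟨w', hw'⟩ := Arc.exists hd (P.edge z)
    exact ⟨w', hw', hm _ _ hw.mem hKw (hw.extend hw')⟩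
  · rintro z ⟨w, hw, hKw⟩
    by_cases hz : z.1 ∈ S
    · obtain ⟨w', hw'⟩ := Arc.exists hd (P.opp z)
      exact ⟨w', hw', hm (P.opp z) _ hz (ho _ hz (hm _ _ hw.mem hKw (hw.symm hz))) hw'⟩
    · obtain ⟨w', hw'⟩ := Arc.exists hd (P.edge z)
      refine ⟨w', ?_, hm _ _ hw.mem hKw (hw.extend hw')⟩
      cases hw' with
      | arrive _ h => rw [P.edge_edge] at h; exact absurd h hz
      | pass _ _ _ t => rwa [P.edge_edge] at t
  · obtain ⟨w, hw⟩ := Arc.exists hd d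
    exact ⟨w, hw, hm _ _ hd hK hw⟩

/-- Forgetting the double points of `T` outside `S` only concatenates arcs: an end in `S` remains an
end, and at any other end the arc is continued straight on. -/
theorem Arc.coarsen (h : P.Arc T d e) (hST : S ⊆ T) :
    (e.1 ∈ S → P.Arc S d e) ∧ (e.1 ∉ S → ∀ f, P.Arc S (P.opp e) f → P.Arc S d f) := by
  induction h with
  | arrive d h => exact ⟨fun h' => Arc.arrive d h', fun h' f hf => Arc.pass d f h' hf⟩
  | pass d e h t ih =>
    have h' : (P.edge d).1 ∉ S := fun h' => h (hST h')
    exact ⟨fun he => Arc.pass _ _ h' (ih.1 he), fun he f hf => Arc.pass _ _ h' (ih.2 he f hf)⟩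

theorem Arc.injective (h : P.Arc S d f) (h' : P.Arc S e f) (hd : d.1 ∈ S) (he : e.1 ∈ S) :
    d = e :=
  (h.symm hd).unique (h'.symm he)

theorem front_true (x : P.Dart) : P.front true x = P.turn 1 x := rfl
theorem front_false (x : P.Dart) : P.front false x = P.turn 0 x := rfl
theorem back_true (x : P.Dart) : P.back true x = P.turn 2 x := rfl
theorem back_false (x : P.Dart) : P.back false x = P.turn 3 x := rfl

theorem front_opp (s : Bool) (x : P.Dart) : P.front s (P.opp x) = P.back (!s) x := by
  cases s <;> exact turn_opp _ _

theorem back_opp (s : Bool) (x : P.Dart) : P.back s (P.opp x) = P.front (!s) x := by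
  cases s <;> exact turn_opp _ _

theorem opp_front (s : Bool) (x : P.Dart) : P.opp (P.front s x) = P.back (!s) x := by
  cases s <;> exact opp_turn _ _

theorem opp_back (s : Bool) (x : P.Dart) : P.opp (P.back s x) = P.front (!s) x := by
  cases s <;> exact opp_turn _ _

end KnotProjection

/-! ### Splicing a map at one double point. -/

namespace FourValentMap
variable {P Q : FourValentMap.{u}}
open Classical in
/-- The branch to which a branch at the double point of `b` is joined when this double point is
spliced so that its corners `b` and `opp b` are merged. -/
noncomputable def glue (P : FourValentMap.{u}) (b : P.Dart) : Equiv.Perm P.Dart :=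
  Equiv.swap b (P.opp b) * P.turn (-1)

theorem glue_apply (b e : P.Dart) [DecidableEq P.Dart] :
    P.glue b e = Equiv.swap b (P.opp b) (P.turn (-1) e) := by
  rw [glue, Equiv.Perm.mul_apply]; congr; exact Subsingleton.elim _ _

theorem glue_fst (b e : P.Dart) : (P.glue b e).1 = e.1 := by
  classical
  rw [glue_apply, ← turn_fst (-1) e]
  generalize P.turn (-1) e = z
  rcases eq_or_ne z b with rfl | h1
  · rw [Equiv.swap_apply_left]; rfl
  rcases eq_or_ne z (P.opp b) with rfl | h2
  · rw [Equiv.swap_apply_right]; rfl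
  rw [Equiv.swap_apply_of_ne_of_ne h1 h2]

theorem glue_zero (b : P.Dart) : P.glue b b = P.turn 3 b := by
  classical
  rw [glue_apply, Equiv.swap_apply_of_ne_of_ne, (by decide : (-1 : ZMod 4) = 3)]
  · intro h; exact absurd (turn_inj.mp (h.trans (turn_zero b).symm)) (by decide)
  · intro h; exact absurd (turn_inj.mp h) (by decide)

theorem glue_one (b : P.Dart) : P.glue b (P.turn 1 b) = P.turn 2 b := by
  classical
  rw [glue_apply, turn_turn, add_neg_cancel, turn_zero, Equiv.swap_apply_left]; rfl

theorem glue_two (b : P.Dart) : P.glue b (P.turn 2 b) = P.turn 1 b := by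
  classical
  rw [glue_apply, turn_turn, (by decide : (2 + -1 : ZMod 4) = 1), Equiv.swap_apply_of_ne_of_ne]
  · intro h; exact absurd (turn_inj.mp (h.trans (turn_zero b).symm)) (by decide)
  · intro h; exact absurd (turn_inj.mp h) (by decide)

theorem glue_three (b : P.Dart) : P.glue b (P.turn 3 b) = b := by
  classical
  rw [glue_apply, turn_turn, (by decide : (3 + -1 : ZMod 4) = 2)]
  exact Equiv.swap_apply_right _ _

theorem eq_turn_cases {b e : P.Dart} (h : e.1 = b.1) :
    e = b ∨ e = P.turn 1 b ∨ e = P.turn 2 b ∨ e = P.turn 3 b := by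
  rw [eq_turn h]
  rcases zmod_four_cases (e.2 - b.2) with h | h | h | h <;> rw [h]
  · exact Or.inl (turn_zero b)
  · exact Or.inr (Or.inl rfl)
  · exact Or.inr (Or.inr (Or.inl rfl))
  · exact Or.inr (Or.inr (Or.inr rfl))

theorem glue_glue {b e : P.Dart} (h : e.1 = b.1) : P.glue b (P.glue b e) = e := by
  rcases eq_turn_cases h with rfl | rfl | rfl | rfl
  · rw [glue_zero, glue_three]
  · rw [glue_one, glue_two]
  · rw [glue_two, glue_one]
  · rw [glue_three, glue_zero]

theorem glue_ne {b e : P.Dart} (h : e.1 = b.1) : P.glue b e ≠ e := by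
  rcases eq_turn_cases h with rfl | rfl | rfl | rfl
  · rw [glue_zero]; exact fun h => absurd (turn_inj.mp (h.trans (turn_zero _).symm)) (by decide)
  · rw [glue_one]; exact fun h => absurd (turn_inj.mp h) (by decide)
  · rw [glue_two]; exact fun h => absurd (turn_inj.mp h) (by decide)
  · rw [glue_three]; exact fun h => absurd (turn_inj.mp ((turn_zero _).trans h)) (by decide)

open Classical in
/-- The other end of an edge after the double point of `b` has been spliced, in a map without loop
edges. -/
noncomputable def spliceNext (P : FourValentMap.{u}) (b d : P.Dart) : P.Dart :=
  if (P.edge d).1 = b.1 then P.edge (P.glue b (P.edge d)) else P.edge d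

theorem spliceNext_of_eq {b d : P.Dart} (h : (P.edge d).1 = b.1) :
    P.spliceNext b d = P.edge (P.glue b (P.edge d)) := if_pos h

theorem spliceNext_of_ne {b d : P.Dart} (h : (P.edge d).1 ≠ b.1) :
    P.spliceNext b d = P.edge d := if_neg h

/-- `Q` arises from `P` by splicing the double point of `b` in such a way that its corners `b` and
`opp b` are merged. -/
structure Splicing (P Q : FourValentMap.{u}) (b : P.Dart) where
  vertices : Q.V ≃ {w : P.V // w ≠ b.1}
  edge_eq : ∀ d : Q.Dart, (((vertices (Q.edge d).1 : P.V), (Q.edge d).2) : P.Dart) =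
    P.spliceNext b ((vertices d.1 : P.V), d.2)

namespace Splicing
variable {b : P.Dart} (s : Splicing P Q b)

/-- The branches of the spliced map as branches of the original map. -/
def incl (d : Q.Dart) : P.Dart := ((s.vertices d.1 : P.V), d.2)

theorem incl_edge (d : Q.Dart) : s.incl (Q.edge d) = P.spliceNext b (s.incl d) := s.edge_eq d

theorem incl_turn (k : ZMod 4) (d : Q.Dart) : s.incl (Q.turn k d) = P.turn k (s.incl d) := rfl

theorem incl_opp (d : Q.Dart) : s.incl (Q.opp d) = P.opp (s.incl d) := rfl

theorem incl_fst_ne (d : Q.Dart) : (s.incl d).1 ≠ b.1 := (s.vertices d.1).2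

theorem incl_injective : Function.Injective s.incl := by
  rintro ⟨v, i⟩ ⟨w, j⟩ h
  have h1 := congrArg Prod.fst h
  have h2 := congrArg Prod.snd h
  have h3 : v = w := s.vertices.injective (Subtype.ext h1)
  have h4 : i = j := h2
  rw [h3, h4]

theorem exists_incl {e : P.Dart} (h : e.1 ≠ b.1) : ∃ d, s.incl d = e :=
  ⟨(s.vertices.symm ⟨e.1, h⟩, e.2), by rw [incl, Equiv.apply_symm_apply]⟩

/-- The face permutation of the spliced map is the first-return map, to the branches away from the
double point of `b`, of `faceStep` followed by the transposition of `b` and `opp b`. This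
transposition merges the cycles of the two corners. -/
theorem sameFace_iff (hl : ∀ d, (P.edge d).1 ≠ d.1) (hb : ¬ P.SameFace b (P.opp b))
    (d e : Q.Dart) : Q.SameFace d e ↔ P.SameFace (s.incl d) (s.incl e) ∨
      (P.SameFace (s.incl d) b ∧ P.SameFace (P.opp b) (s.incl e)) ∨
      (P.SameFace (s.incl d) (P.opp b) ∧ P.SameFace b (s.incl e)) := by
  classical
  have hτ : ∀ z, (Equiv.swap b (P.opp b) * P.faceStep) z = P.glue b (P.edge z) := fun z => by
    rw [Equiv.Perm.mul_apply, faceStep_apply, glue_apply]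
  have hoff : ∀ z : P.Dart, (P.edge z).1 ≠ b.1 → P.glue b (P.edge z) = P.faceStep z := by
    intro z hz
    rw [glue_apply, Equiv.swap_apply_of_ne_of_ne]; rfl
    · intro h; have h2 := congrArg Prod.fst h; exact hz h2
    · intro h; have h2 := congrArg Prod.fst h; exact hz h2
  have hat : ∀ z : P.Dart, z.1 = b.1 → (P.edge z).1 ≠ b.1 := fun z hz => hz ▸ hl z
  refine Iff.trans ?_ (Equiv.Perm.sameCycle_swap_mul hb (s.incl d) (s.incl e))
  constructor
  · intro h
    refine h.induct (fun e => (Equiv.swap b (P.opp b) * P.faceStep).SameCycle (s.incl d)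
      (s.incl e)) (fun z hz => hz.trans ?_) Equiv.Perm.SameCycle.rfl
    rw [faceStep_apply, incl_turn, incl_edge]
    have h1 : (Equiv.swap b (P.opp b) * P.faceStep).SameCycle (s.incl z)
        (P.glue b (P.edge (s.incl z))) := by
      rw [← hτ]; exact Equiv.Perm.SameCycle.rfl.apply_right
    by_cases hz : (P.edge (s.incl z)).1 = b.1
    · rw [spliceNext_of_eq hz]
      have h2 := h1.apply_right
      rwa [hτ, hoff _ (hat _ ((glue_fst _ _).trans hz))] at h2
    · rw [spliceNext_of_ne hz]
      rwa [hoff _ hz] at h1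
  · intro h
    -- Corners at the removed double point are replaced by their successors under `faceStep`; these
    -- lie elsewhere because there are no loop edges.
    have := h.induct (fun z => ∀ q, s.incl q = (if z.1 = b.1 then P.faceStep z else z) →
      Q.SameFace d q) ?_ ?_ e (if_neg (s.incl_fst_ne e)).symm
    · exact this
    · intro z hz q hq
      rw [hτ] at hq
      by_cases h1 : z.1 = b.1
      · rw [hoff z (hat z h1), if_neg (show (P.faceStep z).1 ≠ b.1 from hat z h1)] at hq
        exact hz q (by rw [if_pos h1, hq])
      · obtain ⟨r, rfl⟩ := s.exists_incl h1
        refine (hz r (if_neg h1).symm).trans ?_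
        have : q = Q.faceStep r := by
          apply s.incl_injective
          rw [faceStep_apply, incl_turn, incl_edge, hq]
          by_cases h2 : (P.edge (s.incl r)).1 = b.1
          · rw [if_pos ((glue_fst _ _).trans h2), spliceNext_of_eq h2]; rfl
          · rw [if_neg (fun h => h2 ((glue_fst _ _).symm.trans h)), spliceNext_of_ne h2, hoff _ h2]
            rfl
        rw [this]; exact sameFace_faceStep r
    · intro q hq
      rw [if_neg (s.incl_fst_ne d)] at hq
      rw [s.incl_injective hq]; exact SameFace.refl d

end Splicing

open Classical in
/-- The map that arises by splicing the double point of `b` so that `b` and `opp b` are merged. -/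
noncomputable def splice (P : FourValentMap.{u}) (b : P.Dart) (hl : ∀ d, (P.edge d).1 ≠ d.1) :
    FourValentMap.{u} :=
  have hat : ∀ z : P.Dart, z.1 = b.1 → (P.edge z).1 ≠ b.1 := fun z hz => hz ▸ hl z
  have hg : ∀ z : P.Dart, (P.edge z).1 = b.1 → (P.glue b (P.edge z)).1 = b.1 :=
    fun z hz => (glue_fst _ _).trans hz
  have hfst : ∀ d : P.Dart, (P.spliceNext b d).1 ≠ b.1 := fun d => by
    by_cases h : (P.edge d).1 = b.1
    · rw [spliceNext_of_eq h]; exact hat _ (hg d h)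
    · rwa [spliceNext_of_ne h]
  have hinv : ∀ d : P.Dart, d.1 ≠ b.1 → P.spliceNext b (P.spliceNext b d) = d := fun d hd => by
    by_cases h : (P.edge d).1 = b.1
    · rw [spliceNext_of_eq h, spliceNext_of_eq, P.edge_edge, glue_glue h, P.edge_edge]
      rw [P.edge_edge]; exact hg d h
    · rw [spliceNext_of_ne h, spliceNext_of_ne, P.edge_edge]
      rwa [P.edge_edge]
  let next : {w : P.V // w ≠ b.1} × ZMod 4 → {w : P.V // w ≠ b.1} × ZMod 4 := fun d =>
    (⟨(P.spliceNext b (d.1, d.2)).1, hfst _⟩, (P.spliceNext b (d.1, d.2)).2)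
  have hnext : Function.Involutive next := fun d => by
    have := hinv (d.1, d.2) d.1.2
    have h1 := congrArg Prod.fst this
    have h2 := congrArg Prod.snd this
    exact Prod.ext (Subtype.ext h1) h2
  { V := {w : P.V // w ≠ b.1}
    edge := hnext.toPerm
    edge_edge := hnext
    edge_ne := fun d h => by
      have h1 : P.spliceNext b (d.1, d.2) = ((d.1 : P.V), d.2) := by
        have e1 := congrArg (fun e => (e.1 : P.V)) h
        have e2 := congrArg Prod.snd h
        exact Prod.ext e1 e2
      by_cases h2 : (P.edge (d.1, d.2)).1 = b.1
      · rw [spliceNext_of_eq h2, edge_eq_iff] at h1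
        exact glue_ne h2 h1
      · rw [spliceNext_of_ne h2] at h1
        exact P.edge_ne _ h1 }

noncomputable def spliceSplicing (P : FourValentMap.{u}) (b : P.Dart)
    (hl : ∀ d, (P.edge d).1 ≠ d.1) : Splicing P (P.splice b hl) b where
  vertices := Equiv.refl _
  edge_eq _ := rfl

end FourValentMap

namespace FourValentMap.Splicing
open FourValentMap
variable {P Q : FourValentMap.{u}} {b : P.Dart} (s : Splicing P Q b)

/-- An orientation of the spliced map is given by an orientation of the edges of the original map
that is compatible with the splice. -/
theorem exists_pullback (hl : ∀ d, (P.edge d).1 ≠ d.1) (o' : Q.Dart → Bool)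
    (he : ∀ d, o' (Q.edge d) = !o' d) (ho : ∀ d, o' (Q.opp d) = !o' d) :
    ∃ o : P.Dart → Bool, (∀ d, o (P.edge d) = !o d) ∧
      (∀ d : P.Dart, d.1 ≠ b.1 → o (P.opp d) = !o d) ∧
      (∀ d : P.Dart, d.1 = b.1 → o (P.glue b d) = !o d) ∧ ∀ d, o (s.incl d) = o' d := by
  classical
  let x : P.Dart → Bool := Function.extend s.incl o' fun _ => false
  have hx : ∀ d, x (s.incl d) = o' d := s.incl_injective.extend_apply _ _
  have hat : ∀ z : P.Dart, z.1 = b.1 → (P.edge z).1 ≠ b.1 := fun z hz => hz ▸ hl z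
  -- A branch at the removed double point gets the direction opposite to that of the far end of its
  -- edge, which survives the splice.
  refine ⟨fun d => if d.1 = b.1 then !x (P.edge d) else x d, ?_, ?_, ?_, ?_⟩
  · intro d
    by_cases h : d.1 = b.1
    · simp only [if_pos h, if_neg (hat d h), Bool.not_not]
    · by_cases h2 : (P.edge d).1 = b.1
      · simp only [if_neg h, if_pos h2, P.edge_edge]
      · simp only [if_neg h, if_neg h2]
        obtain ⟨q, rfl⟩ := s.exists_incl h
        rw [← spliceNext_of_ne h2, ← incl_edge, hx, hx, he]
  · intro d h
    simp only [if_neg h, if_neg (show (P.opp d).1 ≠ b.1 from h)]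
    obtain ⟨q, rfl⟩ := s.exists_incl h
    rw [← incl_opp, hx, hx, ho]
  · intro d h
    simp only [if_pos h, if_pos ((glue_fst b d).trans h)]
    obtain ⟨q, hq⟩ := s.exists_incl (hat d h)
    have h2 : (P.edge (s.incl q)).1 = b.1 := by rw [hq, P.edge_edge]; exact h
    have h3 := spliceNext_of_eq h2
    rw [← incl_edge, hq, P.edge_edge] at h3
    rw [← h3, ← hq, hx, hx, he]
  · intro d
    simp only [if_neg (s.incl_fst_ne d), hx]

end FourValentMap.Splicing

/-! ### Non-Seifert splices of knot projections. -/

namespace KnotProjection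
open FourValentMap
variable {P : KnotProjection.{u}}

/-- The splice that merges the corners `b` and `opp b` is a non-Seifert splice. -/
def NonSeifert (P : KnotProjection.{u}) (o : P.Dart → Bool) (b : P.Dart) : Prop :=
  o (P.turn 1 b) = o (P.turn 2 b)

theorem IsOrientation.turn_two {o : P.Dart → Bool} (ho : P.IsOrientation o) (d : P.Dart) :
    o (P.turn 2 d) = !o d := ho.2 d

theorem IsOrientation.turn_three {o : P.Dart → Bool} (ho : P.IsOrientation o) (d : P.Dart) :
    o (P.turn 3 d) = !o (P.turn 1 d) := by
  rw [← ho.2, opp_turn]; rfl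

theorem NonSeifert.glue {o : P.Dart → Bool} {b e : P.Dart} (ho : P.IsOrientation o)
    (h : P.NonSeifert o b) (he : e.1 = b.1) : o (P.glue b e) = o e := by
  have h2 := ho.turn_two b
  have h3 := ho.turn_three b
  rw [NonSeifert] at h
  rcases eq_turn_cases he with rfl | rfl | rfl | rfl
  · rw [glue_zero, h3, h, h2, Bool.not_not]
  · rw [glue_one, h]
  · rw [glue_two, h]
  · rw [glue_three, h3, h, h2, Bool.not_not]

/-- This yields that a non-Seifert splice keeps one component. A closed set `K` of branches is
transported to a set `Y` in the original map. Counting outgoing minus incoming branches of `Y` gives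
zero over all branches (pair along edges) and zero over those away from `b` (pair opposite ones),
hence zero over the four branches at `b`. As the splice joins branches of equal direction there, `Y`
contains all four or none, so it is closed under passing straight through `b` as well. -/
theorem splice_closed {o : P.Dart → Bool} {b : P.Dart} {Q : FourValentMap.{u}}
    (s : Splicing P.toFourValentMap Q b) (hl : ∀ d : P.Dart, (P.edge d).1 ≠ d.1)
    (ho : P.IsOrientation o)
    (hb : P.NonSeifert o b) (K : Q.Dart → Prop) (he : ∀ d, K d → K (Q.edge d))
    (hopp : ∀ d, K d → K (Q.opp d)) {d : Q.Dart} (hd : K d) (e : Q.Dart) : K e := by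
  classical
  let X : P.Dart → Prop := fun z => ∃ q, s.incl q = z ∧ K q
  have hX : ∀ q, X (s.incl q) ↔ K q := fun q =>
    ⟨fun ⟨r, hr, hK⟩ => s.incl_injective hr ▸ hK, fun h => ⟨q, rfl, h⟩⟩
  have hat : ∀ z : P.Dart, z.1 = b.1 → (P.edge z).1 ≠ b.1 := fun z hz => hz ▸ hl z
  let Y : P.Dart → Prop := fun z => if z.1 = b.1 then X (P.edge z) else X z
  have hYe : ∀ z, Y z → Y (P.edge z) := by
    intro z hz
    by_cases h : z.1 = b.1
    · simp only [Y, if_pos h, if_neg (hat z h)] at hz ⊢; exact hz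
    · by_cases h2 : (P.edge z).1 = b.1
      · simp only [Y, if_neg h, if_pos h2, P.edge_edge] at hz ⊢; exact hz
      · simp only [Y, if_neg h, if_neg h2] at hz ⊢
        obtain ⟨q, rfl⟩ := s.exists_incl h
        rw [← spliceNext_of_ne h2, ← s.incl_edge, hX]
        exact he _ ((hX q).mp hz)
  have hYo : ∀ z : P.Dart, z.1 ≠ b.1 → Y z → Y (P.opp z) := by
    intro z h hz
    simp only [Y, if_neg h, if_neg (show (P.opp z).1 ≠ b.1 from h)] at hz ⊢
    obtain ⟨q, rfl⟩ := s.exists_incl h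
    rw [← s.incl_opp, hX]
    exact hopp _ ((hX q).mp hz)
  have hYg : ∀ z : P.Dart, z.1 = b.1 → Y z → Y (P.glue b z) := by
    intro z h hz
    simp only [Y, if_pos h, if_pos ((glue_fst b z).trans h)] at hz ⊢
    obtain ⟨q, hq⟩ := s.exists_incl (hat z h)
    have h2 : (P.edge (s.incl q)).1 = b.1 := by rw [hq, P.edge_edge]; exact h
    have h3 := spliceNext_of_eq h2
    rw [← s.incl_edge, hq, P.edge_edge] at h3
    rw [← h3, hX]
    rw [← hq, hX] at hz
    exact he _ hz
  have hYe' : ∀ z, Y (P.edge z) ↔ Y z := fun z =>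
    ⟨fun h => by have := hYe _ h; rwa [P.edge_edge] at this, hYe z⟩
  have hYo' : ∀ z : P.Dart, z.1 ≠ b.1 → (Y (P.opp z) ↔ Y z) := fun z hz =>
    ⟨fun h => by have := hYo (P.opp z) hz h; rwa [opp_opp] at this, hYo z hz⟩
  let sg : P.Dart → ℤ := fun z => if o z then 1 else -1
  have sg_not : ∀ z w, o z = !o w → sg z = - sg w := fun z w h => by
    simp only [sg, h]; cases o w <;> rfl
  let f : P.Dart → ℤ := fun z => if Y z then sg z else 0
  let f' : P.Dart → ℤ := fun z => if z.1 = b.1 then 0 else f z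
  have sf : ∑ z, f z = 0 := by
    have h1 : ∑ z, f (P.edge z) = ∑ z, f z := Equiv.sum_comp P.edge f
    have h2 : ∀ z, f (P.edge z) = - f z := fun z => by
      simp only [f, hYe', sg_not _ _ (ho.1 z)]; split_ifs <;> simp
    simp only [h2, Finset.sum_neg_distrib] at h1
    linarith
  have sf' : ∑ z, f' z = 0 := by
    have h1 : ∑ z, f' (P.opp z) = ∑ z, f' z := Equiv.sum_comp P.opp f'
    have h2 : ∀ z, f' (P.opp z) = - f' z := fun z => by
      by_cases h : z.1 = b.1
      · show (if (P.opp z).1 = b.1 then 0 else f (P.opp z)) = -(if z.1 = b.1 then 0 else f z)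
        rw [if_pos h, if_pos (show (P.opp z).1 = b.1 from h), neg_zero]
      · simp only [f', f, opp_fst, if_neg h, hYo' z h, sg_not _ _ (ho.2 z)]; split_ifs <;> simp
    simp only [h2, Finset.sum_neg_distrib] at h1
    linarith
  have hsum : ∑ k, f (P.turn k b) = 0 := by
    have h0 : ∑ k, f (b.1, k) = ∑ z, (f z - f' z) := by
      rw [Fintype.sum_prod_type, Finset.sum_eq_single b.1]
      · simp [f']
      · intro v _ hv; simp [f', hv]
      · simp
    rw [Finset.sum_sub_distrib, sf, sf', sub_zero] at h0
    rw [← h0]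
    exact Equiv.sum_comp (Equiv.addLeft b.2) (fun k => f (b.1, k))
  have hsum4 : ∑ k, f (P.turn k b) =
      f b + f (P.turn 1 b) + f (P.turn 2 b) + f (P.turn 3 b) := by
    have := Fin.sum_univ_four (fun k : Fin 4 => f (P.turn (k : ZMod 4) b))
    rw [show P.turn ((0 : Fin 4) : ZMod 4) b = b from turn_zero b] at this
    exact this
  have y3 : Y (P.turn 3 b) ↔ Y b :=
    ⟨fun h => by have := hYg (P.turn 3 b) rfl h; rwa [glue_three] at this,
      fun h => by have := hYg _ rfl h; rwa [glue_zero] at this⟩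
  have y2 : Y (P.turn 2 b) ↔ Y (P.turn 1 b) :=
    ⟨fun h => by have := hYg (P.turn 2 b) rfl h; rwa [glue_two] at this,
      fun h => by have := hYg (P.turn 1 b) rfl h; rwa [glue_one] at this⟩
  -- The two joined pairs at `b` have opposite directions, so the sum is plus or minus twice the
  -- difference of the indicators of `Y` at `b` and at `turn 1 b`.
  have y1 : Y (P.turn 1 b) ↔ Y b := by
    have o2 := ho.turn_two b
    have o3 := ho.turn_three b
    have o1 : o (P.turn 1 b) = o (P.turn 2 b) := hb
    rw [hsum4] at hsum
    simp only [f, sg, y3, y2, o3, o1, o2] at hsum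
    by_cases h1 : Y (P.turn 1 b) <;> by_cases h2 : Y b <;> cases hob : o b <;>
      simp [h1, h2, hob] at hsum ⊢
  have yb : ∀ z : P.Dart, z.1 = b.1 → (Y z ↔ Y b) := fun z hz => by
    rcases eq_turn_cases hz with rfl | rfl | rfl | rfl
    · rfl
    · exact y1
    · exact y2.trans y1
    · exact y3
  have hYq : ∀ q, Y (s.incl q) ↔ K q := fun q => by
    simp only [Y, if_neg (s.incl_fst_ne q), hX]
  rw [← hYq]
  refine of_closed Y hYe (fun z hz => ?_) ((hYq d).mpr hd) _
  by_cases h : z.1 = b.1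
  · rwa [yb _ (show (P.opp z).1 = b.1 from h), ← yb z h]
  · exact hYo z h hz

theorem one_component_of_closed {Q : FourValentMap.{u}}
    (h : ∀ K : Q.Dart → Prop, (∀ d, K d → K (Q.edge d)) → (∀ d, K d → K (Q.opp d)) →
      ∀ d, K d → ∀ e, K e) (d e : Q.Dart) :
    Q.straight.SameCycle d e ∨ Q.straight.SameCycle d (Q.edge e) := by
  refine h (fun e => Q.straight.SameCycle d e ∨ Q.straight.SameCycle d (Q.edge e)) ?_ ?_ d
    (Or.inl Equiv.Perm.SameCycle.rfl) e
  · rintro e (h | h)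
    · right; rwa [Q.edge_edge]
    · left; exact h
  · rintro e (h | h)
    · right
      have e1 : Q.straight (Q.edge (Q.opp e)) = e := by
        rw [straight_apply, Q.edge_edge, opp_opp]
      rw [← e1] at h
      exact Equiv.Perm.sameCycle_apply_right.mp h
    · left
      have := h.apply_right
      rwa [straight_apply, Q.edge_edge] at this

/-- One double point disappears and two different faces become one, so Euler's formula persists. The
new faces are matched with the old ones other than that of `b`, which is absorbed by that of `opp
b`. -/
theorem card_face_splice {Q : FourValentMap.{u}} {b : P.Dart}
    (s : Splicing P.toFourValentMap Q b) (hl : ∀ d : P.Dart, (P.edge d).1 ≠ d.1)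
    (hb : ¬ P.SameFace b (P.opp b)) : Nat.card Q.Face = Nat.card Q.V + 2 := by
  classical
  let q : P.Dart → P.Face := Quotient.mk _
  have hq : ∀ d e, q d = q e ↔ P.SameFace d e := fun d e => Quotient.eq
  have : Finite P.Face := Quotient.finite _
  have : Fintype P.Face := Fintype.ofFinite _
  have hne : q (P.opp b) ≠ q b := fun h => hb ((hq _ _).mp h).symm
  let ψ : Q.Dart → {F : P.Face // F ≠ q b} := fun d =>
    if h : q (s.incl d) = q b then ⟨q (P.opp b), hne⟩ else ⟨q (s.incl d), h⟩
  have hψ : ∀ d e, Q.SameFace d e ↔ ψ d = ψ e := by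
    intro d e
    rw [s.sameFace_iff hl hb]
    have := hq (s.incl d) (s.incl e)
    rw [← hq, ← hq, ← hq, ← hq, ← hq]
    by_cases h1 : q (s.incl d) = q b <;> by_cases h2 : q (s.incl e) = q b
    · simp [ψ, h1, h2]
    · simp only [ψ, h1, h2, dif_pos, dif_neg, not_false_eq_true, Subtype.mk.injEq, true_and]
      grind
    · simp only [ψ, h1, h2, dif_pos, dif_neg, not_false_eq_true, Subtype.mk.injEq]
      grind
    · simp only [ψ, h1, h2, dif_neg, not_false_eq_true, Subtype.mk.injEq]
      grind
  have key : Nat.card Q.Face = Nat.card {F : P.Face // F ≠ q b} := by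
    refine Nat.card_congr (Equiv.ofBijective
      (Quotient.lift ψ fun d e h => (hψ d e).mp h) ⟨?_, ?_⟩)
    · rintro ⟨d⟩ ⟨e⟩ h
      exact Quotient.sound ((hψ d e).mpr h)
    · rintro ⟨F, hF⟩
      obtain ⟨z, rfl⟩ := Quotient.exists_rep F
      -- Every old face has a corner away from the spliced double point, because there are no loop
      -- edges.
      have hz' : ∃ w : P.Dart, w.1 ≠ b.1 ∧ q w = q z := by
        by_cases h : z.1 = b.1
        · exact ⟨P.faceStep z, h ▸ hl z, (hq _ _).mpr (sameFace_faceStep z).symm⟩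
        · exact ⟨z, h, rfl⟩
      obtain ⟨w, hw, hwz⟩ := hz'
      obtain ⟨d, rfl⟩ := s.exists_incl hw
      refine ⟨Quotient.mk _ d, ?_⟩
      show ψ d = _
      have : ¬ q (s.incl d) = q b := fun h => hF (hwz.symm.trans h)
      simp only [ψ, dif_neg this]
      exact Subtype.ext hwz
  have hV : Nat.card Q.V = Nat.card {w : P.V // w ≠ b.1} := Nat.card_congr s.vertices
  have hsph := P.spherical
  have hpos : 0 < Fintype.card P.V := Fintype.card_pos_iff.mpr ⟨b.1⟩
  rw [key, hV]
  simp only [Nat.card_eq_fintype_card, ne_eq, Fintype.card_subtype_compl,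
    Fintype.card_subtype_eq] at hsph ⊢
  omega

theorem exists_splice (hP : P.IsReduced) {o : P.Dart → Bool} (ho : P.IsOrientation o)
    {b : P.Dart} (hb : P.NonSeifert o b) :
    ∃ Q : KnotProjection.{u}, Nonempty (Splicing P.toFourValentMap Q.toFourValentMap b) := by
  have hl := edge_fst_ne hP
  have s := P.toFourValentMap.spliceSplicing b hl
  exact ⟨{ toFourValentMap := P.toFourValentMap.splice b hl
           nonempty := ⟨s.vertices.symm ⟨(P.edge b).1, hl b⟩⟩
           one_component := one_component_of_closed fun K he hopp d hd e =>
             splice_closed s hl ho hb K he hopp hd e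
           spherical := card_face_splice s hl (not_sameFace_opp hP b) }, ⟨s⟩⟩

/-- There are only two such pairings of four branches in cyclic order; each one merges an opposite
pair of corners, `j` and `j + 2`. -/
theorem isSmoothing_merge {m : ZMod 4 → ZMod 4} (h : IsSmoothing m) :
    ∃ j, ∀ i, m i = Equiv.swap j (j + 2) (i - 1) := by
  obtain ⟨h1, h2⟩ := h
  have key : m 0 = 3 ∧ m 1 = 2 ∧ m 2 = 1 ∧ m 3 = 0 ∨ m 0 = 1 ∧ m 1 = 0 ∧ m 2 = 3 ∧ m 3 = 2 := by
    have e0 := h1 0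
    have e1 := h1 1
    have e2 := h1 2
    have e3 := h1 3
    have aux : ∀ a b c d : ZMod 4, (a = 1 ∨ a = 3) → (b = 2 ∨ b = 0) → (c = 3 ∨ c = 1) →
      (d = 0 ∨ d = 2) → (a = 1 → b = 0) → (a = 3 → d = 0) → (b = 0 → a = 1) → (b = 2 → c = 1) →
      (c = 1 → b = 2) → (c = 3 → d = 2) → (d = 0 → a = 3) → (d = 2 → c = 3) →
      a = 3 ∧ b = 2 ∧ c = 1 ∧ d = 0 ∨ a = 1 ∧ b = 0 ∧ c = 3 ∧ d = 2 := by
      rintro a b c d (rfl | rfl) (rfl | rfl) (rfl | rfl) (rfl | rfl) <;> decide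
    exact aux (m 0) (m 1) (m 2) (m 3) (h2 0) (h2 1) (h2 2) (h2 3)
      (fun h => h ▸ e0) (fun h => h ▸ e0) (fun h => h ▸ e1) (fun h => h ▸ e1)
      (fun h => h ▸ e2) (fun h => h ▸ e2) (fun h => h ▸ e3) (fun h => h ▸ e3)
  rcases key with ⟨k0, k1, k2, k3⟩ | ⟨k0, k1, k2, k3⟩
  · refine ⟨0, fun i => ?_⟩
    rcases zmod_four_cases i with rfl | rfl | rfl | rfl
    · rw [k0]; decide
    · rw [k1]; decide
    · rw [k2]; decide
    · rw [k3]; decide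
  · refine ⟨1, fun i => ?_⟩
    rcases zmod_four_cases i with rfl | rfl | rfl | rfl
    · rw [k0]; decide
    · rw [k1]; decide
    · rw [k2]; decide
    · rw [k3]; decide

theorem glue_eq (b e : P.Dart) (h : e.1 = b.1) :
    P.glue b e = (b.1, Equiv.swap b.2 (b.2 + 2) (e.2 - 1)) := by
  rcases eq_turn_cases h with rfl | rfl | rfl | rfl
  · rw [glue_zero, turn_apply]
    congr 1; generalize e.2 = j; revert j; decide
  · rw [glue_one]; simp only [turn_apply]
    congr 1; generalize b.2 = j; revert j; decide
  · rw [glue_two]; simp only [turn_apply]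
    congr 1; generalize b.2 = j; revert j; decide
  · rw [glue_three]; simp only [turn_apply]
    refine Prod.ext rfl ?_
    show b.2 = Equiv.swap b.2 (b.2 + 2) (b.2 + 3 - 1)
    generalize b.2 = j; revert j; decide

/-- Without loop edges, a spliced edge runs through the removed double point at most once. -/
theorem spliceEdge_iff (hl : ∀ d : P.Dart, (P.edge d).1 ≠ d.1) {b : P.Dart} {m : ZMod 4 → ZMod 4}
    (hm : ∀ i, m i = Equiv.swap b.2 (b.2 + 2) (i - 1)) (d e : P.Dart) :
    P.SpliceEdge b.1 m d e ↔ e = P.spliceNext b d := by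
  have hg : ∀ d : P.Dart, (P.edge d).1 = b.1 → ((b.1, m (P.edge d).2) : P.Dart) =
      P.glue b (P.edge d) := fun d h => by rw [glue_eq _ _ h, hm]
  have hat : ∀ z : P.Dart, z.1 = b.1 → (P.edge z).1 ≠ b.1 := fun z hz => hz ▸ hl z
  constructor
  · intro h
    cases h with
    | direct _ h => rw [spliceNext_of_ne h]
    | through _ _ h t =>
      rw [spliceNext_of_eq h]
      rw [hg d h] at t
      have h3 := hat _ ((glue_fst b _).trans h)
      cases t with
      | direct _ _ => rfl
      | through _ _ h2 _ => exact absurd h2 h3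
  · rintro rfl
    by_cases h : (P.edge d).1 = b.1
    · rw [spliceNext_of_eq h]
      refine SpliceEdge.through _ _ h ?_
      rw [hg d h]
      exact SpliceEdge.direct _ (hat _ ((glue_fst b _).trans h))
    · rw [spliceNext_of_ne h]; exact SpliceEdge.direct _ h

theorem isNonSeifertSplice_iff (hP : P.IsReduced) (Q : KnotProjection.{u}) :
    IsNonSeifertSplice P Q ↔ ∃ (b : P.Dart) (o : P.Dart → Bool), P.IsOrientation o ∧
      P.NonSeifert o b ∧ Nonempty (Splicing P.toFourValentMap Q.toFourValentMap b) := by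
  have hl := edge_fst_ne hP
  constructor
  · rintro ⟨v, m, o, hm, ho, hns, f, hf⟩
    obtain ⟨j, hj⟩ := isSmoothing_merge hm
    refine ⟨(v, j), o, ho, ?_, ⟨⟨f, fun d => (spliceEdge_iff hl (b := (v, j)) hj _ _).mp (hf d)⟩⟩⟩
    have := hns (j + 1)
    rw [hj, add_sub_cancel_right, Equiv.swap_apply_left] at this
    exact this.symm
  · rintro ⟨b, o, ho, hns, ⟨s⟩⟩
    refine ⟨b.1, fun i => Equiv.swap b.2 (b.2 + 2) (i - 1), o, ?_, ho, fun i => ?_, s.vertices,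
      fun d => (spliceEdge_iff hl (fun _ => rfl) _ _).mpr (s.edge_eq d)⟩
    · generalize b.2 = j
      constructor <;> revert j <;> decide
    · have := hns.glue ho (e := (b.1, i)) rfl
      rwa [glue_eq b (b.1, i) rfl] at this

/-! ### Reductivity one and two in terms of splices. -/

theorem reductivity_le_iff (P : KnotProjection.{u}) (n : ℕ) :
    P.reductivity ≤ n ↔ ∃ (k : ℕ) (Q : KnotProjection.{u}), k ≤ n ∧ Splices k P Q ∧
      Q.IsReducible := by
  constructor
  · intro h
    have hne : {x : ℕ∞ | ∃ (n : ℕ) (Q : KnotProjection.{u}), x = n ∧ Splices n P Q ∧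
        Q.IsReducible}.Nonempty := by
      by_contra h0
      rw [Set.not_nonempty_iff_eq_empty] at h0
      rw [reductivity, h0, sInf_empty] at h
      exact absurd (top_le_iff.mp h) (ENat.natCast_ne_top n)
    obtain ⟨k, Q, hk, hs, hr⟩ := csInf_mem hne
    refine ⟨k, Q, ?_, hs, hr⟩
    rw [reductivity, hk] at h
    exact_mod_cast h
  · rintro ⟨k, Q, hk, hs, hr⟩
    exact (sInf_le ⟨k, Q, rfl, hs, hr⟩ : P.reductivity ≤ k).trans (by exact_mod_cast hk)

theorem splices_zero_iff {Q : KnotProjection.{u}} : Splices 0 P Q ↔ P = Q :=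
  ⟨fun h => by cases h; rfl, fun h => h ▸ Splices.zero P⟩

theorem splices_succ_iff {n : ℕ} {R : KnotProjection.{u}} :
    Splices (n + 1) P R ↔ ∃ Q, IsNonSeifertSplice P Q ∧ Splices n Q R :=
  ⟨fun h => by cases h with | succ h t => exact ⟨_, h, t⟩, fun ⟨_, h, t⟩ => Splices.succ h t⟩

theorem reductivity_eq_one_iff (hP : P.IsReduced) :
    P.reductivity = 1 ↔ ∃ Q, IsNonSeifertSplice P Q ∧ Q.IsReducible := by
  have h0 : ¬ P.reductivity ≤ (0 : ℕ) := by
    rw [reductivity_le_iff]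
    rintro ⟨k, Q, hk, hs, hr⟩
    obtain rfl : k = 0 := by omega
    rw [splices_zero_iff] at hs
    exact hP (hs ▸ hr)
  have h1 : P.reductivity = 1 ↔ P.reductivity ≤ (1 : ℕ) := by
    constructor
    · intro h; rw [h]; exact le_rfl
    · intro h
      refine le_antisymm h ?_
      rw [not_le] at h0
      exact Order.one_le_iff_pos.mpr h0
  rw [h1, reductivity_le_iff]
  constructor
  · rintro ⟨k, Q, hk, hs, hr⟩
    obtain rfl | rfl : k = 0 ∨ k = 1 := by omega
    · rw [splices_zero_iff] at hs
      exact absurd (hs ▸ hr) hP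
    · rw [splices_succ_iff] at hs
      obtain ⟨R, h, t⟩ := hs
      rw [splices_zero_iff] at t
      exact ⟨R, h, t ▸ hr⟩
  · rintro ⟨Q, h, hr⟩
    exact ⟨1, Q, le_rfl, Splices.succ h (Splices.zero Q), hr⟩

theorem reductivity_eq_two_iff (hP : P.IsReduced) :
    P.reductivity = 2 ↔ P.reductivity ≠ 1 ∧
      ∃ Q R, IsNonSeifertSplice P Q ∧ IsNonSeifertSplice Q R ∧ R.IsReducible := by
  constructor
  · intro h
    have h1 : P.reductivity ≠ 1 := by rw [h]; decide
    refine ⟨h1, ?_⟩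
    obtain ⟨k, R, hk, hs, hr⟩ := (reductivity_le_iff P 2).mp h.le
    obtain rfl | rfl | rfl : k = 0 ∨ k = 1 ∨ k = 2 := by omega
    · rw [splices_zero_iff] at hs
      exact absurd (hs ▸ hr) hP
    · exfalso
      rw [splices_succ_iff] at hs
      obtain ⟨Q, h, t⟩ := hs
      rw [splices_zero_iff] at t
      exact h1 ((reductivity_eq_one_iff hP).mpr ⟨Q, h, t ▸ hr⟩)
    · rw [splices_succ_iff] at hs
      obtain ⟨Q, h, t⟩ := hs
      rw [splices_succ_iff] at t
      obtain ⟨R', h', t⟩ := t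
      rw [splices_zero_iff] at t
      exact ⟨Q, R', h, h', t ▸ hr⟩
  · rintro ⟨h1, Q, R, h, h', hr⟩
    have h2 : P.reductivity ≤ (2 : ℕ) := (reductivity_le_iff P 2).mpr
      ⟨2, R, le_rfl, Splices.succ h (Splices.succ h' (Splices.zero R)), hr⟩
    obtain ⟨n, hn⟩ := ENat.ne_top_iff_exists.mp (ne_top_of_le_ne_top (ENat.natCast_ne_top 2) h2)
    have h0 : P.reductivity ≠ 0 := fun h0 => by
      obtain ⟨k, Q, hk, hs, hr⟩ := (reductivity_le_iff P 0).mp h0.le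
      obtain rfl : k = 0 := by omega
      rw [splices_zero_iff] at hs
      exact hP (hs ▸ hr)
    rw [← hn] at h0 h1 h2 ⊢
    norm_cast at h0 h1 h2 ⊢
    omega

end KnotProjection

/-! ### Circles through double points separate the projection. -/

/-- Walking along a cycle of a permutation from `x` to a different point `y`: a property of `x`
that persists until the walk returns to `x` or reaches `y` holds just before the walk reaches
`y`. -/
theorem Equiv.Perm.SameCycle.walk {α : Type*} [Finite α] {f : Equiv.Perm α} {x y : α}
    (h : f.SameCycle x y) (hne : x ≠ y) (C : α → Prop) (hx : C x)
    (step : ∀ z, C z → f.SameCycle x z → f z ≠ x → f z ≠ y → C (f z)) :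
    ∃ z, C z ∧ f.SameCycle x z ∧ f z = y := by
  classical
  have hex : ∃ n : ℕ, (f ^ n) x = y := h.exists_nat_pow_eq
  obtain ⟨n, hn⟩ : ∃ n, Nat.find hex = n + 1 := Nat.exists_eq_succ_of_ne_zero fun h0 => by
    have := Nat.find_spec hex
    rw [h0] at this
    exact hne this
  have hs : ∀ j, f ((f ^ j) x) = (f ^ (j + 1)) x := fun j => by
    rw [pow_succ', Equiv.Perm.mul_apply]
  have hcyc : ∀ j : ℕ, f.SameCycle x ((f ^ j) x) := fun j => ⟨j, by rw [zpow_natCast]⟩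
  have hC : ∀ j, j ≤ n → C ((f ^ j) x) := by
    intro j hj
    induction j with
    | zero => exact hx
    | succ j ih =>
      rw [← hs]
      refine step _ (ih (by omega)) (hcyc j) ?_ ?_
      · rw [hs]
        intro h0
        have h1 : (f ^ (n + 1 - (j + 1))) x = y := by
          rw [← Nat.find_spec hex, hn]
          conv_lhs => rw [← h0]
          rw [← Equiv.Perm.mul_apply, ← pow_add]
          congr 2; omega
        exact Nat.find_min hex (by omega) h1
      · rw [hs]; exact Nat.find_min hex (by omega)
  refine ⟨(f ^ n) x, hC n le_rfl, hcyc n, ?_⟩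
  rw [hs, ← hn]; exact Nat.find_spec hex

namespace KnotProjection
open FourValentMap
variable {P : KnotProjection.{u}}

theorem turn_ne {d : P.Dart} {k l : ZMod 4} (h : k ≠ l) : P.turn k d ≠ P.turn l d :=
  fun h' => h (turn_inj.mp h')

/-- A circle that meets the projection only in double points, passing straight through each of
them, separates the projection. -/
theorem exists_sides {ι : Type*} [Fintype ι] (c : ι → P.Dart) (next : Equiv.Perm ι) (i₀ : ι)
    (hnext : ∀ i, next.SameCycle i₀ i) (hinj : ∀ i j, (c i).1 = (c j).1 → i = j)
    (hface : ∀ i, P.SameFace (c i) (P.opp (c (next i))))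
    (hdisj : ∀ i j, P.SameFace (c i) (c j) → i = j) :
    ∃ col : P.Dart → Bool, (∀ d, col (P.edge d) = col d) ∧
      (∀ d : P.Dart, (∀ i, d.1 ≠ (c i).1) → ∀ k, col (P.turn k d) = col d) ∧
      ∀ s i, col (P.front s (c i)) = s ∧ col (P.back s (c i)) = s := by
  classical
  -- `g` counts the passages of the circle through a corner modulo 2. The circle enters and leaves
  -- each double point and each face equally often, so `g` is a cocycle; its primitive changes
  -- exactly where the circle separates two neighbouring branches, and therefore records the side.
  let g : P.Dart → ZMod 2 := fun d =>
    ∑ i, ((if c i = d then 1 else 0) + (if P.opp (c i) = d then 1 else 0))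
  have g0 : ∀ d, (∀ i, c i ≠ d) → (∀ i, P.opp (c i) ≠ d) → g d = 0 := fun d h1 h2 =>
    Finset.sum_eq_zero fun i _ => by rw [if_neg (h1 i), if_neg (h2 i), add_zero]
  have g1 : ∀ i, g (c i) = 1 := fun i => by
    simp only [g]
    rw [Finset.sum_eq_single i]
    · rw [if_pos rfl, if_neg (opp_ne _), add_zero]
    · intro j _ hj
      rw [if_neg fun h => hj (hinj _ _ (congrArg Prod.fst h)), if_neg, add_zero]
      intro h
      have h2 := congrArg Prod.fst h
      exact hj (hinj _ _ h2)
    · simp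
  have g2 : ∀ i, g (P.opp (c i)) = 1 := fun i => by
    simp only [g]
    rw [Finset.sum_eq_single i]
    · rw [if_pos rfl, if_neg (opp_ne _).symm, zero_add]
    · intro j _ hj
      rw [if_neg, if_neg, add_zero]
      · intro h
        have h2 := congrArg Prod.fst h
        exact hj (hinj _ _ h2)
      · intro h
        have h2 := congrArg Prod.fst h
        exact hj (hinj _ _ h2)
    · simp
  have hv : ∀ v, ∑ k, g (v, k) = 0 := by
    intro v
    simp only [g]
    rw [Finset.sum_comm]
    refine Finset.sum_eq_zero fun i _ => ?_
    rw [Finset.sum_add_distrib]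
    have e : ∀ d : P.Dart, ∑ k, (if d = (v, k) then (1 : ZMod 2) else 0) =
        if d.1 = v then 1 else 0 := fun d => by
      by_cases hd : d.1 = v
      · rw [if_pos hd, Finset.sum_eq_single d.2]
        · subst hd; exact if_pos rfl
        · intro k _ hk
          rw [if_neg]; intro h; rw [h] at hk; exact hk rfl
        · simp
      · rw [if_neg hd]
        refine Finset.sum_eq_zero fun k _ => if_neg fun h => hd ?_
        rw [h]
    rw [e, e, opp_fst, CharTwo.add_self_eq_zero]
  have hf : ∀ d, ∑ᶠ e ∈ {e | P.SameFace d e}, g e = 0 := by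
    intro d
    rw [finsum_mem_eq_finite_toFinset_sum _ (Set.toFinite _)]
    simp only [g]
    rw [Finset.sum_comm]
    simp only [Finset.sum_add_distrib, Finset.sum_ite_eq, Set.Finite.mem_toFinset,
      Set.mem_ofPred_eq]
    have e1 : ∑ i, (if P.SameFace d (P.opp (c i)) then (1 : ZMod 2) else 0) =
        ∑ i, if P.SameFace d (c i) then 1 else 0 := by
      rw [← Equiv.sum_comp next]
      refine Finset.sum_congr rfl fun i _ => ?_
      have : P.SameFace d (P.opp (c (next i))) ↔ P.SameFace d (c i) :=
        ⟨fun h => h.trans (hface i).symm, fun h => h.trans (hface i)⟩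
      simp only [this]
    rw [e1, CharTwo.add_self_eq_zero]
  obtain ⟨h, he, ht⟩ := P.exists_coboundary g hv hf
  have h1 : ∀ i, h (P.turn 1 (c i)) = h (c i) + 1 := fun i => by rw [ht, g1]
  have h2 : ∀ i, h (P.turn 2 (c i)) = h (c i) + 1 := fun i => by
    rw [show P.turn 2 (c i) = P.turn 1 (P.turn 1 (c i)) by rw [turn_turn]; rfl, ht, h1, g0,
      add_zero]
    · intro j hj
      have hji := hinj j i (by have := congrArg Prod.fst hj; exact this)
      rw [hji, ← turn_zero (c i), turn_turn] at hj
      exact turn_ne (by decide) hj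
    · intro j hj
      have hji := hinj j i (by have := congrArg Prod.fst hj; exact this)
      rw [hji] at hj
      exact turn_ne (by decide) hj
  have h3 : ∀ i, h (P.turn 3 (c i)) = h (c i) := fun i => by
    rw [show P.turn 3 (c i) = P.turn 1 (P.turn 2 (c i)) by rw [turn_turn]; rfl, ht, h2,
      show P.turn 2 (c i) = P.opp (c i) from rfl, g2, add_assoc, CharTwo.add_self_eq_zero,
      add_zero]
  -- The boundary walk of the face between two successive double points of the circle meets no other
  -- corner of the circle, as its faces are distinct. So `h` stays constant on it, and left and
  -- right agree all along the circle.
  have h4 : ∀ i, h (c (next i)) = h (c i) := fun i => by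
    have hf1 : ∀ z, P.turn 1 (P.faceStep z) = P.edge z := fun z => by
      rw [faceStep_apply, turn_turn, neg_add_cancel, turn_zero]
    obtain ⟨z, hz, -, hzy⟩ := (hface i).walk (fun heq => by
      have hv := congrArg Prod.fst heq
      have hi := hinj _ _ hv
      rw [← hi] at heq
      exact opp_ne _ heq.symm) (fun z => h z = h (c i)) rfl (fun z hz hs hx hy => by
        have h5 := ht (P.faceStep z)
        rw [hf1, he, hz, g0, add_zero] at h5
        · exact h5.symm
        · intro j hj
          have := hdisj i j (by rw [hj]; exact SameFace.trans hs (sameFace_faceStep z))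
          subst this
          exact hx hj.symm
        · intro j hj
          have h6 := hface (next.symm j)
          rw [Equiv.apply_symm_apply, hj] at h6
          have := hdisj i (next.symm j) (SameFace.trans
            (SameFace.trans hs (sameFace_faceStep z)) h6.symm)
          rw [this, Equiv.apply_symm_apply] at hy
          exact hy hj.symm)
    have h5 := ht (P.faceStep z)
    rw [hf1, he, hz, hzy, g2, ← h3 (next i)] at *
    have h6 : P.turn 3 (c (next i)) = P.turn 1 (P.opp (c (next i))) := by
      rw [turn_opp]; rfl
    rw [h6, ht, g2, ← h5]
  have hall : ∀ i, h (c i) = h (c i₀) := fun i => by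
    have := Finite.of_fintype ι
    exact (hnext i).induct (fun i => h (c i) = h (c i₀)) (fun i hi => (h4 i).trans hi) rfl
  have hne : ∀ a : ZMod 2, ¬ a + 1 = a := by decide
  refine ⟨fun d => !decide (h d = h (c i₀)), fun d => by simp only [he], fun d hd k => ?_, ?_⟩
  · have h5 : ∀ z : P.Dart, z.1 = d.1 → h (P.turn 1 z) = h z := fun z hz => by
      rw [ht, g0, add_zero]
      all_goals
        intro i hi
        have h6 := congrArg Prod.fst hi
        exact hd i (hz.symm.trans h6.symm)
    have h6 : ∀ z : P.Dart, z.1 = d.1 → h (P.turn 2 z) = h z := fun z hz => by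
      rw [show P.turn 2 z = P.turn 1 (P.turn 1 z) by rw [turn_turn]; rfl, h5 (P.turn 1 z) hz, h5 _ hz]
    have h7 : h (P.turn k d) = h d := by
      rcases zmod_four_cases k with rfl | rfl | rfl | rfl
      · rw [turn_zero]
      · exact h5 d rfl
      · exact h6 d rfl
      · rw [show P.turn 3 d = P.turn 1 (P.turn 2 d) by rw [turn_turn]; rfl,
        h5 (P.turn 2 d) rfl, h6 d rfl]
    simp only [h7]
  · intro s i
    cases s
    · rw [front_false, back_false, turn_zero]
      simp [h3, hall]
    · rw [front_true, back_true]
      simp [h1, h2, hall]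

/-- Two disjoint arcs of the curve that join the opposite branches at two double points would
form a component of their own. -/
theorem Arc.not_opp {S : Set P.V} {d e : P.Dart} (h : P.Arc S d e) (hd : d.1 ∈ S)
    (hne : e.1 ≠ d.1) : ¬ P.Arc S (P.opp d) (P.opp e) := by
  intro h'
  have he := h.mem
  have h1 := Arc.closed (S := S) (fun z => z = d ∨ z = P.opp d ∨ z = e ∨ z = P.opp e)
    (by
      rintro z w - (rfl | rfl | rfl | rfl) hz
      · exact Or.inr (Or.inr (Or.inl (hz.unique h)))
      · exact Or.inr (Or.inr (Or.inr (hz.unique h')))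
      · exact Or.inl (hz.unique (h.symm hd))
      · exact Or.inr (Or.inl (hz.unique (h'.symm hd))))
    (by
      rintro z - (rfl | rfl | rfl | rfl)
      · exact Or.inr (Or.inl rfl)
      · exact Or.inl (opp_opp _)
      · exact Or.inr (Or.inr (Or.inr rfl))
      · exact Or.inr (Or.inr (Or.inl (opp_opp _)))) hd (Or.inl rfl)
    (show (P.turn 1 d).1 ∈ S from hd)
  rcases h1 with h1 | h1 | h1 | h1
  · rw [← turn_zero d, turn_turn] at h1; exact turn_ne (by decide) h1
  · exact turn_ne (by decide) h1
  · exact hne (congrArg Prod.fst h1).symm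
  · have := congrArg Prod.fst h1; exact hne this.symm

/-! ### Circles through two double points and reductivity one. -/

theorem nonSeifert_iff {o : P.Dart → Bool} (ho : P.IsOrientation o) (s : Bool) (b : P.Dart) :
    P.NonSeifert o b ↔ o (P.front s b) = o (P.back s b) := by
  cases s
  · rw [front_false, back_false, turn_zero, ho.turn_three, NonSeifert, ho.turn_two]
    cases o b <;> cases o (P.turn 1 b) <;> decide
  · rfl

theorem nonSeifert_opp {o : P.Dart → Bool} (ho : P.IsOrientation o) {b : P.Dart} :
    P.NonSeifert o (P.opp b) ↔ P.NonSeifert o b := by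
  rw [nonSeifert_iff ho true, nonSeifert_iff ho false b, front_opp, back_opp]
  exact eq_comm

theorem TwoCircle.opp {x y : P.Dart} (h : P.TwoCircle x y) :
    P.TwoCircle (P.opp x) (P.opp y) := by
  obtain ⟨h1, h2, h3, h4⟩ := h
  refine ⟨h1, ?_, ?_, fun h => h4 ?_⟩
  · rw [opp_opp]; exact h3.symm
  · rw [opp_opp]; exact h2.symm
  · exact h2.trans (h.symm.trans h3.symm)

/-- Since `P` is reduced, the two opposite corners lie in one face only after the merger. So they
lie in the two merged faces of `P`, and the circle crosses from one to the other at `b`, in one of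
two directions. -/
theorem twoCircle_of_nugatory (hP : P.IsReduced) {Q : FourValentMap.{u}} {b : P.Dart}
    (s : Splicing P.toFourValentMap Q b) {q : Q.Dart} (hq : Q.SameFace q (Q.opp q)) :
    ∃ b', (b' = b ∨ b' = P.opp b) ∧ P.TwoCircle (s.incl q) b' := by
  rw [s.sameFace_iff (edge_fst_ne hP) (not_sameFace_opp hP b), s.incl_opp] at hq
  have hne := s.incl_fst_ne q
  rcases hq with h | ⟨h1, h2⟩ | ⟨h1, h2⟩
  · exact absurd h (not_sameFace_opp hP _)
  · exact ⟨P.opp b, Or.inr rfl, hne, by rwa [opp_opp], h2,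
      fun h => not_sameFace_opp hP b (h1.symm.trans h)⟩
  · exact ⟨b, Or.inl rfl, hne, h1, h2, fun h => not_sameFace_opp hP b (h.symm.trans h1)⟩

theorem nugatory_of_twoCircle (hP : P.IsReduced) {Q : FourValentMap.{u}} {b x : P.Dart}
    (s : Splicing P.toFourValentMap Q b) (hx : x.1 ≠ b.1) (h1 : P.SameFace x (P.opp b))
    (h2 : P.SameFace b (P.opp x)) : ∃ q, s.incl q = x ∧ Q.SameFace q (Q.opp q) := by
  obtain ⟨q, rfl⟩ := s.exists_incl hx
  refine ⟨q, rfl, ?_⟩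
  rw [s.sameFace_iff (edge_fst_ne hP) (not_sameFace_opp hP b), s.incl_opp]
  exact Or.inr (Or.inr ⟨h1, h2⟩)

theorem eq_front_or_back {col : P.Dart → Bool} {x e : P.Dart} {s : Bool}
    (hcol : ∀ s, col (P.front s x) = s ∧ col (P.back s x) = s) (he : e.1 = x.1)
    (hs : col e = s) : e = P.front s x ∨ e = P.back s x := by
  have h0 : x = P.front false x := (turn_zero x).symm
  rcases eq_turn_cases he with h | h | h | h
  · rw [h, h0] at hs; rw [(hcol false).1] at hs; subst hs; exact Or.inl (h.trans h0)
  · rw [h, ← front_true, (hcol true).1] at hs; subst hs; exact Or.inl h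
  · rw [h, ← back_true, (hcol true).2] at hs; subst hs; exact Or.inr h
  · rw [h, ← back_false, (hcol false).2] at hs; subst hs; exact Or.inr h

theorem TwoCircle.sides {x y : P.Dart} (h : P.TwoCircle x y) :
    ∃ col : P.Dart → Bool, (∀ d, col (P.edge d) = col d) ∧
      (∀ d : P.Dart, d.1 ∉ ({x.1, y.1} : Set P.V) → ∀ k, col (P.turn k d) = col d) ∧
      (∀ s, col (P.front s x) = s ∧ col (P.back s x) = s) ∧
      ∀ s, col (P.front s y) = s ∧ col (P.back s y) = s := by
  obtain ⟨h1, h2, h3, h4⟩ := h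
  obtain ⟨col, ha, hb, hc⟩ := exists_sides (P := P) ![x, y] (finRotate 2) 0
    (fun i => ⟨(i : ℕ), by rw [zpow_natCast]; revert i; decide⟩)
    (by simp [Fin.forall_fin_two, h1, h1.symm])
    (by rw [Fin.forall_fin_two]; exact ⟨h2, h3⟩)
    (by simp only [Fin.forall_fin_two]
        exact ⟨⟨fun _ => trivial, fun h => absurd h h4⟩, fun h => absurd h.symm h4, fun _ => trivial⟩)
  refine ⟨col, ha, fun d hd => hb d ?_, fun s => hc s 0, fun s => hc s 1⟩
  rw [Fin.forall_fin_two]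
  exact ⟨fun h => hd (Or.inl h), fun h => hd (Or.inr h)⟩

/-- On each side of a circle through two double points, the arcs form two loops, or they are
crossed, or they are parallel. -/
theorem TwoCircle.arcs {x y : P.Dart} (h : P.TwoCircle x y) (s : Bool) :
    (P.Arc {x.1, y.1} (P.front s x) (P.back s x) ∧ P.Arc {x.1, y.1} (P.front s y) (P.back s y)) ∨
      P.CrossedPair {x.1, y.1} s x y ∨ P.ParallelPair {x.1, y.1} s x y := by
  obtain ⟨col, ha, hb, hx, hy⟩ := h.sides
  have hxS : x.1 ∈ ({x.1, y.1} : Set P.V) := Or.inl rfl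
  have hyS : y.1 ∈ ({x.1, y.1} : Set P.V) := Or.inr rfl
  have mate : ∀ d : P.Dart, col d = s → ∃ e, P.Arc {x.1, y.1} d e ∧
      (e = P.front s x ∨ e = P.back s x ∨ e = P.front s y ∨ e = P.back s y) := by
    intro d hd
    obtain ⟨e, he⟩ := Arc.exists hxS d
    have hc := he.const ha fun d hd => hb d hd 2
    refine ⟨e, he, ?_⟩
    rcases he.mem with hm | hm
    · rcases eq_front_or_back hx hm (hc.trans hd) with h | h
      · exact Or.inl h
      · exact Or.inr (Or.inl h)
    · rcases eq_front_or_back hy hm (hc.trans hd) with h | h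
      · exact Or.inr (Or.inr (Or.inl h))
      · exact Or.inr (Or.inr (Or.inr h))
  have hfb : ∀ z : P.Dart, P.front s z ≠ P.back s z := fun z => by
    cases s
    · exact turn_ne (by decide)
    · exact turn_ne (by decide)
  have hff : P.front s x ≠ P.front s y := fun h' => by
    have := congrArg Prod.fst h'
    cases s <;> exact h.1 this
  have hbb : P.back s x ≠ P.back s y := fun h' => by
    have := congrArg Prod.fst h'
    cases s <;> exact h.1 this
  have hF : ∀ z : P.Dart, (P.front s z).1 = z.1 := fun z => by cases s <;> rfl
  have hB : ∀ z : P.Dart, (P.back s z).1 = z.1 := fun z => by cases s <;> rfl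
  obtain ⟨e, he, hee⟩ := mate _ (hx s).1
  rcases hee with rfl | rfl | rfl | rfl
  · exact absurd he Arc.irrefl
  · left
    refine ⟨he, ?_⟩
    obtain ⟨f, hf, hff'⟩ := mate _ (hy s).1
    have hf2 := hf.symm (by rw [hF]; exact hyS)
    have he2 := he.symm (by rw [hF]; exact hxS)
    rcases hff' with rfl | rfl | rfl | rfl
    · have := hf2.unique he; exact absurd (hF y ▸ hB x ▸ congrArg Prod.fst this) h.1.symm
    · exact absurd (hf2.unique he2) hff.symm
    · exact absurd hf Arc.irrefl
    · exact hf
  · right; left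
    refine ⟨he, ?_⟩
    obtain ⟨f, hf, hff'⟩ := mate _ (hx s).2
    have hf2 := hf.symm (by rw [hB]; exact hxS)
    have he2 := he.symm (by rw [hF]; exact hxS)
    rcases hff' with rfl | rfl | rfl | rfl
    · have := hf2.unique he; exact absurd (hF y ▸ hB x ▸ congrArg Prod.fst this) h.1
    · exact absurd hf Arc.irrefl
    · exact absurd (hf2.unique he2) (hfb x).symm
    · exact hf
  · right; right
    refine ⟨he, ?_⟩
    obtain ⟨f, hf, hff'⟩ := mate _ (hx s).2
    have hf2 := hf.symm (by rw [hB]; exact hxS)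
    have he2 := he.symm (by rw [hF]; exact hxS)
    rcases hff' with rfl | rfl | rfl | rfl
    · exact absurd (hf2.unique he) hbb
    · exact absurd hf Arc.irrefl
    · exact hf
    · exact absurd (hf2.unique he2) (hfb x).symm

theorem front_fst (s : Bool) (x : P.Dart) : (P.front s x).1 = x.1 := by cases s <;> rfl

theorem back_fst (s : Bool) (x : P.Dart) : (P.back s x).1 = x.1 := by cases s <;> rfl

theorem not_crossedPair_crossedPair {S : Set P.V} {x y : P.Dart} {s : Bool} (hx : x.1 ∈ S)
    (hne : x.1 ≠ y.1) (h : P.CrossedPair S s x y) : ¬ P.CrossedPair S (!s) x y := fun h' => by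
  refine h.1.not_opp ?_ ?_ ?_
  · rwa [front_fst]
  · rw [front_fst, front_fst]; exact hne.symm
  · rw [opp_front, opp_front]; exact h'.2

theorem not_parallelPair_parallelPair {S : Set P.V} {x y : P.Dart} {s : Bool} (hx : x.1 ∈ S)
    (hne : x.1 ≠ y.1) (h : P.ParallelPair S s x y) : ¬ P.ParallelPair S (!s) x y := fun h' => by
  refine h.1.not_opp ?_ ?_ ?_
  · rwa [front_fst]
  · rw [front_fst, back_fst]; exact hne.symm
  · rw [opp_front, opp_back]; exact h'.2

/-- Equal directions at `y` exclude a loop there, so each side is crossed or parallel. The same type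
on both sides would give a curve with more than one component. -/
theorem hasTwoPointCircle_of_nonSeifert {x y : P.Dart} (h : P.TwoCircle x y) {o : P.Dart → Bool}
    (ho : P.IsOrientation o) (hns : P.NonSeifert o y) : P.HasTwoPointCircle := by
  have hx : x.1 ∈ ({x.1, y.1} : Set P.V) := Or.inl rfl
  have key : ∀ s, P.CrossedPair {x.1, y.1} s x y ∨ P.ParallelPair {x.1, y.1} s x y := fun s => by
    rcases h.arcs s with ⟨-, h2⟩ | h2
    · have h3 := h2.flip_orientation ho
      rw [(nonSeifert_iff ho s y).mp hns] at h3
      exact absurd h3.symm (Bool.not_ne_self _)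
    · exact h2
  rcases key true with h1 | h1 <;> rcases key false with h2 | h2
  · exact absurd h2 (not_crossedPair_crossedPair (s := true) hx h.1 h1)
  · exact ⟨x, y, true, h, h1, h2⟩
  · exact ⟨x, y, false, h, h2, h1⟩
  · exact absurd h2 (not_parallelPair_parallelPair (s := true) hx h.1 h1)

theorem hasTwoPointCircle_iff (hP : P.IsReduced) :
    P.HasTwoPointCircle ↔ P.reductivity = 1 := by
  rw [reductivity_eq_one_iff hP]
  constructor
  · rintro ⟨x, y, s, h, hc, hp⟩
    obtain ⟨o, ho⟩ := P.exists_orientation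
    -- Through the crossed arc and the parallel arc, both branches at `y` on the side `s` get the
    -- direction opposite to that of the front branch of `x` on this side.
    have hns : P.NonSeifert o y := by
      rw [nonSeifert_iff ho s]
      have h1 := hc.1.flip_orientation ho
      have h2 := hp.2.flip_orientation ho
      have h3 := ho.2 (P.front s x)
      have h4 := ho.2 (P.back s y)
      rw [opp_front] at h3
      rw [opp_back] at h4
      rw [h1]
      rw [h2, h3, Bool.not_not] at h4
      rw [h4, Bool.not_not]
    obtain ⟨Q, ⟨t⟩⟩ := exists_splice hP ho hns
    obtain ⟨q, -, hq⟩ := nugatory_of_twoCircle hP t h.1 h.2.1 h.2.2.1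
    exact ⟨Q, (isNonSeifertSplice_iff hP Q).mpr ⟨y, o, ho, hns, ⟨t⟩⟩, q.1, q.2, hq⟩
  · rintro ⟨Q, hQ, v, i, hi⟩
    obtain ⟨b, o, ho, hns, ⟨t⟩⟩ := (isNonSeifertSplice_iff hP Q).mp hQ
    obtain ⟨b', hb', hT⟩ := twoCircle_of_nugatory hP t hi
    refine hasTwoPointCircle_of_nonSeifert hT ho ?_
    rcases hb' with rfl | rfl
    · exact hns
    · exact (nonSeifert_opp ho).mpr hns

/-! ### Directions and circles for two successive splices. -/

/-- An assignment of directions to the edges, compatible with the splice that merges the corners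
`b` and `opp b`. -/
structure SplicedOrientation (P : KnotProjection.{u}) (b : P.Dart) (o : P.Dart → Bool) : Prop where
  edge : ∀ d, o (P.edge d) = !o d
  opp : ∀ d : P.Dart, d.1 ≠ b.1 → o (P.opp d) = !o d
  back : ∀ s, o (P.back s b) = !o (P.front s b)

theorem SplicedOrientation.of_opp {b : P.Dart} {o : P.Dart → Bool}
    (h : P.SplicedOrientation (P.opp b) o) : P.SplicedOrientation b o :=
  ⟨h.edge, h.opp, fun s => by
    have := h.back (!s)
    rw [front_opp, back_opp, Bool.not_not] at this
    rw [this, Bool.not_not]⟩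

theorem SplicedOrientation.opp_iff {b : P.Dart} {o : P.Dart → Bool} :
    P.SplicedOrientation (P.opp b) o ↔ P.SplicedOrientation b o :=
  ⟨SplicedOrientation.of_opp, fun h => of_opp (by rwa [opp_opp])⟩

theorem SplicedOrientation.arc {b : P.Dart} {o : P.Dart → Bool} (h : P.SplicedOrientation b o)
    {S : Set P.V} (hb : b.1 ∈ S) {d e : P.Dart} (ha : P.Arc S d e) : o e = !o d :=
  ha.flip h.edge fun d hd => h.opp d fun hdb => hd (hdb ▸ hb)

theorem exists_splicedOrientation (hP : P.IsReduced) {Q : KnotProjection.{u}} {b : P.Dart}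
    (s : Splicing P.toFourValentMap Q.toFourValentMap b) {o' : Q.Dart → Bool}
    (ho' : Q.IsOrientation o') :
    ∃ o, P.SplicedOrientation b o ∧ ∀ d, o (s.incl d) = o' d := by
  obtain ⟨o, h1, h2, h3, h4⟩ := s.exists_pullback (edge_fst_ne hP) o' ho'.1 ho'.2
  refine ⟨o, ⟨h1, h2, fun t => ?_⟩, h4⟩
  cases t
  · rw [← h3 (P.front false b) rfl, front_false, back_false, turn_zero, glue_zero]
  · rw [← h3 (P.front true b) rfl, front_true, back_true, glue_one]

theorem incl_front {Q : KnotProjection.{u}} {b : P.Dart}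
    (t : Splicing P.toFourValentMap Q.toFourValentMap b) (s : Bool) (d : Q.Dart) :
    t.incl (Q.front s d) = P.front s (t.incl d) := rfl

theorem incl_back {Q : KnotProjection.{u}} {b : P.Dart}
    (t : Splicing P.toFourValentMap Q.toFourValentMap b) (s : Bool) (d : Q.Dart) :
    t.incl (Q.back s d) = P.back s (t.incl d) := rfl

/-- Splicing first at `b` and then at `c` makes `a` nugatory. -/
theorem exists_two_splices (hP : P.IsReduced) {a b c : P.Dart} (hab : a.1 ≠ b.1) (hbc : c.1 ≠ b.1)
    (hac : a.1 ≠ c.1) (h1 : P.SameFace a (P.opp c) ∨ P.SameFace a (P.opp b) ∧ P.SameFace b (P.opp c))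
    (h2 : P.SameFace c (P.opp a)) {o : P.Dart → Bool} (ho : P.IsOrientation o)
    (hb : P.NonSeifert o b)
    (hc : ∀ o₁, P.SplicedOrientation b o₁ → ∃ s, o₁ (P.front s c) = o₁ (P.back s c)) :
    P.reductivity = 1 ∨ P.reductivity = 2 := by
  by_cases hr : P.reductivity = 1
  · exact Or.inl hr
  right
  rw [reductivity_eq_two_iff hP]
  refine ⟨hr, ?_⟩
  rw [reductivity_eq_one_iff hP] at hr
  obtain ⟨Q, ⟨s⟩⟩ := exists_splice hP ho hb
  have hPQ : IsNonSeifertSplice P Q := (isNonSeifertSplice_iff hP Q).mpr ⟨b, o, ho, hb, ⟨s⟩⟩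
  have hQ : Q.IsReduced := fun h => hr ⟨Q, hPQ, h⟩
  obtain ⟨o', ho'⟩ := Q.exists_orientation
  obtain ⟨o₁, ho₁, hoo⟩ := exists_splicedOrientation hP s ho'
  obtain ⟨c', rfl⟩ := s.exists_incl hbc
  obtain ⟨a', rfl⟩ := s.exists_incl hab
  obtain ⟨t, ht⟩ := hc o₁ ho₁
  rw [← incl_front, ← incl_back, hoo, hoo, ← nonSeifert_iff ho'] at ht
  obtain ⟨R, ⟨r⟩⟩ := exists_splice hQ ho' ht
  have hl := edge_fst_ne hP
  have hnf := not_sameFace_opp hP b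
  obtain ⟨q, -, hq⟩ := nugatory_of_twoCircle hQ r (x := a')
    (fun h => hac (by show (s.vertices a'.1 : P.V) = s.vertices c'.1; rw [h]))
    (by
      rw [s.sameFace_iff hl hnf, s.incl_opp]
      rcases h1 with h1 | h1
      · exact Or.inl h1
      · exact Or.inr (Or.inr h1))
    (by rw [s.sameFace_iff hl hnf, s.incl_opp]; exact Or.inl h2)
  exact ⟨Q, R, hPQ, (isNonSeifertSplice_iff hQ R).mpr ⟨c', o', ho', ht, ⟨r⟩⟩, q.1, q.2, hq⟩

theorem ThreeCircle.rotate {x y z : P.Dart} (h : P.ThreeCircle x y z) : P.ThreeCircle y z x := by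
  obtain ⟨⟨a, b, c⟩, ⟨d, e, f⟩, g, i, j⟩ := h
  exact ⟨⟨b, c, a⟩, ⟨e, f, d⟩, i, j, g⟩

theorem ThreeCircle.opp {x y z : P.Dart} (h : P.ThreeCircle x y z) :
    P.ThreeCircle (P.opp x) (P.opp z) (P.opp y) := by
  obtain ⟨⟨a, b, c⟩, ⟨d, e, f⟩, g, i, j⟩ := h
  refine ⟨⟨c.symm, b.symm, a.symm⟩, ?_, fun h => ?_, fun h => ?_, fun h => ?_⟩
  · rw [opp_opp, opp_opp, opp_opp]; exact ⟨f.symm, e.symm, d.symm⟩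
  · exact i (e.trans (h.symm.trans f.symm))
  · exact g (d.trans (h.symm.trans e.symm))
  · exact j (f.trans (h.symm.trans d.symm))

/-- Each of the two segments of the circle either lies in an old face or crosses the merged face
through `b`. Not both segments can use the merged face: the faces on the circle are distinct and `P`
is reduced. -/
theorem circle_of_splice (hP : P.IsReduced) {Q : KnotProjection.{u}} {b : P.Dart}
    (s : Splicing P.toFourValentMap Q.toFourValentMap b) {x y : Q.Dart} (h : Q.TwoCircle x y) :
    P.TwoCircle (s.incl x) (s.incl y) ∨
      ∃ c, (c = b ∨ c = P.opp b) ∧ (P.ThreeCircle (s.incl x) c (s.incl y) ∨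
        P.ThreeCircle (s.incl x) (s.incl y) c) := by
  obtain ⟨h1, h2, h3, h4⟩ := h
  have hl := edge_fst_ne hP
  have hnf := not_sameFace_opp hP b
  have hnx := not_sameFace_opp hP (s.incl x)
  have hny := not_sameFace_opp hP (s.incl y)
  rw [s.sameFace_iff hl hnf] at h2 h3 h4
  rw [s.incl_opp] at h2 h3
  have hxy : (s.incl x).1 ≠ (s.incl y).1 := fun h => h1 (s.vertices.injective (Subtype.ext h))
  have hxb := s.incl_fst_ne x
  have hyb := s.incl_fst_ne y
  generalize s.incl x = x at *
  generalize s.incl y = y at *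
  push Not at h4
  obtain ⟨h4, h5, h6⟩ := h4
  have mk : ∀ c, (c = b ∨ c = P.opp b) → P.SameFace x (P.opp c) → P.SameFace c (P.opp y) →
      P.SameFace y (P.opp x) → P.ThreeCircle x c y := by
    intro c hc e1 e2 e3
    have hcb : c.1 = b.1 := by rcases hc with rfl | rfl <;> rfl
    have hc' := not_sameFace_opp hP c
    exact ⟨⟨hcb ▸ hxb, hcb ▸ hyb.symm, hxy.symm⟩, ⟨e1, e2, e3⟩,
      fun h => hc' (h.symm.trans e1), fun h => hny (h.symm.trans e2), fun h => h4 h.symm⟩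
  have mk' : ∀ c, (c = b ∨ c = P.opp b) → P.SameFace x (P.opp y) → P.SameFace y (P.opp c) →
      P.SameFace c (P.opp x) → P.ThreeCircle x y c := by
    intro c hc e1 e2 e3
    have hcb : c.1 = b.1 := by rcases hc with rfl | rfl <;> rfl
    have hc' := not_sameFace_opp hP c
    exact ⟨⟨hxy, hcb ▸ hyb, hcb ▸ hxb.symm⟩, ⟨e1, e2, e3⟩,
      h4, fun h => hc' (h.symm.trans e2), fun h => hnx (h.symm.trans e3)⟩
  rcases h2 with h2 | ⟨h2, h2'⟩ | ⟨h2, h2'⟩ <;> rcases h3 with h3 | ⟨h3, h3'⟩ | ⟨h3, h3'⟩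
  · exact Or.inl ⟨hxy, h2, h3, h4⟩
  · exact Or.inr ⟨_, Or.inr rfl, Or.inr (mk' _ (Or.inr rfl) h2 (by rwa [opp_opp]) h3')⟩
  · exact Or.inr ⟨_, Or.inl rfl, Or.inr (mk' _ (Or.inl rfl) h2 h3 h3')⟩
  · exact Or.inr ⟨_, Or.inr rfl, Or.inl (mk _ (Or.inr rfl) (by rwa [opp_opp]) h2' h3)⟩
  · exact absurd (h2.trans h3.symm) h4
  · exact absurd (h2.trans h3') hnx
  · exact Or.inr ⟨_, Or.inl rfl, Or.inl (mk _ (Or.inl rfl) h2 h2' h3)⟩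
  · exact absurd (h2.trans h3') hnx
  · exact absurd (h2.trans h3.symm) h4

theorem ThreeCircle.sides {x y z : P.Dart} (h : P.ThreeCircle x y z) :
    ∃ col : P.Dart → Bool, (∀ d, col (P.edge d) = col d) ∧
      (∀ d : P.Dart, d.1 ∉ ({x.1, y.1, z.1} : Set P.V) → ∀ k, col (P.turn k d) = col d) ∧
      (∀ s, col (P.front s x) = s ∧ col (P.back s x) = s) ∧
      (∀ s, col (P.front s y) = s ∧ col (P.back s y) = s) ∧
      ∀ s, col (P.front s z) = s ∧ col (P.back s z) = s := by
  obtain ⟨⟨a, b, c⟩, ⟨d, e, f⟩, g, i, j⟩ := h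
  obtain ⟨col, h1, h2, h3⟩ := exists_sides (P := P) ![x, y, z] (finRotate 3) 0
    (fun i => ⟨(i : ℕ), by rw [zpow_natCast]; revert i; decide⟩)
    (by intro k l
        fin_cases k <;> fin_cases l <;>
          first
          | exact fun _ => rfl
          | exact fun h => absurd h (by assumption)
          | exact fun h => absurd h.symm (by assumption))
    (by intro k
        fin_cases k <;> assumption)
    (by intro k l
        fin_cases k <;> fin_cases l <;>
          first
          | exact fun _ => rfl
          | exact fun h => absurd h (by assumption)
          | exact fun h => absurd h.symm (by assumption))
  refine ⟨col, h1, fun d hd => h2 d (fun i => ?_), fun s => h3 s 0, fun s => h3 s 1, fun s => h3 s 2⟩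
  fin_cases i
  · exact fun h => hd (Or.inl h)
  · exact fun h => hd (Or.inr (Or.inl h))
  · exact fun h => hd (Or.inr (Or.inr h))

/-- The front or back branch on the side `s`. -/
def branch (P : KnotProjection.{u}) (s t : Bool) (x : P.Dart) : P.Dart :=
  if t then P.front s x else P.back s x

theorem branch_fst (s t : Bool) (x : P.Dart) : (P.branch s t x).1 = x.1 := by
  cases s <;> cases t <;> rfl

theorem branch_ne (s t : Bool) {x y : P.Dart} (s' t' : Bool) (h : x.1 ≠ y.1) :
    P.branch s t x ≠ P.branch s' t' y := fun h' => by
  have := congrArg Prod.fst h'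
  rw [branch_fst, branch_fst] at this
  exact h this

theorem branch_not_ne (s t : Bool) (x : P.Dart) : P.branch s (!t) x ≠ P.branch s t x := by
  cases s <;> cases t <;> exact turn_ne (by decide)

theorem opp_branch (s t : Bool) (x : P.Dart) : P.opp (P.branch s t x) = P.branch (!s) (!t) x := by
  cases t
  · exact opp_back s x
  · exact opp_front s x

theorem branch_opp (s t : Bool) (x : P.Dart) : P.branch s t (P.opp x) = P.branch (!s) (!t) x := by
  cases t
  · exact back_opp s x
  · exact front_opp s x

/-- The arcs on one side of a circle through three double points of which the second one is
spliced first and the third one is spliced next, both by non-Seifert splices. -/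
theorem ThreeCircle.arcs {x y z : P.Dart} (h : P.ThreeCircle x y z) {o o₁ : P.Dart → Bool}
    (ho : P.IsOrientation o) (hy : P.NonSeifert o y) (ho₁ : P.SplicedOrientation y o₁)
    (s : Bool) (hz : o₁ (P.front s z) = o₁ (P.back s z)) :
    ∃ i j k : Bool, P.Arc {x.1, y.1, z.1} (P.branch s i x) (P.branch s j y) ∧
      P.Arc {x.1, y.1, z.1} (P.branch s (!i) x) (P.branch s k z) ∧
      P.Arc {x.1, y.1, z.1} (P.branch s (!j) y) (P.branch s (!k) z) := by
  obtain ⟨col, ha, hb, cx, cy, cz⟩ := h.sides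
  obtain ⟨⟨nxy, nyz, nzx⟩, -, -⟩ := h
  have xS : x.1 ∈ ({x.1, y.1, z.1} : Set P.V) := Or.inl rfl
  have yS : y.1 ∈ ({x.1, y.1, z.1} : Set P.V) := Or.inr (Or.inl rfl)
  have zS : z.1 ∈ ({x.1, y.1, z.1} : Set P.V) := Or.inr (Or.inr rfl)
  generalize hS : ({x.1, y.1, z.1} : Set P.V) = S at *
  have mem : ∀ {s t : Bool} {w : P.Dart}, w.1 ∈ S → (P.branch s t w).1 ∈ S := fun {s t w} hw => by
    rwa [branch_fst]
  have mate : ∀ d : P.Dart, col d = s → ∃ e, P.Arc S d e ∧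
      ∃ t, e = P.branch s t x ∨ e = P.branch s t y ∨ e = P.branch s t z := by
    intro d hd
    obtain ⟨e, he⟩ := Arc.exists xS d
    have hc := he.const ha fun d hd => hb d hd 2
    refine ⟨e, he, ?_⟩
    have hm := he.mem
    rw [← hS] at hm
    rcases hm with hm | hm | hm
    · rcases eq_front_or_back cx hm (hc.trans hd) with h | h
      · exact ⟨true, Or.inl h⟩
      · exact ⟨false, Or.inl h⟩
    · rcases eq_front_or_back cy hm (hc.trans hd) with h | h
      · exact ⟨true, Or.inr (Or.inl h)⟩
      · exact ⟨false, Or.inr (Or.inl h)⟩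
    · rcases eq_front_or_back cz hm (hc.trans hd) with h | h
      · exact ⟨true, Or.inr (Or.inr h)⟩
      · exact ⟨false, Or.inr (Or.inr h)⟩
  have colx : ∀ t, col (P.branch s t x) = s := fun t => by
    cases t; exacts [(cx s).2, (cx s).1]
  have coly : ∀ t, col (P.branch s t y) = s := fun t => by
    cases t; exacts [(cy s).2, (cy s).1]
  have colz : ∀ t, col (P.branch s t z) = s := fun t => by
    cases t; exacts [(cz s).2, (cz s).1]
  have oy : ∀ t, o (P.branch s t y) = o (P.front s y) := fun t => by
    cases t
    · exact ((nonSeifert_iff ho s y).mp hy).symm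
    · rfl
  have o₁y : o₁ (P.branch s false y) = !o₁ (P.branch s true y) := ho₁.back s
  have o₁z : ∀ t, o₁ (P.branch s t z) = o₁ (P.front s z) := fun t => by
    cases t
    · exact hz.symm
    · rfl
  have hoa : ∀ {d e : P.Dart}, P.Arc S d e → o e = !o d := fun h => h.flip_orientation ho
  have hoa₁ : ∀ {d e : P.Dart}, P.Arc S d e → o₁ e = !o₁ d := fun h => ho₁.arc yS h
  have inj : ∀ {d e f : P.Dart}, P.Arc S d f → P.Arc S e f → d.1 ∈ S → e.1 ∈ S → d = e :=
    fun h h' hd he => h.injective h' hd he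
  have yx_or_yz : ∀ t, ∃ t', P.Arc S (P.branch s t y) (P.branch s t' x) ∨
      P.Arc S (P.branch s t y) (P.branch s t' z) := by
    intro t
    obtain ⟨e, he, t', rfl | rfl | rfl⟩ := mate _ (coly t)
    · exact ⟨t', Or.inl he⟩
    · have := hoa he
      rw [oy, oy] at this
      exact absurd this.symm (Bool.not_ne_self _)
    · exact ⟨t', Or.inr he⟩
  have finish : ∀ i j k, P.Arc S (P.branch s j y) (P.branch s i x) →
      P.Arc S (P.branch s (!j) y) (P.branch s k z) →
      ∃ i j k : Bool, P.Arc S (P.branch s i x) (P.branch s j y) ∧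
      P.Arc S (P.branch s (!i) x) (P.branch s k z) ∧
      P.Arc S (P.branch s (!j) y) (P.branch s (!k) z) := by
    intro i j k h1 h2
    refine ⟨i, j, !k, h1.symm (mem yS), ?_, by rwa [Bool.not_not]⟩
    obtain ⟨e, he, t', rfl | rfl | rfl⟩ := mate _ (colx (!i))
    · exfalso
      rcases Bool.eq_or_eq_not t' i with rfl | rfl
      · exact branch_ne _ _ _ _ nxy (inj he h1 (mem xS) (mem yS))
      · exact he.irrefl
    · exfalso
      have he' := he.symm (mem xS)
      rcases Bool.eq_or_eq_not t' j with rfl | rfl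
      · exact branch_not_ne _ _ _ (he'.unique h1)
      · exact branch_ne _ _ _ _ nzx.symm (he'.unique h2)
    · rcases Bool.eq_or_eq_not t' k with rfl | rfl
      · exact absurd (inj he h2 (mem xS) (mem yS)) (branch_ne _ _ _ _ nxy)
      · exact he
  obtain ⟨t₁, h1 | h1⟩ := yx_or_yz true <;> obtain ⟨t₂, h2 | h2⟩ := yx_or_yz false
  · exfalso
    have h12 : t₂ = !t₁ := by
      rcases Bool.eq_or_eq_not t₂ t₁ with rfl | h
      · exact absurd (inj h2 h1 (mem yS) (mem yS)) (branch_not_ne s true y)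
      · exact h
    subst h12
    obtain ⟨e, he, t', rfl | rfl | rfl⟩ := mate _ (colz true)
    · rcases Bool.eq_or_eq_not t' t₁ with rfl | rfl
      · exact branch_ne _ _ _ _ nyz (inj h1 he (mem yS) (mem zS))
      · exact branch_ne _ _ _ _ nyz (inj h2 he (mem yS) (mem zS))
    · have he' := he.symm (mem zS)
      cases t'
      · exact branch_ne _ _ _ _ nzx (he'.unique h2)
      · exact branch_ne _ _ _ _ nzx (he'.unique h1)
    · have := hoa₁ he
      rw [o₁z, o₁z] at this
      exact Bool.not_ne_self _ this.symm
  · exact finish _ true _ h1 h2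
  · exact finish _ false _ h2 h1
  · exfalso
    have e1 := hoa₁ h1
    have e2 := hoa₁ h2
    rw [o₁z] at e1 e2
    rw [e1, o₁y, Bool.not_not] at e2
    exact Bool.not_ne_self _ e2

end KnotProjection

/-! ### Triangular configurations. -/

/-- The arcs on a circle through three double points, on both sides of which an arc joins the
first and the second double point, another one the first and the third one, and another one the
second and the third one.  A branch is given by its double point, by its side, and by whether it
is a front branch. -/
def triangleMate (i j k i' j' k' : Bool) (p : Fin 3 × Bool × Bool) : Fin 3 × Bool × Bool :=
  let a := if p.2.1 then i else i'
  let b := if p.2.1 then j else j'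
  let c := if p.2.1 then k else k'
  match p.1 with
  | 0 => if p.2.2 = a then (1, p.2.1, b) else (2, p.2.1, c)
  | 1 => if p.2.2 = b then (0, p.2.1, a) else (2, p.2.1, !c)
  | 2 => if p.2.2 = c then (0, p.2.1, !a) else (1, p.2.1, !b)

/-- Renaming of the branches when the circle starts at `r` and is reversed if `f` holds. -/
def relabel (r : Fin 3) (f : Bool) (t : Fin 3) (s i : Bool) : Fin 3 × Bool × Bool :=
  (if f then r - t else r + t, s ^^ f, i ^^ f)

def IsTriangleOneMate (m : Fin 3 × Bool × Bool → Fin 3 × Bool × Bool) (r : Fin 3) (f s : Bool) :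
    Prop :=
  (m (relabel r f 0 s true) = relabel r f 1 s true ∧
    m (relabel r f 0 s false) = relabel r f 2 s true ∧
    m (relabel r f 1 s false) = relabel r f 2 s false) ∧
  m (relabel r f 0 (!s) true) = relabel r f 1 (!s) true ∧
    m (relabel r f 0 (!s) false) = relabel r f 2 (!s) false ∧
    m (relabel r f 1 (!s) false) = relabel r f 2 (!s) true

def IsTriangleTwoMate (m : Fin 3 × Bool × Bool → Fin 3 × Bool × Bool) (r : Fin 3) (f s : Bool) :
    Prop :=
  (m (relabel r f 0 s true) = relabel r f 1 s true ∧
    m (relabel r f 0 s false) = relabel r f 2 s true ∧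
    m (relabel r f 1 s false) = relabel r f 2 s false) ∧
  m (relabel r f 0 (!s) true) = relabel r f 1 (!s) false ∧
    m (relabel r f 1 (!s) true) = relabel r f 2 (!s) false ∧
    m (relabel r f 2 (!s) true) = relabel r f 0 (!s) false

def IsTriangleThreeMate (m : Fin 3 × Bool × Bool → Fin 3 × Bool × Bool) (r : Fin 3)
    (f s : Bool) : Prop :=
  (m (relabel r f 0 s true) = relabel r f 1 s true ∧
    m (relabel r f 0 s false) = relabel r f 2 s false ∧
    m (relabel r f 1 s false) = relabel r f 2 s true) ∧
  m (relabel r f 0 (!s) true) = relabel r f 2 (!s) false ∧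
    m (relabel r f 1 (!s) true) = relabel r f 0 (!s) false ∧
    m (relabel r f 2 (!s) true) = relabel r f 1 (!s) false

instance (m : Fin 3 × Bool × Bool → Fin 3 × Bool × Bool) (r : Fin 3) (f s : Bool) :
    Decidable (IsTriangleOneMate m r f s) := by unfold IsTriangleOneMate; infer_instance

instance (m : Fin 3 × Bool × Bool → Fin 3 × Bool × Bool) (r : Fin 3) (f s : Bool) :
    Decidable (IsTriangleTwoMate m r f s) := by unfold IsTriangleTwoMate; infer_instance

instance (m : Fin 3 × Bool × Bool → Fin 3 × Bool × Bool) (r : Fin 3) (f s : Bool) :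
    Decidable (IsTriangleThreeMate m r f s) := by unfold IsTriangleThreeMate; infer_instance

/-- Of the 64 pairings, those that come from a one-component curve with suitable orientations form
one of the three triangular configurations. -/
theorem triangleMate_cases (i j k i' j' k' : Bool) (h : ¬ (i' = i ∧ k' = k))
    (hc : ∀ p, triangleMate i j k i' j' k' (p.1, !p.2.1, !p.2.2) ≠
      ((triangleMate i j k i' j' k' p).1, !(triangleMate i j k i' j' k' p).2.1,
        !(triangleMate i j k i' j' k' p).2.2)) :
    ∃ r f s, IsTriangleOneMate (triangleMate i j k i' j' k') r f s ∨
      IsTriangleTwoMate (triangleMate i j k i' j' k') r f s ∨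
      IsTriangleThreeMate (triangleMate i j k i' j' k') r f s := by
  revert i j k i' j' k'
  decide +kernel

theorem triangleMate_fst_ne (i j k i' j' k' : Bool) (p : Fin 3 × Bool × Bool) :
    (triangleMate i j k i' j' k' p).1 ≠ p.1 := by
  revert i j k i' j' k' p
  decide +kernel

namespace KnotProjection
open FourValentMap
variable {P : KnotProjection.{u}}

/-- The renaming `relabel` is realized geometrically: `ThreeCircle.rotate` changes the starting
point, and `ThreeCircle.opp` reverses the circle, which exchanges both left with right and front
with back. -/
theorem ThreeCircle.hasTriangleCircle {c : Fin 3 → P.Dart} (h : P.ThreeCircle (c 0) (c 1) (c 2))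
    {m : Fin 3 × Bool × Bool → Fin 3 × Bool × Bool}
    (hm : ∀ p, P.Arc {(c 0).1, (c 1).1, (c 2).1} (P.branch p.2.1 p.2.2 (c p.1))
      (P.branch (m p).2.1 (m p).2.2 (c (m p).1)))
    (ht : ∃ r f s, IsTriangleOneMate m r f s ∨ IsTriangleTwoMate m r f s ∨
      IsTriangleThreeMate m r f s) : P.HasTriangleCircle := by
  obtain ⟨r, f, s, ht⟩ := ht
  let c' : Fin 3 → P.Dart := fun t => if f then P.opp (c (r - t)) else c (r + t)
  have hc' : P.ThreeCircle (c' 0) (c' 1) (c' 2) := by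
    have h1 := h.rotate
    have h2 := h1.rotate
    have h3 := h.opp
    have h4 := h1.opp
    have h5 := h2.opp
    cases f <;> fin_cases r <;> assumption
  have hS : ({(c 0).1, (c 1).1, (c 2).1} : Set P.V) = {(c' 0).1, (c' 1).1, (c' 2).1} := by
    have e1 : ∀ a b c : P.V, ({a, b, c} : Set P.V) = {b, c, a} := fun a b c => by
      ext v; simp only [Set.mem_insert_iff, Set.mem_singleton_iff]; tauto
    have e2 : ∀ a b c : P.V, ({a, b, c} : Set P.V) = {a, c, b} := fun a b c => by
      ext v; simp only [Set.mem_insert_iff, Set.mem_singleton_iff]; tauto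
    have h1 := e1 (c 0).1 (c 1).1 (c 2).1
    have h2 := h1.trans (e1 _ _ _)
    have h3 := e2 (c 0).1 (c 1).1 (c 2).1
    have h4 := h1.trans (e2 _ _ _)
    have h5 := h2.trans (e2 _ _ _)
    cases f <;> fin_cases r <;> first | rfl | assumption
  have key : ∀ {t t' : Fin 3} {u u' i i' : Bool}, m (relabel r f t u i) = relabel r f t' u' i' →
      P.Arc {(c' 0).1, (c' 1).1, (c' 2).1} (P.branch u i (c' t)) (P.branch u' i' (c' t')) := by
    intro t t' u u' i i' he
    have h1 := hm (relabel r f t u i)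
    rw [he, hS] at h1
    cases f
    · simpa [relabel, c'] using h1
    · simpa [relabel, c', branch_opp] using h1
  refine ⟨c' 0, c' 1, c' 2, hc', ?_⟩
  rcases ht with ht | ht | ht
  · obtain ⟨⟨a1, a2, a3⟩, a4, a5, a6⟩ := ht
    exact Or.inl ⟨s, ⟨key a1, key a2, key a3⟩, key a4, key a5, key a6⟩
  · obtain ⟨⟨a1, a2, a3⟩, a4, a5, a6⟩ := ht
    exact Or.inr (Or.inl ⟨s, ⟨key a1, key a2, key a3⟩, key a4, key a5, key a6⟩)
  · obtain ⟨⟨a1, a2, a3⟩, a4, a5, a6⟩ := ht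
    exact Or.inr (Or.inr ⟨s, ⟨key a1, key a2, key a3⟩, key a4, key a5, key a6⟩)

/-- Each side contributes three Boolean parameters. The two restrictions demanded by
`triangleMate_cases` come from the directions along the arcs, given the non-Seifert splice at `y`,
and from the curve having one component. -/
theorem hasTriangleCircle_of_splices {x y z : P.Dart} (h : P.ThreeCircle x y z)
    {o o₁ : P.Dart → Bool} (ho : P.IsOrientation o) (hy : P.NonSeifert o y)
    (ho₁ : P.SplicedOrientation y o₁) (hz : ∀ s, o₁ (P.front s z) = o₁ (P.back s z)) :
    P.HasTriangleCircle := by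
  obtain ⟨i, j, k, a1, a2, a3⟩ := h.arcs ho hy ho₁ true (hz _)
  obtain ⟨i', j', k', b1, b2, b3⟩ := h.arcs ho hy ho₁ false (hz _)
  let c : Fin 3 → P.Dart := ![x, y, z]
  have xS : x.1 ∈ ({x.1, y.1, z.1} : Set P.V) := Or.inl rfl
  have yS : y.1 ∈ ({x.1, y.1, z.1} : Set P.V) := Or.inr (Or.inl rfl)
  have zS : z.1 ∈ ({x.1, y.1, z.1} : Set P.V) := Or.inr (Or.inr rfl)
  have mem : ∀ {s t : Bool} {w : P.Dart}, w.1 ∈ ({x.1, y.1, z.1} : Set P.V) →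
      (P.branch s t w).1 ∈ ({x.1, y.1, z.1} : Set P.V) := fun {s t w} hw => by
    rwa [branch_fst]
  have cS : ∀ v, (c v).1 ∈ ({x.1, y.1, z.1} : Set P.V) := fun v => by
    fin_cases v
    exacts [xS, yS, zS]
  have hinj : ∀ v w, (c v).1 = (c w).1 → v = w := by
    obtain ⟨⟨h1, h2, h3⟩, -, -⟩ := h
    intro v w
    fin_cases v <;> fin_cases w <;>
      first
      | exact fun _ => rfl
      | exact fun h => absurd h (by assumption)
      | exact fun h => absurd h.symm (by assumption)
  have hm : ∀ p, P.Arc {x.1, y.1, z.1} (P.branch p.2.1 p.2.2 (c p.1))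
      (P.branch (triangleMate i j k i' j' k' p).2.1 (triangleMate i j k i' j' k' p).2.2
        (c (triangleMate i j k i' j' k' p).1)) := by
    rintro ⟨v, s, t⟩
    have a1' := a1.symm (mem xS)
    have a2' := a2.symm (mem xS)
    have a3' := a3.symm (mem yS)
    have b1' := b1.symm (mem xS)
    have b2' := b2.symm (mem xS)
    have b3' := b3.symm (mem yS)
    cases s <;> fin_cases v
    · rcases Bool.eq_or_eq_not t i' with rfl | rfl
      · simpa [triangleMate, c] using b1
      · simpa [triangleMate, c] using b2
    · rcases Bool.eq_or_eq_not t j' with rfl | rfl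
      · simpa [triangleMate, c] using b1'
      · simpa [triangleMate, c] using b3
    · rcases Bool.eq_or_eq_not t k' with rfl | rfl
      · simpa [triangleMate, c] using b2'
      · simpa [triangleMate, c] using b3'
    · rcases Bool.eq_or_eq_not t i with rfl | rfl
      · simpa [triangleMate, c] using a1
      · simpa [triangleMate, c] using a2
    · rcases Bool.eq_or_eq_not t j with rfl | rfl
      · simpa [triangleMate, c] using a1'
      · simpa [triangleMate, c] using a3
    · rcases Bool.eq_or_eq_not t k with rfl | rfl
      · simpa [triangleMate, c] using a2'
      · simpa [triangleMate, c] using a3'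
  refine ThreeCircle.hasTriangleCircle (c := c) h hm (triangleMate_cases i j k i' j' k' ?_ ?_)
  -- Following directions from `x` to `y` to `z` on the left, across `z`, and back to `x` on the
  -- right leads to a contradiction, since both branches of `y` on the left have the same direction.
  · rintro ⟨rfl, rfl⟩
    have e1 := a1.flip_orientation ho
    have e4 := b2.flip_orientation ho
    have e5 := a3.flip_orientation ho
    have oy : ∀ s t t', o (P.branch s t y) = o (P.branch s t' y) := fun s t t' => by
      have := (nonSeifert_iff ho s y).mp hy
      cases t <;> cases t'
      exacts [rfl, this.symm, this, rfl]
    have op : ∀ s t w, o (P.branch s t w) = !o (P.branch (!s) (!t) w) := fun s t w => by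
      rw [← opp_branch, ho.2, Bool.not_not]
    have p1 := op false (!i') x
    have p2 := op false k' z
    rw [Bool.not_not] at p1
    rw [p2, p1] at e4
    simp only [Bool.not_false] at e4
    rw [e5, oy true (!j) j, e1, Bool.not_not, Bool.not_not] at e4
    exact Bool.not_ne_self _ e4
  · rintro ⟨v, s, t⟩ he
    have h1 := hm (v, s, t)
    have h2 := hm (v, !s, !t)
    simp only at he
    rw [he] at h2
    rw [← opp_branch, ← opp_branch] at h2
    refine h1.not_opp (mem (cS _)) ?_ h2
    rw [branch_fst, branch_fst]
    refine fun hv => triangleMate_fst_ne i j k i' j' k' (v, s, t) (hinj _ _ hv)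

/-- In the first two configurations the splices at `x` and then `y` make `z` nugatory; in the third
one the splices at `y` and then `z` make `x` nugatory. In each case the arcs force the required
equalities of directions, first for the original curve and then for the spliced one. -/
theorem HasTriangleCircle.reductivity (hP : P.IsReduced) (h : P.HasTriangleCircle) :
    P.reductivity = 1 ∨ P.reductivity = 2 := by
  obtain ⟨x, y, z, ⟨⟨nxy, nyz, nzx⟩, ⟨fxy, fyz, fzx⟩, -⟩, hT⟩ := h
  obtain ⟨o, ho⟩ := P.exists_orientation
  have xS : x.1 ∈ ({x.1, y.1, z.1} : Set P.V) := Or.inl rfl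
  have yS : y.1 ∈ ({x.1, y.1, z.1} : Set P.V) := Or.inr (Or.inl rfl)
  have flip : ∀ {d e : P.Dart}, P.Arc {x.1, y.1, z.1} d e → o e = !o d :=
    fun h => h.flip_orientation ho
  have op : ∀ s (w : P.Dart), o (P.back (!s) w) = !o (P.front s w) := fun s w => by
    rw [← opp_front, ho.2]
  have op' : ∀ s (w : P.Dart), o (P.front (!s) w) = !o (P.back s w) := fun s w => by
    rw [← opp_back, ho.2]
  have sop : ∀ {b : P.Dart} {o₁ : P.Dart → Bool}, P.SplicedOrientation b o₁ →
      ∀ s (w : P.Dart), w.1 ≠ b.1 → o₁ (P.back (!s) w) = !o₁ (P.front s w) ∧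
        o₁ (P.front (!s) w) = !o₁ (P.back s w) := fun h s w hw => by
    rw [← opp_front, ← opp_back, h.opp, h.opp]
    · exact ⟨rfl, rfl⟩
    · rwa [back_fst]
    · rwa [front_fst]
  rcases hT with ⟨s, ⟨a1, a2, a3⟩, a4, a5, a6⟩ | ⟨s, ⟨a1, a2, a3⟩, a4, a5, a6⟩ |
    ⟨s, ⟨a1, a2, a3⟩, a4, a5, a6⟩
  · refine exists_two_splices hP (a := z) (b := x) (c := y) nzx nxy.symm nyz.symm
      (Or.inr ⟨fzx, fxy⟩) fyz ho ((nonSeifert_iff ho s x).mpr ?_) fun o₁ ho₁ => ⟨s, ?_⟩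
    · have := flip a1; have := flip a2; have := flip a3
      have := flip a4; have := flip a5; have := flip a6
      have := op s x; have := op s y; have := op s z
      have := op' s x; have := op' s y; have := op' s z
      clear flip op op' sop a1 a2 a3 a4 a5 a6
      cases h1 : o (P.front s x) <;> cases h2 : o (P.back s x) <;>
        cases h3 : o (P.back s y) <;> simp_all
    · have := ho₁.arc xS a1; have := ho₁.arc xS a2; have := ho₁.arc xS a3
      have := ho₁.arc xS a4; have := ho₁.arc xS a5; have := ho₁.arc xS a6
      have := sop ho₁ s y nxy.symm; have := sop ho₁ s z nzx
      have := ho₁.back s; have := ho₁.back (!s)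
      clear flip op op' sop a1 a2 a3 a4 a5 a6
      cases h1 : o₁ (P.front s x) <;> cases h2 : o₁ (P.back s x) <;>
        cases h3 : o₁ (P.back s y) <;> simp_all
  · refine exists_two_splices hP (a := z) (b := x) (c := y) nzx nxy.symm nyz.symm
      (Or.inr ⟨fzx, fxy⟩) fyz ho ((nonSeifert_iff ho s x).mpr ?_) fun o₁ ho₁ => ⟨s, ?_⟩
    · have := flip a1; have := flip a2; have := flip a3
      have := flip a4; have := flip a5; have := flip a6
      have := op s x; have := op s y; have := op s z
      have := op' s x; have := op' s y; have := op' s z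
      clear flip op op' sop a1 a2 a3 a4 a5 a6
      cases h1 : o (P.front s x) <;> cases h2 : o (P.back s x) <;>
        cases h3 : o (P.back s y) <;> simp_all
    · have := ho₁.arc xS a1; have := ho₁.arc xS a2; have := ho₁.arc xS a3
      have := ho₁.arc xS a4; have := ho₁.arc xS a5; have := ho₁.arc xS a6
      have := sop ho₁ s y nxy.symm; have := sop ho₁ s z nzx
      have := ho₁.back s; have := ho₁.back (!s)
      clear flip op op' sop a1 a2 a3 a4 a5 a6
      cases h1 : o₁ (P.front s x) <;> cases h2 : o₁ (P.back s x) <;>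
        cases h3 : o₁ (P.back s y) <;> simp_all
  · refine exists_two_splices hP (a := x) (b := y) (c := z) nxy nyz.symm nzx.symm
      (Or.inr ⟨fxy, fyz⟩) fzx ho ((nonSeifert_iff ho s y).mpr ?_) fun o₁ ho₁ => ⟨s, ?_⟩
    · have := flip a1; have := flip a2; have := flip a3
      have := flip a4; have := flip a5; have := flip a6
      have := op s x; have := op s y; have := op s z
      have := op' s x; have := op' s y; have := op' s z
      clear flip op op' sop a1 a2 a3 a4 a5 a6
      cases h1 : o (P.front s x) <;> cases h2 : o (P.back s x) <;>
        cases h3 : o (P.back s y) <;> simp_all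
    · have := ho₁.arc yS a1; have := ho₁.arc yS a2; have := ho₁.arc yS a3
      have := ho₁.arc yS a4; have := ho₁.arc yS a5; have := ho₁.arc yS a6
      have := sop ho₁ s x nxy; have := sop ho₁ s z nyz.symm
      have := ho₁.back s; have := ho₁.back (!s)
      clear flip op op' sop a1 a2 a3 a4 a5 a6
      cases h1 : o₁ (P.front s x) <;> cases h2 : o₁ (P.back s x) <;>
        cases h3 : o₁ (P.back s y) <;> simp_all

/-! ### Loop configurations have reductivity at most two. -/

theorem exists_branch {b e : P.Dart} (h : e.1 = b.1) : ∃ s t, e = P.branch s t b := by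
  rcases eq_turn_cases h with h | h | h | h
  · exact ⟨false, true, h.trans (turn_zero b).symm⟩
  · exact ⟨true, true, h⟩
  · exact ⟨true, false, h⟩
  · exact ⟨false, false, h⟩

theorem exists_nonSeifert {o : P.Dart → Bool} (ho : P.IsOrientation o) (v : P.V) :
    ∃ b : P.Dart, b.1 = v ∧ P.NonSeifert o b := by
  by_cases h : P.NonSeifert o (v, 0)
  · exact ⟨_, rfl, h⟩
  · refine ⟨P.turn 1 (v, 0), rfl, ?_⟩
    have h1 := ho.turn_three (v, 0)
    rw [NonSeifert, turn_turn, turn_turn, (by decide : (1 + 1 : ZMod 4) = 2),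
      (by decide : (1 + 2 : ZMod 4) = 3), h1]
    rw [NonSeifert] at h
    revert h
    cases o (P.turn 1 (v, 0)) <;> cases o (P.turn 2 (v, 0)) <;> decide

/-- A non-Seifert splice joins the branches of equal direction, and a joined pair consists of one
incoming and one outgoing branch of the new curve. -/
theorem SplicedOrientation.ne_of_eq {b d e : P.Dart} {o o₁ : P.Dart → Bool}
    (ho : P.IsOrientation o) (hb : P.NonSeifert o b) (ho₁ : P.SplicedOrientation b o₁)
    (hd : d.1 = b.1) (he : e.1 = b.1) (hne : d ≠ e) (h : o d = o e) : o₁ e = !o₁ d := by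
  obtain ⟨s, t, rfl⟩ := exists_branch hd
  obtain ⟨s', t', rfl⟩ := exists_branch he
  have h1 : ∀ s t, o (P.branch s t b) = o (P.front s b) := fun s t => by
    cases t
    · exact ((nonSeifert_iff ho s b).mp hb).symm
    · rfl
  have h2 : o (P.front (!s) b) = !o (P.front s b) := by
    rw [← opp_back, ho.2, (nonSeifert_iff ho s b).mp hb]
  rcases Bool.eq_or_eq_not s' s with rfl | rfl
  · rcases Bool.eq_or_eq_not t' t with rfl | rfl
    · exact absurd rfl hne
    · have := ho₁.back s'
      cases t
      · show o₁ (P.front s' b) = !o₁ (P.back s' b)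
        rw [this, Bool.not_not]
      · exact this
  · rw [h1, h1, h2] at h
    exact absurd h.symm (Bool.not_ne_self _)

/-- Splicing `c` replaces the two loops by arcs between `x` and `y`. After that a splice at `y` is
non-Seifert, and it makes `x` nugatory; the circle itself does not pass through `c`. -/
theorem reductivity_of_loops (hP : P.IsReduced) {x y : P.Dart} {c : P.V} (hT : P.TwoCircle x y)
    (hcx : c ≠ x.1) (hcy : c ≠ y.1) (h : P.LoopsParallel x y c ∨ P.LoopsCrossed x y c) :
    P.reductivity = 1 ∨ P.reductivity = 2 := by
  obtain ⟨nxy, fxy, fyx, -⟩ := hT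
  obtain ⟨o, ho⟩ := P.exists_orientation
  obtain ⟨b, rfl, hb⟩ := exists_nonSeifert ho c
  have bS : b.1 ∈ ({x.1, y.1, b.1} : Set P.V) := Or.inr (Or.inr rfl)
  have flip : ∀ {d e : P.Dart}, P.Arc {x.1, y.1, b.1} d e → o e = !o d :=
    fun h => h.flip_orientation ho
  have op : ∀ s (w : P.Dart), o (P.back (!s) w) = !o (P.front s w) := fun s w => by
    rw [← opp_front, ho.2]
  have op' : ∀ s (w : P.Dart), o (P.front (!s) w) = !o (P.back s w) := fun s w => by
    rw [← opp_back, ho.2]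
  have opb : ∀ p : ZMod 4, o (b.1, p + 2) = !o (b.1, p) := fun p => ho.2 (b.1, p)
  refine exists_two_splices hP hcx.symm hcy.symm nxy (Or.inl fxy) fyx ho hb fun o₁ ho₁ => ?_
  have flip₁ : ∀ {d e : P.Dart}, P.Arc {x.1, y.1, b.1} d e → o₁ e = !o₁ d :=
    fun h => ho₁.arc bS h
  have sop : ∀ s (w : P.Dart), w.1 ≠ b.1 → o₁ (P.back (!s) w) = !o₁ (P.front s w) ∧
        o₁ (P.front (!s) w) = !o₁ (P.back s w) := fun s w hw => by
    rw [← opp_front, ← opp_back, ho₁.opp, ho₁.opp]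
    · exact ⟨rfl, rfl⟩
    · rwa [back_fst]
    · rwa [front_fst]
  have main : ∀ s, P.LoopsCrossingAt b.1 s x y →
      P.ParallelPair {x.1, y.1, b.1} (!s) x y ∨ P.CrossedPair {x.1, y.1, b.1} (!s) x y →
      o₁ (P.front s y) = o₁ (P.back s y) := by
    rintro s ⟨p, q, a1, a2, a3, a4⟩ h
    have fS : (P.front s x).1 ∈ ({x.1, y.1, b.1} : Set P.V) := by rw [front_fst]; exact Or.inl rfl
    have fS' : (P.front s y).1 ∈ ({x.1, y.1, b.1} : Set P.V) := by
      rw [front_fst]; exact Or.inr (Or.inl rfl)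
    have bS' : (P.back s x).1 ∈ ({x.1, y.1, b.1} : Set P.V) := by rw [back_fst]; exact Or.inl rfl
    -- The four arcs reach `c` by four different branches, so `ne_of_eq` applies to any one from the
    -- loop at `x` together with any one from the loop at `y`.
    have hpq : p ≠ q := by
      rintro rfl
      have := congrArg Prod.fst (a1.injective a3 fS fS')
      rw [front_fst, front_fst] at this; exact nxy this
    have hpq' : p + 2 ≠ q := by
      rintro rfl
      have := congrArg Prod.fst (a2.injective a3 bS' fS')
      rw [front_fst, back_fst] at this; exact nxy this
    have n1 : ((b.1, p) : P.Dart) ≠ (b.1, q) := fun h => hpq (congrArg Prod.snd h)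
    have n2 : ((b.1, p) : P.Dart) ≠ (b.1, q + 2) := fun h => by
      have h2 : p = q + 2 := congrArg Prod.snd h
      rw [h2, add_assoc, (by decide : (2 + 2 : ZMod 4) = 0), add_zero] at hpq'
      exact hpq' rfl
    have n3 : ((b.1, p + 2) : P.Dart) ≠ (b.1, q) := fun h => hpq' (congrArg Prod.snd h)
    have n4 : ((b.1, p + 2) : P.Dart) ≠ (b.1, q + 2) := fun h =>
      hpq (add_right_cancel (congrArg Prod.snd h))
    have oglue : ∀ d e : P.Dart, d ≠ e → d.1 = b.1 → e.1 = b.1 → o d = o e → o₁ e = !o₁ d :=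
      fun d e hne hd he => SplicedOrientation.ne_of_eq ho hb ho₁ hd he hne
    have m1 := oglue _ _ n1 rfl rfl
    have m2 := oglue _ _ n2 rfl rfl
    have m3 := oglue _ _ n3 rfl rfl
    have m4 := oglue _ _ n4 rfl rfl
    have := flip a1; have := flip a2; have := flip a3; have := flip a4
    have := flip₁ a1; have := flip₁ a2; have := flip₁ a3; have := flip₁ a4
    have := op s x; have := op s y; have := op' s x; have := op' s y
    have := opb p; have := opb q
    have := sop s x hcx.symm; have := sop s y hcy.symm
    rcases h with h | h
    · have := flip h.1; have := flip h.2; have := flip₁ h.1; have := flip₁ h.2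
      clear n1 n2 n3 n4 hpq hpq' flip flip₁ op op' opb sop oglue a1 a2 a3 a4 h
      cases h1 : o (P.front s x) <;> cases h2 : o (P.front s y) <;>
        cases h3 : o₁ (P.front s x) <;> cases h4 : o₁ (P.back s x) <;> simp_all
    · have := flip h.1; have := flip h.2; have := flip₁ h.1; have := flip₁ h.2
      clear n1 n2 n3 n4 hpq hpq' flip flip₁ op op' opb sop oglue a1 a2 a3 a4 h
      cases h1 : o (P.front s x) <;> cases h2 : o (P.front s y) <;>
        cases h3 : o₁ (P.front s x) <;> cases h4 : o₁ (P.back s x) <;> simp_all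
  rcases h with ⟨s, h1, h2⟩ | ⟨s, h1, h2⟩
  · exact ⟨s, main s h1 (Or.inl h2)⟩
  · exact ⟨s, main s h1 (Or.inr h2)⟩

theorem HasThreePointDisk.reductivity (hP : P.IsReduced) (h : P.HasThreePointDisk) :
    P.reductivity = 1 ∨ P.reductivity = 2 := by
  rcases h with h | ⟨x, y, c, h1, h2, h3, h4⟩
  · exact h.reductivity hP
  · exact reductivity_of_loops hP h1 h2 h3 h4

theorem HasThreePointCircle.hasThreePointDisk (h : P.HasThreePointCircle) :
    P.HasThreePointDisk := by
  rcases h with h | ⟨x, y, c, ⟨h1, h2, h3, -⟩, h4⟩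
  · exact Or.inl h
  · exact Or.inr ⟨x, y, c, h1, h2, h3, h4⟩

/-! ### From two splices to crossing loops. -/

theorem Arc.refine {S T : Set P.V} {d e : P.Dart} (h : P.Arc S d e) (hST : S ⊆ T) {t : P.V}
    (ht : t ∈ T) (hS : ∀ f, P.Arc T d f → f.1 ∈ S) : P.Arc T d e := by
  obtain ⟨f, hf⟩ := Arc.exists ht d
  have := (hf.coarsen hST).1 (hS f hf)
  rwa [← this.unique h]

/-- Such an arc would close up to a component that meets `S` in a single double point. -/
theorem Arc.ne_opp {S : Set P.V} {d e : P.Dart} (hd : d.1 ∈ S) (he : e.1 ∈ S)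
    (hne : e.1 ≠ d.1) : ¬ P.Arc S d (P.opp d) := fun h => by
  have := Arc.closed (S := S) (fun f => f = d ∨ f = P.opp d) ?_ ?_ hd (Or.inl rfl) he
  · rcases this with rfl | rfl
    · exact hne rfl
    · exact hne rfl
  · rintro f g hf (rfl | rfl) hg
    · exact Or.inr (hg.unique h)
    · exact Or.inl (hg.unique (h.symm hd))
  · rintro f hf (rfl | rfl)
    · exact Or.inr rfl
    · exact Or.inl (opp_opp _)

theorem front_ne_back (s : Bool) (x : P.Dart) : P.front s x ≠ P.back s x := by
  cases s
  · exact turn_ne (by decide)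
  · exact turn_ne (by decide)

theorem pair_subset_triple (a b c : P.V) : ({a, b} : Set P.V) ⊆ {a, b, c} := fun v hv => by
  rcases hv with rfl | rfl
  · exact Or.inl rfl
  · exact Or.inr (Or.inl rfl)

/-- If a circle through two double points does not have crossed arcs on one side and parallel arcs
on the other, then it has loops on exactly one side. -/
theorem TwoCircle.exists_loops {x y : P.Dart} (h : P.TwoCircle x y)
    (hno : ¬ P.HasTwoPointCircle) :
    ∃ s, (P.Arc {x.1, y.1} (P.front s x) (P.back s x) ∧
        P.Arc {x.1, y.1} (P.front s y) (P.back s y)) ∧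
      (P.ParallelPair {x.1, y.1} (!s) x y ∨ P.CrossedPair {x.1, y.1} (!s) x y) := by
  have hxS : x.1 ∈ ({x.1, y.1} : Set P.V) := Or.inl rfl
  rcases h.arcs true with h1 | h1 | h1 <;> rcases h.arcs false with h2 | h2 | h2
  · exfalso
    obtain ⟨col, -, -, hx, -⟩ := h.sides
    have hl : ∀ s, P.Arc {x.1, y.1} (P.front s x) (P.back s x) := fun s => by
      cases s
      · exact h2.1
      · exact h1.1
    refine h.1.symm (Arc.closed (S := {x.1, y.1}) (fun e => e.1 = x.1) ?_ (fun d _ hd => hd) hxS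
      rfl (Or.inr rfl))
    intro d e hd hdx hde
    rcases eq_front_or_back hx hdx rfl with h' | h'
    · rw [h'] at hde
      rw [hde.unique (hl _), back_fst]
    · rw [h'] at hde
      rw [hde.unique ((hl _).symm (by rw [front_fst]; exact hxS)), front_fst]
  · exact ⟨true, h1, Or.inr h2⟩
  · exact ⟨true, h1, Or.inl h2⟩
  · exact ⟨false, h2, Or.inr h1⟩
  · exact absurd h2 (not_crossedPair_crossedPair (s := true) hxS h.1 h1)
  · exact absurd ⟨x, y, true, h, h1, h2⟩ hno
  · exact ⟨false, h2, Or.inl h1⟩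
  · exact absurd ⟨x, y, false, h, h2, h1⟩ hno
  · exact absurd h2 (not_parallelPair_parallelPair (s := true) hxS h.1 h1)

theorem eq_of_four_ne : ∀ p p' q q' r : ZMod 4, p ≠ p' → p ≠ q → p ≠ q' → p' ≠ q → p' ≠ q' →
    q ≠ q' → r = p ∨ r = p' ∨ r = q ∨ r = q' := by decide

/-- This is the case in which the circle of the second splice misses the first spliced point `b`.
Without a two-point circle, one side has loops; the condition `heq` that the splice at `y` is
non-Seifert after that at `b` forces both loops through `b`. -/
theorem hasThreePointDisk_of_twoCircle {x y b : P.Dart} (h : P.TwoCircle x y)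
    (hno : ¬ P.HasTwoPointCircle) (hbx : b.1 ≠ x.1) (hby : b.1 ≠ y.1) {o₁ : P.Dart → Bool}
    (ho₁ : P.SplicedOrientation b o₁) (heq : ∀ s, o₁ (P.front s y) = o₁ (P.back s y)) :
    P.HasThreePointDisk := by
  obtain ⟨s, ⟨lx, ly⟩, hpair⟩ := h.exists_loops hno
  obtain ⟨col, ha, hb, hx, hy⟩ := h.sides
  have hsub := pair_subset_triple x.1 y.1 b.1
  have xS : x.1 ∈ ({x.1, y.1, b.1} : Set P.V) := Or.inl rfl
  have yS : y.1 ∈ ({x.1, y.1, b.1} : Set P.V) := Or.inr (Or.inl rfl)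
  have bS : b.1 ∈ ({x.1, y.1, b.1} : Set P.V) := Or.inr (Or.inr rfl)
  have bS' : b.1 ∉ ({x.1, y.1} : Set P.V) := fun h => h.elim hbx hby
  have flip : ∀ {d e : P.Dart}, P.Arc {x.1, y.1, b.1} d e → o₁ e = !o₁ d :=
    fun h => ho₁.arc bS h
  -- The values of `o₁` alternate between the ends of any arc that avoids `b`. So an arc whose ends
  -- have equal values must pass through `b`.
  have atb : ∀ {d e f : P.Dart}, P.Arc {x.1, y.1, b.1} d e → P.Arc {x.1, y.1} d f →
      o₁ f = o₁ d → e.1 = b.1 := fun {d e f} he hf hfd => by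
    by_contra hne
    have hm : e.1 ∈ ({x.1, y.1} : Set P.V) := by
      rcases he.mem with h | h | h
      · exact Or.inl h
      · exact Or.inr h
      · exact absurd h hne
    have h1 := ((he.coarsen hsub).1 hm).unique hf
    subst h1
    exact Bool.not_ne_self _ ((flip he).symm.trans hfd)
  have lx' := lx.symm (by rw [front_fst]; exact Or.inl rfl)
  have ly' := ly.symm (by rw [front_fst]; exact Or.inr rfl)
  obtain ⟨⟨v, q⟩, hq⟩ := Arc.exists (P := P) xS (P.front s y)
  obtain rfl : v = b.1 := atb hq ly (heq s).symm
  obtain ⟨⟨v, q'⟩, hq'⟩ := Arc.exists (P := P) xS (P.back s y)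
  obtain rfl : v = b.1 := atb hq' ly' (heq s)
  have const : ∀ {d e : P.Dart}, P.Arc {x.1, y.1, b.1} d e → col e = col d :=
    fun h => h.const ha fun d hd => hb d (fun h => hd (hsub h)) 2
  have colb : ∀ e : P.Dart, e.1 = b.1 → col e = s := fun e he => by
    have h1 : e = P.turn (e.2 - q) (b.1, q) := eq_turn (e := (b.1, q)) he
    have h2 := hb (b.1, q) bS' (e.2 - q)
    rw [← h1, const hq, (hy s).1] at h2
    exact h2
  -- Since `b` lies on the side of the loops, the arcs on the other side are not cut by it.
  have fine : ∀ {d e : P.Dart}, col d = !s → P.Arc {x.1, y.1} d e → P.Arc {x.1, y.1, b.1} d e :=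
    fun {d e} hd he => he.refine hsub xS fun f hf => by
      rcases hf.mem with h | h | h
      · exact Or.inl h
      · exact Or.inr h
      · have h1 := const hf
        rw [hd, colb f h] at h1
        exact absurd h1.symm (Bool.not_ne_self _)
  have hpair' : P.ParallelPair {x.1, y.1, b.1} (!s) x y ∨
      P.CrossedPair {x.1, y.1, b.1} (!s) x y := by
    rcases hpair with h | h
    · exact Or.inl ⟨fine (hx _).1 h.1, fine (hx _).2 h.2⟩
    · exact Or.inr ⟨fine (hx _).1 h.1, fine (hx _).2 h.2⟩
  -- The arcs on the other side carry the equality of directions from `y` to `x`, so the loop at `x`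
  -- passes through `b` too.
  have hox : o₁ (P.back s x) = o₁ (P.front s x) := by
    have h1 : o₁ (P.front (!s) x) = o₁ (P.back (!s) x) := by
      have h3 := heq (!s)
      rcases hpair' with h | h
      · rw [flip h.1, flip h.2] at h3
        exact (Bool.not_inj h3).symm
      · rw [flip h.1, flip h.2] at h3
        exact Bool.not_inj h3
    rw [← opp_back, ← opp_front, ho₁.opp, ho₁.opp] at h1
    · exact Bool.not_inj h1
    · rw [front_fst]; exact hbx.symm
    · rw [back_fst]; exact hbx.symm
  obtain ⟨⟨v, p⟩, hp⟩ := Arc.exists (P := P) xS (P.front s x)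
  obtain rfl : v = b.1 := atb hp lx hox
  obtain ⟨⟨v, p'⟩, hp'⟩ := Arc.exists (P := P) xS (P.back s x)
  obtain rfl : v = b.1 := atb hp' lx' hox.symm
  have fx : (P.front s x).1 = x.1 := front_fst s x
  have fy : (P.front s y).1 = y.1 := front_fst s y
  have bx : (P.back s x).1 = x.1 := back_fst s x
  have by' : (P.back s y).1 = y.1 := back_fst s y
  have fxS := fx.symm ▸ xS
  have fyS := fy.symm ▸ yS
  have bxS := bx.symm ▸ xS
  have byS := by'.symm ▸ yS
  -- The two ends of both loops arrive at `b` by four different branches, hence by all of them. Thus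
  -- each loop passes through `b` exactly once.
  have mates : ∀ r : P.Dart, r.1 = b.1 →
      ∃ g : P.Dart, g.1 ∈ ({x.1, y.1} : Set P.V) ∧ P.Arc {x.1, y.1, b.1} r g := by
    rintro ⟨v, r⟩ hv
    obtain rfl : v = b.1 := hv
    have hxy := h.1
    rcases eq_of_four_ne p p' q q' r
      (fun e => by subst e; exact front_ne_back s x (hp.injective hp' fxS bxS))
      (fun e => by
        subst e; have := congrArg Prod.fst (hp.injective hq fxS fyS)
        rw [fx, fy] at this; exact hxy this)
      (fun e => by
        subst e; have := congrArg Prod.fst (hp.injective hq' fxS byS)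
        rw [fx, by'] at this; exact hxy this)
      (fun e => by
        subst e; have := congrArg Prod.fst (hp'.injective hq bxS fyS)
        rw [bx, fy] at this; exact hxy this)
      (fun e => by
        subst e; have := congrArg Prod.fst (hp'.injective hq' bxS byS)
        rw [bx, by'] at this; exact hxy this)
      (fun e => by subst e; exact front_ne_back s y (hq.injective hq' fyS byS))
      with rfl | rfl | rfl | rfl
    · exact ⟨_, Or.inl fx, hp.symm fxS⟩
    · exact ⟨_, Or.inl bx, hp'.symm bxS⟩
    · exact ⟨_, Or.inr fy, hq.symm fyS⟩
    · exact ⟨_, Or.inr by', hq'.symm byS⟩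
  have half : ∀ {d d' e : P.Dart}, P.Arc {x.1, y.1} d d' → P.Arc {x.1, y.1, b.1} d e →
      e.1 = b.1 → P.Arc {x.1, y.1, b.1} d' (P.opp e) := fun {d d' e} hdd hde he => by
    obtain ⟨g, hg, hr⟩ := mates (P.opp e) he
    have h1 := (hde.coarsen hsub).2 (fun h => bS' (he ▸ h)) g ((hr.coarsen hsub).1 hg)
    rw [hdd.unique h1]
    refine hr.symm ?_
    rw [opp_fst, he]; exact bS
  have hloops : P.LoopsCrossingAt b.1 s x y :=
    ⟨p, q, hp, half lx hp rfl, hq, half ly hq rfl⟩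
  rcases hpair' with h' | h'
  · exact Or.inr ⟨x, y, b.1, h, hbx, hby, Or.inl ⟨s, hloops, h'⟩⟩
  · exact Or.inr ⟨x, y, b.1, h, hbx, hby, Or.inr ⟨s, hloops, h'⟩⟩

/-! ### Moving the crossing of the loops onto the circle. -/

theorem exists_touchingCircle {x y : P.Dart} (h : P.TwoCircle x y)
    (lx : P.Arc {x.1, y.1} (P.front false x) (P.back false x))
    (ly : P.Arc {x.1, y.1} (P.front false y) (P.back false y)) :
    ∃ c, P.TouchingCircle x y c ∧ P.LoopsCrossingAt c false x y ∧
      (P.ParallelPair {x.1, y.1} true x y → P.ParallelPair {x.1, y.1, c} true x y) ∧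
      (P.CrossedPair {x.1, y.1} true x y → P.CrossedPair {x.1, y.1, c} true x y) := by
  obtain ⟨col, ha, hb, hx, hy⟩ := h.sides
  have xS₂ : x.1 ∈ ({x.1, y.1} : Set P.V) := Or.inl rfl
  have lx' := lx.symm (by rw [front_fst]; exact Or.inl rfl)
  have ly' := ly.symm (by rw [front_fst]; exact Or.inr rfl)
  have const : ∀ {d e : P.Dart}, P.Arc {x.1, y.1} d e → col e = col d :=
    fun h => h.const ha fun d hd => hb d hd 2
  -- `X v d` means that the curve from `d` first meets the circle at `v`. On the side of the loops
  -- this says that `d` belongs to the loop at `v`.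
  obtain ⟨X, hX⟩ : ∃ X : P.V → P.Dart → Prop,
    ∀ v d, X v d ↔ ∃ e, P.Arc {x.1, y.1} d e ∧ e.1 = v := ⟨_, fun _ _ => Iff.rfl⟩
  have X_edge : ∀ d v, col d = false → X v d → X v (P.edge d) := fun d v hd hXd => by
    rw [hX] at hXd ⊢
    obtain ⟨e, he, hev⟩ := hXd
    obtain ⟨f, hf⟩ := Arc.exists (P := P) xS₂ (P.edge d)
    refine ⟨f, hf, ?_⟩
    have hef := he.extend hf
    have hce := (const he).trans hd
    rcases he.mem with hm | hm
    · rcases eq_front_or_back hx hm hce with rfl | rfl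
      · rw [hef.unique lx, ← hev, front_fst, back_fst]
      · rw [hef.unique lx', ← hev, front_fst, back_fst]
    · rcases eq_front_or_back hy hm hce with rfl | rfl
      · rw [hef.unique ly, ← hev, front_fst, back_fst]
      · rw [hef.unique ly', ← hev, front_fst, back_fst]
  have X_opp : ∀ d v, d.1 ∉ ({x.1, y.1} : Set P.V) → col d = false → X v d → X v (P.opp d) :=
    fun d v hd hc hXd => by
      have h1 := X_edge d v hc hXd
      rw [hX] at h1 ⊢
      obtain ⟨e, he, hev⟩ := h1
      obtain ⟨g, hg⟩ := Arc.exists (P := P) xS₂ (P.opp d)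
      have h2 : P.Arc {x.1, y.1} (P.edge d) g :=
        Arc.pass _ _ (by rwa [P.edge_edge]) (by rwa [P.edge_edge])
      exact ⟨g, hg, by rw [h2.unique he, hev]⟩
  have X_front : ∀ d, (P.edge d).1 ∈ ({x.1, y.1} : Set P.V) → X x.1 d → (P.edge d).1 = x.1 :=
    fun d hd h1 => by
      obtain ⟨e, he, hev⟩ := (hX _ _).mp h1
      rw [← hev, he.unique (Arc.arrive d hd)]
  have X_or : ∀ d, X x.1 d ∨ X y.1 d := fun d => by
    obtain ⟨f, hf⟩ := Arc.exists (P := P) xS₂ d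
    rcases hf.mem with hm | hm
    · exact Or.inl ((hX _ _).mpr ⟨f, hf, hm⟩)
    · exact Or.inr ((hX _ _).mpr ⟨f, hf, hm⟩)
  have X_not : ∀ d, X x.1 d → ¬ X y.1 d := fun d h1 h2 => by
    obtain ⟨e, he, hev⟩ := (hX _ _).mp h1
    obtain ⟨f, hf, hfv⟩ := (hX _ _).mp h2
    rw [he.unique hf, hfv] at hev
    exact h.1 hev.symm
  have edge_eq : ∀ d, P.edge d = P.turn 1 (P.faceStep d) := fun d => by
    rw [faceStep_apply, turn_turn, (by decide : (-1 + 1 : ZMod 4) = 0), turn_zero]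
  -- On the face that the circle traverses from `x` to `y`, the boundary walk starts on the loop at
  -- `x` and ends on the loop at `y`. Otherwise the whole walk would stay on the loop at `x`. At the
  -- first change, two neighbouring branches belong to different loops, and the circle can be pushed
  -- to touch the double point there.
  obtain ⟨w, hwS, hxw, hcw, hw1, hw0⟩ : ∃ w : P.Dart, w.1 ∉ ({x.1, y.1} : Set P.V) ∧
      P.SameFace x w ∧ col w = false ∧ X x.1 (P.turn 1 w) ∧ ¬ X x.1 w := by
    by_contra hnone
    have step : ∀ z, col z = false ∧ X x.1 z → P.SameFace x z →
        col (P.faceStep z) = false ∧ X x.1 (P.faceStep z) := by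
      rintro z ⟨hz, hXz⟩ hxz
      have hf : P.SameFace x (P.faceStep z) := SameFace.trans hxz (sameFace_faceStep z)
      have hcol : col (P.edge z) = false := (ha z).trans hz
      by_cases hm : (P.edge z).1 ∈ ({x.1, y.1} : Set P.V)
      · have h2 := X_front z hm hXz
        rcases eq_front_or_back hx h2 hcol with h3 | h3
        · have h4 : P.faceStep z = P.back false x := by
            rw [faceStep_apply, h3, front_false, turn_zero]; rfl
          rw [h4]
          exact ⟨(hx _).2, (hX _ _).mpr ⟨_, lx', front_fst _ _⟩⟩
        · have h4 : P.faceStep z = P.opp x := by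
            rw [faceStep_apply, h3, back_false, turn_turn]; rfl
          rw [h4] at hf
          exact absurd (hf.trans h.2.2.1.symm) h.2.2.2
      · have h2 : col (P.faceStep z) = false := by
          rw [faceStep_apply, hb _ hm, hcol]
        refine ⟨h2, ?_⟩
        by_contra h3
        refine hnone ⟨_, ?_, hf, h2, ?_, h3⟩
        · rw [faceStep_apply, turn_fst]; exact hm
        · rw [← edge_eq]; exact X_edge z _ hz hXz
    obtain ⟨z, ⟨hz, hXz⟩, -, hzy⟩ := h.2.1.walk
      (fun e => h.1 (by rw [e, opp_fst])) (fun z => col z = false ∧ X x.1 z)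
      ⟨by have := (hx false).1; rwa [front_false, turn_zero] at this,
        (hX _ _).mpr ⟨_, by rwa [front_false, turn_zero] at lx, back_fst _ _⟩⟩
      fun z h1 h2 _ _ => step z h1 h2
    have h1 := X_front z (by rw [edge_eq, hzy]; exact Or.inr rfl) hXz
    rw [edge_eq, hzy] at h1
    exact h.1 h1.symm
  have hcol : ∀ d : P.Dart, d.1 = w.1 → col d = false := fun d hd => by
    have h1 := hb w hwS (d.2 - w.2)
    rwa [← eq_turn hd, hcw] at h1
  have hsub := pair_subset_triple x.1 y.1 w.1
  have xS : x.1 ∈ ({x.1, y.1, w.1} : Set P.V) := Or.inl rfl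
  have yS : y.1 ∈ ({x.1, y.1, w.1} : Set P.V) := Or.inr (Or.inl rfl)
  have wS : w.1 ∈ ({x.1, y.1, w.1} : Set P.V) := Or.inr (Or.inr rfl)
  have const' : ∀ {d e : P.Dart}, P.Arc {x.1, y.1, w.1} d e → col e = col d :=
    fun h => h.const ha fun d hd => hb d (fun h => hd (hsub h)) 2
  have mem_of_ne : ∀ {g : P.Dart}, g.1 ∈ ({x.1, y.1, w.1} : Set P.V) → g.1 ≠ w.1 →
      g.1 ∈ ({x.1, y.1} : Set P.V) := fun {g} hg hne => by
    rcases hg with h | h | h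
    · exact Or.inl h
    · exact Or.inr h
    · exact absurd h hne
  have hw3 : ∀ r v, r.1 = w.1 → X v r → X v (P.opp r) := fun r v hr hXr =>
    X_opp r v (hr ▸ hwS) (hcol r hr) hXr
  -- Only `r` and `opp r` at `w` belong to the loop of `v`. An arc returning to `w` would end at `r`
  -- itself, against the alternation of directions, or at `opp r`, closing up a component.
  have mate : ∀ r v, r.1 = w.1 → X v r →
      (∀ g : P.Dart, g.1 = w.1 → X v g → g = r ∨ g = P.opp r) →
      ∃ g : P.Dart, P.Arc {x.1, y.1, w.1} g r ∧ g.1 = v ∧ col g = false := by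
    intro r v hr hXr honly
    obtain ⟨g, hg⟩ := Arc.exists (P := P) xS r
    have hgw : g.1 ≠ w.1 := fun hgw => by
      have hXg : X v g := by
        have h1 : X v (P.opp g) := by
          rw [hX] at hXr ⊢
          obtain ⟨f, hf⟩ := Arc.exists (P := P) xS₂ (P.opp g)
          obtain ⟨e, he, hev⟩ := hXr
          refine ⟨f, hf, ?_⟩
          rw [← hev, he.unique ((hg.coarsen hsub).2 (hgw ▸ hwS) f hf)]
        have h2 := hw3 _ _ (by rw [opp_fst, hgw]) h1
        rwa [opp_opp] at h2
      rcases honly g hgw hXg with rfl | rfl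
      · exact hg.irrefl
      · exact hg.ne_opp (hr ▸ wS) xS (fun h => hwS (Or.inl (hr ▸ h.symm)))
    refine ⟨g, hg.symm (hr ▸ wS), ?_, (const' hg).trans (hcol r hr)⟩
    obtain ⟨e, he, hev⟩ := (hX _ _).mp hXr
    rw [← hev, he.unique ((hg.coarsen hsub).1 (mem_of_ne hg.mem hgw))]
  have loops : ∀ (u r : P.Dart), (∀ s, col (P.front s u) = s ∧ col (P.back s u) = s) →
      u.1 ∈ ({x.1, y.1, w.1} : Set P.V) → r.1 = w.1 → X u.1 r →
      (∀ g : P.Dart, g.1 = w.1 → X u.1 g → g = r ∨ g = P.opp r) →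
      ∃ p : ZMod 4, P.Arc {x.1, y.1, w.1} (P.front false u) (w.1, p) ∧
        P.Arc {x.1, y.1, w.1} (P.back false u) (w.1, p + 2) := by
    rintro u ⟨v, p⟩ hu huS hr hXr honly
    obtain rfl : v = w.1 := hr
    obtain ⟨g, hg, hgu, hgc⟩ := mate (w.1, p) _ rfl hXr honly
    obtain ⟨g', hg', hgu', hgc'⟩ := mate (P.opp (w.1, p)) u.1 rfl (hw3 _ _ rfl hXr)
      (fun g h1 h2 => by rw [opp_opp]; exact (honly g h1 h2).symm)
    have hne : g ≠ g' := fun e => by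
      subst e; exact opp_ne _ (hg'.unique hg)
    rcases eq_front_or_back hu hgu hgc with rfl | rfl <;>
      rcases eq_front_or_back hu hgu' hgc' with rfl | rfl
    · exact absurd rfl hne
    · exact ⟨p, hg, hg'⟩
    · refine ⟨p + 2, hg', ?_⟩
      rwa [add_assoc, (by decide : (2 + 2 : ZMod 4) = 0), add_zero]
    · exact absurd rfl hne
  have turns : ∀ g : P.Dart, g.1 = w.1 →
      g = w ∨ g = P.turn 1 w ∨ g = P.opp w ∨ g = P.opp (P.turn 1 w) := fun g hg => by
    rcases eq_turn_cases hg with h | h | h | h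
    · exact Or.inl h
    · exact Or.inr (Or.inl h)
    · exact Or.inr (Or.inr (Or.inl h))
    · refine Or.inr (Or.inr (Or.inr ?_))
      rw [h, opp_turn]; rfl
  have hw0' : X y.1 w := (X_or w).resolve_left hw0
  obtain ⟨p, hp, hp'⟩ := loops x (P.turn 1 w) hx xS rfl hw1 fun g hg hXg => by
    rcases turns g hg with rfl | rfl | rfl | rfl
    · exact absurd hXg hw0
    · exact Or.inl rfl
    · exact absurd (hw3 w _ rfl hw0') (X_not _ hXg)
    · exact Or.inr rfl
  obtain ⟨q, hq, hq'⟩ := loops y w hy yS rfl hw0' fun g hg hXg => by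
    rcases turns g hg with rfl | rfl | rfl | rfl
    · exact Or.inl rfl
    · exact absurd hXg (X_not _ hw1)
    · exact Or.inr rfl
    · exact absurd hXg (X_not _ (hw3 _ _ rfl hw1))
  have fine : ∀ {d e : P.Dart}, col d = true → P.Arc {x.1, y.1} d e →
      P.Arc {x.1, y.1, w.1} d e := fun {d e} hd he => he.refine hsub xS fun f hf =>
    mem_of_ne hf.mem fun hfw => by
      have h1 := const' hf
      rw [hd, hcol f hfw] at h1
      exact absurd h1 (by decide)
  exact ⟨w.1, ⟨h, fun e => hwS (Or.inl e), fun e => hwS (Or.inr e), w.2, hxw⟩,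
    ⟨p, q, hp, hp', hq, hq'⟩, fun h' => ⟨fine (hx _).1 h'.1, fine (hx _).2 h'.2⟩,
    fun h' => ⟨fine (hx _).1 h'.1, fine (hx _).2 h'.2⟩⟩

/-- Reversing the circle exchanges its sides, so the loops may be taken on the right. -/
theorem hasThreePointCircle_of_loops {x y : P.Dart} (h : P.TwoCircle x y) (s : Bool)
    (lx : P.Arc {x.1, y.1} (P.front s x) (P.back s x))
    (ly : P.Arc {x.1, y.1} (P.front s y) (P.back s y))
    (hpair : P.ParallelPair {x.1, y.1} (!s) x y ∨ P.CrossedPair {x.1, y.1} (!s) x y) :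
    P.HasThreePointCircle := by
  obtain ⟨x', y', h', lx', ly', hpair'⟩ : ∃ x y : P.Dart, P.TwoCircle x y ∧
      P.Arc {x.1, y.1} (P.front false x) (P.back false x) ∧
      P.Arc {x.1, y.1} (P.front false y) (P.back false y) ∧
      (P.ParallelPair {x.1, y.1} true x y ∨ P.CrossedPair {x.1, y.1} true x y) := by
    cases s
    · exact ⟨x, y, h, lx, ly, hpair⟩
    · refine ⟨P.opp x, P.opp y, h.opp, ?_, ?_, ?_⟩
      · rw [front_opp, back_opp]
        exact lx.symm (Or.inl rfl)
      · rw [front_opp, back_opp]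
        exact ly.symm (Or.inr rfl)
      · rw [ParallelPair, CrossedPair]
        simp only [front_opp, back_opp]
        exact hpair.imp And.symm And.symm
  obtain ⟨c, hc, hl, h1, h2⟩ := exists_touchingCircle h' lx' ly'
  exact Or.inr ⟨x', y', c, hc, hpair'.imp (fun h => ⟨false, hl, h1 h⟩) fun h => ⟨false, hl, h2 h⟩⟩

/-- The given crossing is forgotten, which leaves two loops; another crossing, possibly a different
double point, is then found on a face traversed by the circle. -/
theorem HasThreePointDisk.hasThreePointCircle (h : P.HasThreePointDisk) :
    P.HasThreePointCircle := by
  rcases h with h | ⟨x, y, c, h, hcx, hcy, h'⟩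
  · exact Or.inl h
  have hsub := pair_subset_triple x.1 y.1 c
  have hc : c ∉ ({x.1, y.1} : Set P.V) := fun h => h.elim hcx hcy
  have loop : ∀ {d e : P.Dart} {p : ZMod 4}, P.Arc {x.1, y.1, c} d (c, p) →
      P.Arc {x.1, y.1, c} e (c, p + 2) → e.1 ∈ ({x.1, y.1} : Set P.V) →
      P.Arc {x.1, y.1} d e := fun {d e p} h1 h2 he =>
    (h1.coarsen hsub).2 hc e (((h2.symm (hsub he)).coarsen hsub).1 he)
  have bx : ∀ s, (P.back s x).1 ∈ ({x.1, y.1} : Set P.V) := fun s => by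
    rw [back_fst]; exact Or.inl rfl
  have by' : ∀ s, (P.back s y).1 ∈ ({x.1, y.1} : Set P.V) := fun s => by
    rw [back_fst]; exact Or.inr rfl
  have fy : ∀ s, (P.front s y).1 ∈ ({x.1, y.1} : Set P.V) := fun s => by
    rw [front_fst]; exact Or.inr rfl
  rcases h' with ⟨s, ⟨p, q, h1, h2, h3, h4⟩, h5⟩ | ⟨s, ⟨p, q, h1, h2, h3, h4⟩, h5⟩
  · exact hasThreePointCircle_of_loops h s (loop h1 h2 (bx s)) (loop h3 h4 (by' s))
      (Or.inl ⟨(h5.1.coarsen hsub).1 (by' _), (h5.2.coarsen hsub).1 (fy _)⟩)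
  · exact hasThreePointCircle_of_loops h s (loop h1 h2 (bx s)) (loop h3 h4 (by' s))
      (Or.inr ⟨(h5.1.coarsen hsub).1 (fy _), (h5.2.coarsen hsub).1 (by' _)⟩)

/-! ### Assembling the equivalences. -/

theorem hasThreePointDisk_of_reductivity_eq_two (hP : P.IsReduced) (h : P.reductivity = 2) :
    ¬ P.HasTwoPointCircle ∧ P.HasThreePointDisk := by
  obtain ⟨h1, Q, R, hPQ, hQR, v, i, hi⟩ := (reductivity_eq_two_iff hP).mp h
  have hno : ¬ P.HasTwoPointCircle := fun h2 => h1 ((hasTwoPointCircle_iff hP).mp h2)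
  refine ⟨hno, ?_⟩
  have hQ : Q.IsReduced := fun hQ => h1 ((reductivity_eq_one_iff hP).mpr ⟨Q, hPQ, hQ⟩)
  obtain ⟨b, o, ho, hb, ⟨s⟩⟩ := (isNonSeifertSplice_iff hP Q).mp hPQ
  obtain ⟨b₂, o', ho', hb₂, ⟨t⟩⟩ := (isNonSeifertSplice_iff hQ R).mp hQR
  obtain ⟨y, hy, hT⟩ := twoCircle_of_nugatory hQ t hi
  have hy' : Q.NonSeifert o' y := by
    rcases hy with rfl | rfl
    · exact hb₂
    · exact (nonSeifert_opp ho').mpr hb₂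
  obtain ⟨o₁, ho₁, hoo⟩ := exists_splicedOrientation hP s ho'
  have heq : ∀ t, o₁ (P.front t (s.incl y)) = o₁ (P.back t (s.incl y)) := fun t => by
    rw [← incl_front, ← incl_back, hoo, hoo]
    exact (nonSeifert_iff ho' t y).mp hy'
  rcases circle_of_splice hP s hT with hT' | ⟨c, hc, hT'⟩
  · exact hasThreePointDisk_of_twoCircle hT' hno (s.incl_fst_ne _).symm (s.incl_fst_ne _).symm
      ho₁ heq
  · have hc1 : P.NonSeifert o c := by
      rcases hc with rfl | rfl
      · exact hb
      · exact (nonSeifert_opp ho).mpr hb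
    have hc2 : P.SplicedOrientation c o₁ := by
      rcases hc with rfl | rfl
      · exact ho₁
      · exact SplicedOrientation.opp_iff.mpr ho₁
    rcases hT' with hT' | hT'
    · exact Or.inl (hasTriangleCircle_of_splices hT' ho hc1 hc2 heq)
    -- Reversing the circle puts the first spliced point in second place and the second spliced
    -- point in third place.
    · refine Or.inl (hasTriangleCircle_of_splices hT'.opp ho ((nonSeifert_opp ho).mpr hc1)
        (SplicedOrientation.opp_iff.mpr hc2) fun t => ?_)
      rw [front_opp, back_opp, heq]

end KnotProjection

theorem theoremr2 (P : KnotProjection) (hP : P.IsReduced) :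
    (P.HasTwoPointCircle ↔ P.reductivity = 1) ∧
    (P.reductivity = 2 ↔ ¬ P.HasTwoPointCircle ∧ P.HasThreePointCircle) ∧
    (P.reductivity = 2 ↔ ¬ P.HasTwoPointCircle ∧ P.HasThreePointDisk) := by
  have h1 := KnotProjection.hasTwoPointCircle_iff hP
  have h2 : P.reductivity = 2 ↔ ¬ P.HasTwoPointCircle ∧ P.HasThreePointDisk :=
    ⟨KnotProjection.hasThreePointDisk_of_reductivity_eq_two hP, fun h =>
      (h.2.reductivity hP).resolve_left fun h' => h.1 (h1.mpr h')⟩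
  exact ⟨h1, h2.trans (and_congr_right fun _ =>
    ⟨fun h => h.hasThreePointCircle, fun h => h.hasThreePointDisk⟩), h2⟩
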